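/- **Setting.** Let $n,T\ge 1$, let $\mathcal K\subset\mathbb R^n$ be non-empty, convex and compact with $\mathcal K\subseteq R\mathcal B$, where $\mathcal B$ is the closed Euclidean unit ball and $R>0$, and let $G,\alpha>0$, $\beta\ge 0$. The losses $f_1,\dots,f_T$ are differentiable over $3R\mathcal B$, and for all $x,y\in 3R\mathcal B$ and all $t$: $\|\nabla f_t(x)\|\le G$; $\|\nabla f_t(x)-\nabla f_t(y)\|\le\beta\|x-y\|$; and (curvature condition) for every $\eta'\ge\max\{12GR,2/\alpha\}$, $$f_t(x)-f_t(y)\le\nabla f_t(x)^\top(x-y)-\tfrac1{2\eta'}\big(\nabla f_t(x)^\top(x-y)\big)^2 .$$ The set $\mathcal K$ is accessed through a linear optimization oracle (LOO), which returns, for $g\in\mathbb R^n$, some $v\in\arg\min_{v\in\mathcal K}v^\top g$. Write $\|x\|_A^2=x^\top Ax$, and $[n]=\{1,\dots,n\}$. **Algorithm.** Its data are $T$, a block length $K$ (an integer that divides $T$), $\eta,\epsilon_I,\epsilon>0$ and a point $x_1\in\mathcal K$. Put $\tilde y_1=x_1$ and $A_0=\epsilon_I I_n$. For $m=1,\dots,T/K$: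 in the rounds $t=(m-1)K+1,\dots,mK$ play $x^t=x_m$ and compute $\nabla_t=\nabla f_t(\tilde y_m)$; put $\bar\nabla_m=\sum_{t=(m-1)K+1}^{mK}\nabla_t$, $A_m=A_{m-1}+\bar\nabla_m\bar\nabla_m^\top$, $y_{m+1}=\tilde y_m-\eta A_m^{-1}\bar\nabla_m$; and let $(x_{m+1},\tilde y_{m+1})$ be the output of the following procedure with $A=A_m$, started at $u_0=x_m$, $w_1=y_{m+1}$. * *Approximately feasible projection.* If $\|u_0-w_1\|_A^2\le3\epsilon$, return $(u_0,w_1)$. Otherwise, for $i=1,2,\dots$, let $u_i$ be the output of the next procedure, started at $u_{i-1}$ with the target $w_i$; if $\|u_i-w_i\|_A^2\le3\epsilon$, return $(u_i,w_i)$; else put $w_{i+1}=w_i-\frac23(w_i-u_i)$. * *Frank–Wolfe with target $w$, started at $z_1\in\mathcal K$.* For $j=1,2,\dots$, let $v_j\in\arg\min_{z\in\mathcal K}(z_j-w)^\top Az$ (one LOO call); if $(z_j-w)^\top A(z_j-v_j)\le\epsilon$ or $\|z_j-w\|_A^2\le3\epsilon$, return $z_j$; else put $z_{j+1}=z_j+\sigma_j(v_j-z_j)$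 with $\sigma_j\in\arg\min_{\sigma\in[0,1]}\|w-z_j-\sigma(v_j-z_j)\|_A^2$. Let $\mathcal R_T=\sum_{t=1}^Tf_t(x^t)-\min_{x\in\mathcal K}\sum_{t=1}^Tf_t(x)$ be the regret, $\lambda_i(\cdot)$ the $i$-th largest eigenvalue, and $\Omega_\rho=\sum_{i=\rho+1}^n\lambda_i\big(\sum_{t=1}^T\nabla_t\nabla_t^\top\big)$. For $d\in[n]$, the *$d$-tuning* is $$K=4d^{-1/3}T^{2/3},\quad \eta=8\max\{6GR,\tfrac1\alpha\}d^{-1/3}T^{2/3},\quad \epsilon_I=32G^2T^{4/3},$$ $$\epsilon=96G^2R^2\log\Big(19+8\big(12+\tfrac1{3R^2G^2\alpha^2}\big)d^{-4/3}T^{1/3}\Big)T,$$ where it is assumed that this $K$ is an integer that divides $T$. **Theorem.** There is a universal constant $c>0$ with the following properties. Put $\ell=\log\big((c+\frac c{R^2G^2\alpha^2})T^{1/3}\big)$ and $T_0(d)=c\log^3\big(c+(c+\frac c{R^2G^2\alpha^2})d^{-4/3}T^{1/3}\big)$. 1. If $T\ge T_0(n)$, then with the $n$-tuning the algorithm terminates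 and $$\mathcal R_T\le 9\beta R^2T^{2/3}\ell+2RGn^{1/3}T^{2/3}+\big(36GR+\tfrac4\alpha\big)n^{2/3}T^{2/3}\ell .$$ 2. Under the same conditions and with the same parameters, for every $\rho\in[n]$, $$\mathcal R_T\le 9\beta R^2T^{2/3}\ell+2RGn^{1/3}T^{2/3}+36GR\rho^{1/2}n^{1/6}T^{2/3}\ell+\tfrac4\alpha\rho n^{-1/3}T^{2/3}\log(cT^{1/3})+5RT^{1/3}\sqrt{\Omega_\rho}\sqrt{\ell}+\frac{3GR+\frac1{2\alpha}}{G^2n^{2/3}}\Omega_\rho .$$ 3. Let $\rho\in[n]$. If $T\ge T_0(\rho)$, then with the $\rho$-tuning the algorithm terminates and $$\mathcal R_T\le 9\beta R^2T^{2/3}\ell+2RG\rho^{1/3}T^{2/3}+\big(36GR+\tfrac4\alpha\big)\rho^{2/3}T^{2/3}\ell+5RT^{1/3}\sqrt{\Omega_\rho}\sqrt{\ell}+\frac{3GR+\frac1{2\alpha}}{\rho^{2/3}G^2}\Omega_\rho .$$ In all cases the parameters satisfy $\eta\ge\max\{12KGR,\frac{2K}\alpha\}$, $\epsilon_I\ge(KG)^2$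 and $\frac{3\epsilon}{\epsilon_I}\le4R^2$; the total number of LOO calls is at most $0.65\,(8n^{1/3}T^{2/3}+T)$; and the algorithm can be implemented, by one fixed program for a real RAM (unit cost arithmetic and comparisons of real numbers; the work inside the LOO and the gradient oracle is not counted), with $O(n^2)$ memory cells and additional running time $O\big(n^2(T+n^{1/3}T^{2/3})\big)$, where the constants in $O(\cdot)$ are universal. -/

import Mathlib

open scoped InnerProductSpace

noncomputable section

/-- `ℝⁿ` with the Euclidean norm. -/
abbrev Vec (n : ℕ) := EuclideanSpace ℝ (Fin n)

/-- Real `n × n` matrices. -/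
abbrev Mat (n : ℕ) := Matrix (Fin n) (Fin n) ℝ

/-- The matrix-vector product `A x`. -/
def Mat.app {n : ℕ} (A : Mat n) (x : Vec n) : Vec n :=
  WithLp.toLp 2 (A.mulVec (WithLp.ofLp x))

/-- The outer product `u uᵀ`. -/
def outer {n : ℕ} (u : Vec n) : Mat n :=
  Matrix.vecMulVec (WithLp.ofLp u) (WithLp.ofLp u)

/-- The squared matrix norm `‖x‖_A² = xᵀ A x`. -/
def normSq {n : ℕ} (A : Mat n) (x : Vec n) : ℝ := ⟪x, A.app x⟫_ℝ

/-! ### The problem: online optimization with a linear optimization oracle -/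

/-- `f` is differentiable over `C`, with gradients bounded in norm by `G`. -/
def HasGradBound {n : ℕ} (f : Vec n → ℝ) (C : Set (Vec n)) (G : ℝ) : Prop :=
  DifferentiableOn ℝ f C ∧ ∀ x ∈ C, ‖gradientWithin f C x‖ ≤ G

/-- `f` is `β`-smooth over `C`. -/
def IsSmoothOver {n : ℕ} (f : Vec n → ℝ) (C : Set (Vec n)) (β : ℝ) : Prop :=
  ∀ x ∈ C, ∀ y ∈ C, ‖gradientWithin f C x - gradientWithin f C y‖ ≤ β * ‖x - y‖

/-- The curvature condition with parameter `α` over a set `C` of radius `r`, for a function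
whose gradients over `C` are bounded by `G`. -/
def CurvatureCondition {n : ℕ} (f : Vec n → ℝ) (C : Set (Vec n)) (r G α : ℝ) : Prop :=
  ∀ η : ℝ, max (4 * G * r) (2 / α) ≤ η → ∀ x ∈ C, ∀ y ∈ C,
    f x - f y ≤ ⟪gradientWithin f C x, x - y⟫_ℝ
      - 1 / (2 * η) * ⟪gradientWithin f C x, x - y⟫_ℝ ^ 2

/-- The assumptions on the feasible set `S` and the losses; the rounds are `t = 0, …, T - 1`.
The values of the losses outside the ball of radius `3R` are irrelevant. -/
structure OCOSetup {n : ℕ} (S : Set (Vec n)) (R G α β : ℝ) (T : ℕ) (f : ℕ → Vec n → ℝ) :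
    Prop where
  convex : Convex ℝ S
  compact : IsCompact S
  nonempty : S.Nonempty
  subset_ball : S ⊆ Metric.closedBall 0 R
  R_pos : 0 < R
  G_pos : 0 < G
  α_pos : 0 < α
  β_nonneg : 0 ≤ β
  gradBound : ∀ t < T, HasGradBound (f t) (Metric.closedBall 0 (3 * R)) G
  smooth : ∀ t < T, IsSmoothOver (f t) (Metric.closedBall 0 (3 * R)) β
  curvature : ∀ t < T, CurvatureCondition (f t) (Metric.closedBall 0 (3 * R)) (3 * R) G α

/-- The gradient of the loss of round `t`. -/
def lossGrad {n : ℕ} (R : ℝ) (f : ℕ → Vec n → ℝ) (t : ℕ) (x : Vec n) : Vec n :=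
  gradientWithin (f t) (Metric.closedBall 0 (3 * R)) x

/-- A linear optimization oracle for `S`. The answer may depend on the running number `k` of the
call, so that ties may be broken differently in different calls. -/
def IsLOO {n : ℕ} (S : Set (Vec n)) (loo : ℕ → Vec n → Vec n) : Prop :=
  ∀ k g, loo k g ∈ S ∧ ∀ x ∈ S, ⟪loo k g, g⟫_ℝ ≤ ⟪x, g⟫_ℝ

/-- `r` is the regret of the plays `x 0, …, x (T - 1)` with respect to `S`. -/
def IsRegret {n : ℕ} (S : Set (Vec n)) (T : ℕ) (f : ℕ → Vec n → ℝ) (x : ℕ → Vec n) (r : ℝ) :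
    Prop :=
  ∃ z ∈ S, IsMinOn (fun w => ∑ t ∈ Finset.range T, f t w) S z ∧
    r = ∑ t ∈ Finset.range T, f t (x t) - ∑ t ∈ Finset.range T, f t z

/-! ### The algorithm -/

/-- The stopping test of the Frank-Wolfe subroutine at the iterate `x`, with `v` the answer of
the oracle. -/
def FWStop {n : ℕ} (A : Mat n) (ε : ℝ) (y x v : Vec n) : Prop :=
  ⟪x - y, A.app (x - v)⟫_ℝ ≤ ε ∨ normSq A (x - y) ≤ 3 * ε

/-- `SepHyperplane loo A ε y k x k' x'`: the generalized separating hyperplane subroutine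
(Frank-Wolfe with line search for `‖x - y‖_A²`), started at the feasible point `x` after `k` oracle
calls in total, returns `x'` after `k'` oracle calls in total. -/
inductive SepHyperplane {n : ℕ} (loo : ℕ → Vec n → Vec n) (A : Mat n) (ε : ℝ) (y : Vec n) :
    ℕ → Vec n → ℕ → Vec n → Prop
  | halt {k : ℕ} {x : Vec n} (h : FWStop A ε y x (loo k (A.app (x - y)))) :
      SepHyperplane loo A ε y k x (k + 1) x
  | step {k : ℕ} {x v : Vec n} {σ : ℝ} {k' : ℕ} {x' : Vec n}
      (hv : v = loo k (A.app (x - y)))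
      (h : ¬ FWStop A ε y x v)
      (hσ : σ ∈ Set.Icc (0 : ℝ) 1)
      (hmin : IsMinOn (fun s : ℝ => normSq A (y - x - s • (v - x))) (Set.Icc 0 1) σ)
      (next : SepHyperplane loo A ε y (k + 1) (x + σ • (v - x)) k' x') :
      SepHyperplane loo A ε y k x k' x'

/-- The main loop of the approximately feasible projection, with step size `γ = 2/3`:
from `(x_{i-1}, y_i)` after `k` oracle calls to the returned pair after `k'` oracle calls. -/
inductive ProjLoop {n : ℕ} (loo : ℕ → Vec n → Vec n) (A : Mat n) (ε : ℝ) :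
    ℕ → Vec n → Vec n → ℕ → Vec n → Vec n → Prop
  | ret {k : ℕ} {x y : Vec n} {k' : ℕ} {x' : Vec n}
      (sep : SepHyperplane loo A ε y k x k' x')
      (h : normSq A (x' - y) ≤ 3 * ε) :
      ProjLoop loo A ε k x y k' x' y
  | pull {k : ℕ} {x y : Vec n} {k₁ : ℕ} {x₁ : Vec n} {k' : ℕ} {x' y' : Vec n}
      (sep : SepHyperplane loo A ε y k x k₁ x₁)
      (h : 3 * ε < normSq A (x₁ - y))
      (next : ProjLoop loo A ε k₁ x₁ (y - (2 / 3 : ℝ) • (y - x₁)) k' x' y') :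
      ProjLoop loo A ε k x y k' x' y'

/-- `ApproxProj loo A ε k x₀ y₁ k' x y`: the approximately feasible projection, called
with the feasible point `x₀` and the point `y₁` after `k` oracle calls in total, returns `(x, y)`
after `k'` oracle calls in total. -/
def ApproxProj {n : ℕ} (loo : ℕ → Vec n → Vec n) (A : Mat n) (ε : ℝ)
    (k : ℕ) (x₀ y₁ : Vec n) (k' : ℕ) (x y : Vec n) : Prop :=
  (normSq A (x₀ - y₁) ≤ 3 * ε ∧ k' = k ∧ x = x₀ ∧ y = y₁) ∨
    (3 * ε < normSq A (x₀ - y₁) ∧ ProjLoop loo A ε k x₀ y₁ k' x y)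

/-- The input data of the algorithm, apart from the oracles. -/
structure Params (n : ℕ) where
  /-- horizon -/
  T : ℕ
  /-- block length -/
  K : ℕ
  /-- learning rate -/
  η : ℝ
  /-- initialization parameter -/
  εI : ℝ
  /-- error tolerance -/
  ε : ℝ
  /-- initial point -/
  x₁ : Vec n

/-- What the algorithm computes: the blocks are numbered `m = 0, …, T/K - 1`, so `x m`, `y m` are
the points `x_{m+1}`, `ỹ_{m+1}` of the usual numbering from `1`; `A m` is the matrix after the first
`m` blocks, and `calls m` the number of oracle calls made up to the end of the first `m` blocks. -/
structure Run (n : ℕ) where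
  x : ℕ → Vec n
  y : ℕ → Vec n
  A : ℕ → Mat n
  calls : ℕ → ℕ

/-- The sum of the gradients at the (infeasible) point `y m` of the losses of block `m`. -/
def blockGrad {n : ℕ} (grad : ℕ → Vec n → Vec n) (K : ℕ) (r : Run n) (m : ℕ) : Vec n :=
  ∑ s ∈ Finset.range K, grad (m * K + s) (r.y m)

/-- `r` is a run of the Online Newton Step without feasibility, with the exact update
`A_m = A_{m-1} + ∇̄_m ∇̄_mᵀ`, in which projections are replaced by the approximately feasible
projection above, warm-started at the previous feasible point. -/
structure IsRun {n : ℕ} (grad : ℕ → Vec n → Vec n) (loo : ℕ → Vec n → Vec n) (p : Params n)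
    (r : Run n) : Prop where
  x_zero : r.x 0 = p.x₁
  y_zero : r.y 0 = p.x₁
  A_zero : r.A 0 = p.εI • (1 : Mat n)
  calls_zero : r.calls 0 = 0
  A_succ : ∀ m < p.T / p.K, r.A (m + 1) = r.A m + outer (blockGrad grad p.K r m)
  proj : ∀ m < p.T / p.K,
    ApproxProj loo (r.A (m + 1)) p.ε (r.calls m) (r.x m)
      (r.y m - p.η • Mat.app (r.A (m + 1))⁻¹ (blockGrad grad p.K r m))
      (r.calls (m + 1)) (r.x (m + 1)) (r.y (m + 1))

/-- The point played in round `t` (rounds and blocks are numbered from `0`). -/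
def Run.played {n : ℕ} (r : Run n) (K : ℕ) (t : ℕ) : Vec n := r.x (t / K)

/-- The matrix `∑ₜ ∇ₜ ∇ₜᵀ`, where `∇ₜ` is the gradient computed in round `t`, at `ỹ`. -/
def gradCov {n : ℕ} (grad : ℕ → Vec n → Vec n) (p : Params n) (r : Run n) : Mat n :=
  ∑ t ∈ Finset.range p.T, outer (grad t (r.y (t / p.K)))

theorem gradCov_isHermitian {n : ℕ} (grad : ℕ → Vec n → Vec n) (p : Params n) (r : Run n) :
    (gradCov grad p r).IsHermitian := by
  ext i j
  simp [gradCov, outer, Matrix.sum_apply, Matrix.vecMulVec_apply, mul_comm]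

/-- `Ω_ρ`: the sum of all but the `ρ` largest eigenvalues of `∑ₜ ∇ₜ ∇ₜᵀ`
(`eigenvalues₀` lists the eigenvalues in decreasing order, starting with index `0`). -/
def tailEigenvalues {n : ℕ} (grad : ℕ → Vec n → Vec n) (p : Params n) (r : Run n) (ρ : ℕ) : ℝ :=
  ∑ i : Fin (Fintype.card (Fin n)),
    if ρ ≤ (i : ℕ) then (gradCov_isHermitian grad p r).eigenvalues₀ i else 0

/-! ### The choice of parameters

In the following, `d` is `n` for the dimension-dependent tuning, and `ρ` for the other one. -/

/-- The required block length `4 d^{-1/3} T^{2/3}`. -/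
def blockLength (d T : ℕ) : ℝ := 4 * (d : ℝ) ^ (-(1 / 3) : ℝ) * (T : ℝ) ^ (2 / 3 : ℝ)

/-- The parameters as functions of `T`, `G`, `R`, `α` and `d`. -/
def tuned {n : ℕ} (d T K : ℕ) (G R α : ℝ) (x₁ : Vec n) : Params n where
  T := T
  K := K
  η := 8 * max (6 * G * R) (1 / α) * (d : ℝ) ^ (-(1 / 3) : ℝ) * (T : ℝ) ^ (2 / 3 : ℝ)
  εI := 32 * G ^ 2 * (T : ℝ) ^ (4 / 3 : ℝ)
  ε := 96 * G ^ 2 * R ^ 2 *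
    Real.log (19 + 8 * (12 + 1 / (3 * R ^ 2 * G ^ 2 * α ^ 2)) *
      (d : ℝ) ^ (-(4 / 3) : ℝ) * (T : ℝ) ^ (1 / 3 : ℝ)) * T
  x₁ := x₁

/-- The threshold `T₀`, in which the horizon `T` itself occurs. -/
def horizonThreshold (c : ℝ) (d T : ℕ) (G R α : ℝ) : ℝ :=
  c * Real.log (c + (c + c / (R ^ 2 * G ^ 2 * α ^ 2)) *
    (d : ℝ) ^ (-(4 / 3) : ℝ) * (T : ℝ) ^ (1 / 3 : ℝ)) ^ 3

/-- The logarithmic factor of the regret bounds. -/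
def logFactor (c : ℝ) (T : ℕ) (G R α : ℝ) : ℝ :=
  Real.log ((c + c / (R ^ 2 * G ^ 2 * α ^ 2)) * (T : ℝ) ^ (1 / 3 : ℝ))

/-- The general requirements on the parameters. -/
def Params.Admissible {n : ℕ} (p : Params n) (G R α : ℝ) : Prop :=
  max (12 * p.K * G * R) (2 * p.K / α) ≤ p.η ∧ (p.K * G) ^ 2 ≤ p.εI ∧
    0 < p.ε ∧ 3 * p.ε / p.εI ≤ 4 * R ^ 2

/-! ### The cost model: a real RAM with oracles

A program has finitely many integer registers, which hold counters and addresses, and a memory of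
real cells, which is addressed through the integer registers. Elementary instructions and tests
have cost `1`. An instruction that hands over a vector of length `n` (playing a point, asking for
a gradient, asking the linear optimization oracle) has cost `n + 1`; the work inside the oracles is
not counted. -/

namespace RealRAM

inductive ArithOp
  | add
  | sub
  | mul
  | div

def ArithOp.eval : ArithOp → ℝ → ℝ → ℝ
  | .add, a, b => a + b
  | .sub, a, b => a - b
  | .mul, a, b => a * b
  | .div, a, b => a / b

/-- Programs. All operands `i j k a b d` are numbers of integer registers; an operand that stands
for a real number or a vector is the register that holds its (first) address. -/
inductive Cmd
  | skip
  | seq (s s' : Cmd)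
  /-- `reg i := c` -/
  | natConst (i c : ℕ)
  /-- `reg i := reg j + reg k` -/
  | natAdd (i j k : ℕ)
  /-- `reg i := reg j - reg k`, truncated at `0` -/
  | natSub (i j k : ℕ)
  /-- `mem (reg d) := q` -/
  | realConst (d : ℕ) (q : ℚ)
  /-- `mem (reg d) := mem (reg a)` -/
  | realCopy (d a : ℕ)
  /-- `mem (reg d) := mem (reg a) op mem (reg b)` -/
  | realOp (op : ArithOp) (d a b : ℕ)
  /-- if `reg i < reg j` then `s` else `s'` -/
  | ifNatLt (i j : ℕ) (s s' : Cmd)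
  /-- if `mem (reg a) ≤ mem (reg b)` then `s` else `s'` -/
  | ifRealLe (a b : ℕ) (s s' : Cmd)
  /-- while `reg i < reg j` do `s` -/
  | whileNatLt (i j : ℕ) (s : Cmd)
  /-- play the vector at address `reg a`; the next loss function is then revealed -/
  | play (a : ℕ)
  /-- write to address `reg d` the gradient, at the vector at address `reg a`, of the loss function
  revealed last -/
  | grad (d a : ℕ)
  /-- write to address `reg d` the answer of the linear optimization oracle to the vector at
  address `reg a` -/
  | loo (d a : ℕ)

/-- The environment of a program: the gradients of the loss functions on their domain, and the
linear optimization oracle. -/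
structure Env (n : ℕ) where
  dom : Set (Vec n)
  grad : ℕ → Vec n → Vec n
  loo : ℕ → Vec n → Vec n

structure State (n : ℕ) where
  reg : ℕ → ℕ
  mem : ℕ → ℝ
  /-- the points played so far -/
  plays : List (Vec n)
  /-- the number of oracle calls so far -/
  looCalls : ℕ
  /-- the total cost so far -/
  time : ℕ
  /-- all memory cells used so far have addresses below this number -/
  space : ℕ

/-- The vector stored at the addresses `a, …, a + n - 1`. -/
def readVec {n : ℕ} (mem : ℕ → ℝ) (a : ℕ) : Vec n := WithLp.toLp 2 fun i => mem (a + i)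

/-- The memory after `v` has been stored at the addresses `a, …, a + n - 1`. -/
def writeVec {n : ℕ} (mem : ℕ → ℝ) (a : ℕ) (v : Vec n) : ℕ → ℝ := fun j =>
  if h : a ≤ j ∧ j < a + n then v ⟨j - a, by omega⟩ else mem j

/-- Cost `c` has been incurred. -/
def State.tick {n : ℕ} (s : State n) (c : ℕ) : State n := { s with time := s.time + c }

/-- Cells at addresses below `b` have been used. -/
def State.touch {n : ℕ} (s : State n) (b : ℕ) : State n := { s with space := max s.space b }

def State.setReg {n : ℕ} (s : State n) (i v : ℕ) : State n :=
  { s with reg := Function.update s.reg i v }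

def State.setMem {n : ℕ} (s : State n) (a : ℕ) (v : ℝ) : State n :=
  ({ s with mem := Function.update s.mem a v }).touch (a + 1)

def State.setVec {n : ℕ} (s : State n) (a : ℕ) (v : Vec n) : State n :=
  ({ s with mem := writeVec s.mem a v }).touch (a + n)

/-- `Exec env P s s'`: the program `P`, started in the state `s`, halts in the state `s'`. An
execution is stuck if it divides by zero, asks for a gradient before the first round is played, or
asks for a gradient outside the domain of the loss functions. -/
inductive Exec {n : ℕ} (env : Env n) : Cmd → State n → State n → Prop
  | skip (s : State n) : Exec env .skip s s
  | seq {P Q : Cmd} {s s₁ s₂ : State n} (hP : Exec env P s s₁) (hQ : Exec env Q s₁ s₂) :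
      Exec env (.seq P Q) s s₂
  | natConst (i c : ℕ) (s : State n) : Exec env (.natConst i c) s ((s.setReg i c).tick 1)
  | natAdd (i j k : ℕ) (s : State n) :
      Exec env (.natAdd i j k) s ((s.setReg i (s.reg j + s.reg k)).tick 1)
  | natSub (i j k : ℕ) (s : State n) :
      Exec env (.natSub i j k) s ((s.setReg i (s.reg j - s.reg k)).tick 1)
  | realConst (d : ℕ) (q : ℚ) (s : State n) :
      Exec env (.realConst d q) s ((s.setMem (s.reg d) (q : ℝ)).tick 1)
  | realCopy (d a : ℕ) (s : State n) :
      Exec env (.realCopy d a) s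
        (((s.setMem (s.reg d) (s.mem (s.reg a))).touch (s.reg a + 1)).tick 1)
  | realOp (op : ArithOp) (d a b : ℕ) (s : State n)
      (hdiv : op = .div → s.mem (s.reg b) ≠ 0) :
      Exec env (.realOp op d a b) s
        ((((s.setMem (s.reg d) (op.eval (s.mem (s.reg a)) (s.mem (s.reg b)))).touch
          (s.reg a + 1)).touch (s.reg b + 1)).tick 1)
  | ifNatLt_true {i j : ℕ} {P Q : Cmd} {s s' : State n} (h : s.reg i < s.reg j)
      (hP : Exec env P (s.tick 1) s') : Exec env (.ifNatLt i j P Q) s s'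
  | ifNatLt_false {i j : ℕ} {P Q : Cmd} {s s' : State n} (h : ¬ s.reg i < s.reg j)
      (hQ : Exec env Q (s.tick 1) s') : Exec env (.ifNatLt i j P Q) s s'
  | ifRealLe_true {a b : ℕ} {P Q : Cmd} {s s' : State n} (h : s.mem (s.reg a) ≤ s.mem (s.reg b))
      (hP : Exec env P (((s.touch (s.reg a + 1)).touch (s.reg b + 1)).tick 1) s') :
      Exec env (.ifRealLe a b P Q) s s'
  | ifRealLe_false {a b : ℕ} {P Q : Cmd} {s s' : State n}
      (h : ¬ s.mem (s.reg a) ≤ s.mem (s.reg b))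
      (hQ : Exec env Q (((s.touch (s.reg a + 1)).touch (s.reg b + 1)).tick 1) s') :
      Exec env (.ifRealLe a b P Q) s s'
  | while_true {i j : ℕ} {P : Cmd} {s s₁ s₂ : State n} (h : s.reg i < s.reg j)
      (hP : Exec env P (s.tick 1) s₁) (hW : Exec env (.whileNatLt i j P) s₁ s₂) :
      Exec env (.whileNatLt i j P) s s₂
  | while_false {i j : ℕ} {P : Cmd} {s : State n} (h : ¬ s.reg i < s.reg j) :
      Exec env (.whileNatLt i j P) s (s.tick 1)
  | play (a : ℕ) (s : State n) :
      Exec env (.play a) s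
        ((({ s with plays := s.plays ++ [readVec s.mem (s.reg a)] }).touch (s.reg a + n)).tick
          (n + 1))
  | grad (d a : ℕ) (s : State n) (hplay : s.plays ≠ [])
      (hdom : readVec s.mem (s.reg a) ∈ env.dom) :
      Exec env (.grad d a) s
        (((s.setVec (s.reg d) (env.grad (s.plays.length - 1) (readVec s.mem (s.reg a)))).touch
          (s.reg a + n)).tick (n + 1))
  | loo (d a : ℕ) (s : State n) :
      Exec env (.loo d a) s
        ((({ s.setVec (s.reg d) (env.loo s.looCalls (readVec s.mem (s.reg a))) with
          looCalls := s.looCalls + 1 }).touch (s.reg a + n)).tick (n + 1))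

/-- The initial state: registers `0, 1, 2` hold `n`, `T`, `K`; cells `0, 1, 2` hold `η`, `ε_I`,
`ε`, and the next `n` cells hold the initial point. -/
def initState {n : ℕ} (p : Params n) : State n where
  reg := fun i => if i = 0 then n else if i = 1 then p.T else if i = 2 then p.K else 0
  mem := writeVec (fun j => if j = 0 then p.η else if j = 1 then p.εI else
    if j = 2 then p.ε else 0) 3 p.x₁
  plays := []
  looCalls := 0
  time := 0
  space := n + 3

/-- The program `P` carries out the run `r` of the algorithm with the parameters `p`: it halts after
at most `time` steps, uses at most `space` real memory cells, plays the points of the run, in this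
order, and makes exactly the oracle calls of the run. -/
def Implements {n : ℕ} (P : Cmd) (env : Env n) (p : Params n) (r : Run n) (time space : ℝ) :
    Prop :=
  ∃ s : State n, Exec env P (initState p) s ∧
    s.plays = (List.range p.T).map (r.played p.K) ∧
    s.looCalls = r.calls (p.T / p.K) ∧
    (s.time : ℝ) ≤ time ∧ (s.space : ℝ) ≤ space

end RealRAM

/-- The bounds on the resources of a run: the number of oracle calls, and the additional time and
space of the program `P` that carries it out. -/
def ResourceBounds {n : ℕ} (P : RealRAM.Cmd) (C R : ℝ) (f : ℕ → Vec n → ℝ)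
    (loo : ℕ → Vec n → Vec n) (p : Params n) (r : Run n) : Prop :=
  (r.calls (p.T / p.K) : ℝ) ≤
      0.65 * (8 * (n : ℝ) ^ (1 / 3 : ℝ) * (p.T : ℝ) ^ (2 / 3 : ℝ) + p.T) ∧
    RealRAM.Implements P ⟨Metric.closedBall 0 (3 * R), lossGrad R f, loo⟩ p r
      (C * ((n : ℝ) ^ 2 * (p.T + (n : ℝ) ^ (1 / 3 : ℝ) * (p.T : ℝ) ^ (2 / 3 : ℝ))))
      (C * (n : ℝ) ^ 2)

end

/-! ### Matrix-vector products and matrix norms -/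

section LinearAlgebra

variable {n : ℕ}

/-! On a block, playing the feasible `x m` is compared with the infeasible `y m`, and `y m` with the
best point `z`. For the second comparison the curvature condition, summed over the block, gives the
linearised loss minus a square with coefficient `1 / (2η)`. The rank-one growth of `A` costs exactly
this square (`newton_step`). So the squared distances to `z`, each measured in its own matrix,
telescope, and what remains is `η / 2` times the growth of `log det A`. The projection fits in
because a pull towards a separated feasible point never increases the `A`-distance to a feasible
point (`normSq_pull_le`).

The first comparison is controlled by `‖x m - y m‖_A² ≤ 3ε`. Since `A` dominates `εI`, this bounds
the Euclidean distance, hence the smoothness error, and keeps `y m` inside the ball of radius `3R`.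
The linear term is handled by Cauchy-Schwarz, in the geometry of `A` and over the blocks, and is
again paid by `log det A`. `regret_le` collects these bounds.

The growth of `log det A` is bounded by a weighted Hadamard inequality in an eigenbasis of the
gradient covariance (`log_det_le_tail`). One weight serves the `ρ` leading directions and yields `ρ`
times a logarithm; another serves the remaining directions, which contribute linearly through the
tail of the spectrum. The dimension-dependent bound is the case `ρ = n`, where the tail is empty.

For the oracle calls, Frank-Wolfe with line search has the potential `16D / (error + 2ε)`. It gains
at least `1` per unsuccessful test once the error is at most `D`, and never exceeds `8D / ε`. Each
pull divides the squared distance to the target by `9`, so logarithmically many Frank-Wolfe runs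
suffice. The logarithm in the tuned `ε` matches that number and cancels it in the final count
(`tuned_calls_arith`).

The resource claim is proved by an explicit program. It maintains the inverse matrix by the
Sherman-Morrison formula and flattens the nested projection loops into one loop with exactly one
oracle call per pass, so quadratic work per round, block and call suffices. It reproduces any given
run because the line search has a unique minimiser whenever a step is made (`line_search_unique`).
-/

theorem Mat.app_add (A : Mat n) (x y : Vec n) : A.app (x + y) = A.app x + A.app y := by
  ext i; simp [Mat.app, Matrix.mulVec_add]

theorem Mat.app_smul (A : Mat n) (c : ℝ) (x : Vec n) : A.app (c • x) = c • A.app x := by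
  ext i; simp [Mat.app, Matrix.mulVec_smul]

theorem Mat.app_neg (A : Mat n) (x : Vec n) : A.app (-x) = -A.app x := by
  ext i; simp [Mat.app, Matrix.mulVec_neg]

theorem Mat.add_app (A B : Mat n) (x : Vec n) : Mat.app (A + B) x = A.app x + B.app x := by
  ext i; simp [Mat.app, Matrix.add_mulVec]

theorem Mat.smul_one_app (c : ℝ) (x : Vec n) : Mat.app (c • (1 : Mat n)) x = c • x := by
  ext i; simp [Mat.app, Matrix.smul_mulVec]

theorem Mat.app_app (A B : Mat n) (x : Vec n) : A.app (B.app x) = Mat.app (A * B) x := by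
  ext i; simp [Mat.app]

theorem inner_eq_dotProduct (x y : Vec n) : ⟪x, y⟫_ℝ = x.ofLp ⬝ᵥ y.ofLp := by
  simp [PiLp.inner_apply, dotProduct, mul_comm]

theorem outer_app (u x : Vec n) : (outer u).app x = ⟪u, x⟫_ℝ • u := by
  rw [inner_eq_dotProduct]
  ext i
  simp [Mat.app, outer, Matrix.vecMulVec_mulVec]

theorem inner_app_comm {A : Mat n} (hA : A.IsHermitian) (x y : Vec n) :
    ⟪A.app x, y⟫_ℝ = ⟪x, A.app y⟫_ℝ := by
  have h : A.transpose = A := by rw [← Matrix.conjTranspose_eq_transpose_of_trivial]; exact hA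
  rw [inner_eq_dotProduct, inner_eq_dotProduct]
  simp only [Mat.app]
  rw [Matrix.dotProduct_mulVec, ← Matrix.mulVec_transpose, h]

theorem normSq_smul (A : Mat n) (c : ℝ) (x : Vec n) : normSq A (c • x) = c ^ 2 * normSq A x := by
  simp only [normSq, Mat.app_smul, real_inner_smul_left, real_inner_smul_right]; ring

theorem normSq_neg (A : Mat n) (x : Vec n) : normSq A (-x) = normSq A x := by
  simp [normSq, Mat.app_neg]

theorem normSq_sub_comm (A : Mat n) (x y : Vec n) : normSq A (x - y) = normSq A (y - x) := by
  rw [← normSq_neg, neg_sub]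

theorem normSq_add {A : Mat n} (hA : A.IsHermitian) (x y : Vec n) :
    normSq A (x + y) = normSq A x + 2 * ⟪x, A.app y⟫_ℝ + normSq A y := by
  simp only [normSq, Mat.app_add, inner_add_left, inner_add_right]
  rw [← inner_app_comm hA y x, real_inner_comm (A.app y) x]; ring

theorem normSq_sub {A : Mat n} (hA : A.IsHermitian) (x y : Vec n) :
    normSq A (x - y) = normSq A x - 2 * ⟪x, A.app y⟫_ℝ + normSq A y := by
  rw [sub_eq_add_neg, normSq_add hA, normSq_neg, Mat.app_neg, inner_neg_right]; ring

theorem normSq_smul_one (c : ℝ) (x : Vec n) : normSq (c • (1 : Mat n)) x = c * ‖x‖ ^ 2 := by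
  simp [normSq, Mat.smul_one_app, real_inner_smul_right]

theorem normSq_add_outer (A : Mat n) (u x : Vec n) :
    normSq (A + outer u) x = normSq A x + ⟪u, x⟫_ℝ ^ 2 := by
  simp only [normSq, Mat.add_app, outer_app, inner_add_right, real_inner_smul_right]
  rw [real_inner_comm x u]; ring

theorem outer_isHermitian (u : Vec n) : (outer u).IsHermitian := by
  ext i j
  simp [outer, Matrix.vecMulVec_apply, mul_comm]

/-- The Cauchy-Schwarz inequality for a positive semidefinite matrix. -/
theorem inner_app_sq_le {A : Mat n} (hA : A.IsHermitian) (hpsd : ∀ x, 0 ≤ normSq A x)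
    (x y : Vec n) : ⟪x, A.app y⟫_ℝ ^ 2 ≤ normSq A x * normSq A y := by
  have h : ∀ t : ℝ, 0 ≤ normSq A x * (t * t) + (2 * ⟪x, A.app y⟫_ℝ) * t + normSq A y := by
    intro t
    have := hpsd (t • x + y)
    rw [normSq_add hA, normSq_smul, real_inner_smul_left] at this
    nlinarith
  have := discrim_le_zero h
  rw [discrim] at this
  nlinarith

theorem continuous_normSq (A : Mat n) : Continuous (normSq A) := by
  unfold normSq Mat.app
  have h : Continuous fun x : Vec n => WithLp.toLp 2 (A.mulVec (WithLp.ofLp x)) :=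
    (PiLp.continuous_toLp 2 _).comp
      ((Continuous.matrix_mulVec continuous_const continuous_id).comp
        (PiLp.continuous_ofLp 2 _))
  exact continuous_id.inner h

end LinearAlgebra

/-! ### Frank-Wolfe and the approximately feasible projection -/

section Projection

variable {n : ℕ} {S : Set (Vec n)} {loo : ℕ → Vec n → Vec n} {A : Mat n} {ε : ℝ}

/-- Along the segment the objective is a parabola in the step size whose slope at `0` is minus twice
the Frank-Wolfe gap. -/
theorem normSq_line {A : Mat n} (hA : A.IsHermitian) (x y v : Vec n) (s : ℝ) :
    normSq A (y - x - s • (v - x)) =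
      normSq A (x - y) - 2 * s * ⟪x - y, A.app (x - v)⟫_ℝ + s ^ 2 * normSq A (x - v) := by
  have : y - x - s • (v - x) = -((x - y) - s • (x - v)) := by module
  rw [this, normSq_neg, normSq_sub hA, normSq_smul, Mat.app_smul, real_inner_smul_right]; ring

/-- The Frank-Wolfe gap dominates the gap towards every feasible point. -/
theorem inner_le_loo_gap (hA : A.IsHermitian) (hloo : IsLOO S loo) (k : ℕ) (x y : Vec n)
    {z : Vec n} (hz : z ∈ S) :
    ⟪x - y, A.app (x - z)⟫_ℝ ≤ ⟪x - y, A.app (x - loo k (A.app (x - y)))⟫_ℝ := by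
  have h := (hloo k (A.app (x - y))).2 z hz
  rw [← inner_app_comm hA, ← inner_app_comm hA, inner_sub_right, inner_sub_right,
    real_inner_comm z, real_inner_comm (loo k (A.app (x - y)))]
  linarith

/-- Convexity: expand around `x` and drop the nonnegative `‖x - z‖_A²`. The factor `2` appears
because the objective is the squared norm, without a factor one half. -/
theorem sub_le_two_mul_loo_gap (hA : A.IsHermitian) (hpsd : ∀ x, 0 ≤ normSq A x)
    (hloo : IsLOO S loo) (k : ℕ) (x y : Vec n) {z : Vec n} (hz : z ∈ S) :
    normSq A (x - y) - normSq A (z - y) ≤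
      2 * ⟪x - y, A.app (x - loo k (A.app (x - y)))⟫_ℝ := by
  have h1 := inner_le_loo_gap hA hloo k x y hz
  have h2 : z - y = (x - y) - (x - z) := by abel
  have h3 := hpsd (x - z)
  rw [h2, normSq_sub hA (x - y) (x - z)]; linarith

/-- One Frank-Wolfe step with line search. -/
theorem line_search_le (hA : A.IsHermitian) {x y v : Vec n} {σ D : ℝ}
    (hmin : IsMinOn (fun s : ℝ => normSq A (y - x - s • (v - x))) (Set.Icc 0 1) σ)
    (hD : normSq A (x - v) ≤ D) {s : ℝ} (hs : s ∈ Set.Icc (0 : ℝ) 1) :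
    normSq A (x + σ • (v - x) - y) ≤
      normSq A (x - y) - 2 * s * ⟪x - y, A.app (x - v)⟫_ℝ + s ^ 2 * D := by
  have h1 := hmin hs
  simp only [Set.mem_ofPred_eq] at h1
  rw [normSq_line hA x y v s] at h1
  have h2 : x + σ • (v - x) - y = -(y - x - σ • (v - x)) := by abel
  rw [h2, normSq_neg]
  nlinarith [sq_nonneg s]

theorem exists_line_search (A : Mat n) (x y v : Vec n) :
    ∃ σ ∈ Set.Icc (0 : ℝ) 1,
      IsMinOn (fun s : ℝ => normSq A (y - x - s • (v - x))) (Set.Icc 0 1) σ := by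
  refine isCompact_Icc.exists_isMinOn ⟨0, by simp⟩ ?_
  exact ((continuous_normSq A).comp (by fun_prop)).continuousOn

theorem line_mem (hS : Convex ℝ S) {x v : Vec n} (hx : x ∈ S) (hv : v ∈ S) {σ : ℝ}
    (hσ : σ ∈ Set.Icc (0 : ℝ) 1) : x + σ • (v - x) ∈ S := by
  have := hS hx hv (sub_nonneg.2 hσ.2) hσ.1 (by ring)
  convert this using 1; module

/-- The potential `16 D / (δ + 2 ε)` of the Frank-Wolfe method, where `δ` is the primal error,
increases by at least `1` in each step. -/
theorem fw_potential {δ δ' g D ε : ℝ} (hε : 0 < ε) (hD : ε ≤ D) (hδ : 0 ≤ δ) (hδD : δ ≤ D)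
    (hδ' : 0 ≤ δ') (hg : ε < g) (hδg : δ ≤ 2 * g)
    (hstep : ∀ s ∈ Set.Icc (0 : ℝ) 1, δ' ≤ δ - 2 * s * g + s ^ 2 * D) :
    δ' ≤ D ∧ 16 * D / (δ + 2 * ε) + 1 ≤ 16 * D / (δ' + 2 * ε) := by
  have hDpos : 0 < D := hε.trans_le hD
  set q := δ + 2 * ε with hq
  have hqpos : 0 < q := by positivity
  -- This step minimises the upper bound once the gap is replaced by its lower bound `q / 4`. It is
  -- admissible because `q ≤ 3D`.
  have hs := hstep (q / (4 * D)) ⟨by positivity, by rw [div_le_one (by positivity)]; linarith⟩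
  have hgq : q / 4 ≤ g := by linarith
  have h1 : δ' ≤ δ - q ^ 2 / (16 * D) := by
    have e1 : 2 * (q / (4 * D)) * (q / 4) ≤ 2 * (q / (4 * D)) * g := by gcongr
    have e2 : 2 * (q / (4 * D)) * (q / 4) - (q / (4 * D)) ^ 2 * D = q ^ 2 / (16 * D) := by
      field_simp; ring
    linarith
  have hdec : 0 ≤ q ^ 2 / (16 * D) := by positivity
  refine ⟨by linarith, ?_⟩
  have hq' : 0 < δ' + 2 * ε := by positivity
  rw [le_div_iff₀ hq']
  have h2 : δ' + 2 * ε ≤ q - q ^ 2 / (16 * D) := by linarith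
  -- With `u = q / (16 D)` this is `(1 + u)(1 - u) ≤ 1`.
  calc (16 * D / q + 1) * (δ' + 2 * ε) ≤ (16 * D / q + 1) * (q - q ^ 2 / (16 * D)) := by gcongr
    _ = 16 * D - q ^ 2 / (16 * D) := by field_simp; ring
    _ ≤ 16 * D := by linarith

/-- What one unsuccessful test and the following Frank-Wolfe step achieve. -/
theorem fw_step (hA : A.IsHermitian) (hpsd : ∀ x, 0 ≤ normSq A x) (hloo : IsLOO S loo)
    (hS : Convex ℝ S) {D : ℝ} (hε : 0 < ε) (hD : ε ≤ D)
    (hdiam : ∀ u ∈ S, ∀ v ∈ S, normSq A (u - v) ≤ D) {x y v z : Vec n} {k : ℕ} {σ : ℝ}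
    (hx : x ∈ S) (hz : z ∈ S) (hzmin : IsMinOn (fun u => normSq A (u - y)) S z)
    (hv : v = loo k (A.app (x - y))) (h : ¬ FWStop A ε y x v) (hσ : σ ∈ Set.Icc (0 : ℝ) 1)
    (hmin : IsMinOn (fun s : ℝ => normSq A (y - x - s • (v - x))) (Set.Icc 0 1) σ) :
    x + σ • (v - x) ∈ S ∧ normSq A (x + σ • (v - x) - y) ≤ normSq A (x - y) ∧
      normSq A (x + σ • (v - x) - y) - normSq A (z - y) ≤ D ∧
      (normSq A (x - y) - normSq A (z - y) ≤ D →
        16 * D / (normSq A (x - y) - normSq A (z - y) + 2 * ε) + 1 ≤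
          16 * D / (normSq A (x + σ • (v - x) - y) - normSq A (z - y) + 2 * ε)) := by
  have hvS : v ∈ S := hv ▸ (hloo k _).1
  have hx' : x + σ • (v - x) ∈ S := line_mem hS hx hvS hσ
  simp only [FWStop, not_or, not_le] at h
  have hgap := sub_le_two_mul_loo_gap hA hpsd hloo k x y hz
  rw [← hv] at hgap
  have hstep : ∀ s ∈ Set.Icc (0 : ℝ) 1, _ := fun s hs =>
    line_search_le hA hmin (hdiam x hx v hvS) hs
  -- Step size `0` shows monotonicity. Step size `1` brings the error below `D` from any starting
  -- point, since the error is at most twice the gap.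
  have h0 := hstep 0 (by simp)
  have h1 := hstep 1 (by simp)
  simp only [mul_zero, zero_mul, mul_one, one_mul, one_pow] at h0 h1
  refine ⟨hx', by linarith, by linarith, fun hδ => ?_⟩
  exact (fw_potential hε hD (sub_nonneg.2 (hzmin hx)) hδ (sub_nonneg.2 (hzmin hx')) h.1 hgap
    fun s hs => by linarith [hstep s hs]).2

theorem exists_nearest (hc : IsCompact S) (hne : S.Nonempty) (A : Mat n) (y : Vec n) :
    ∃ z ∈ S, IsMinOn (fun u => normSq A (u - y)) S z :=
  hc.exists_isMinOn hne ((continuous_normSq A).comp (by fun_prop)).continuousOn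

/-- The guarantees for the output of the Frank-Wolfe subroutine. -/
theorem SepHyperplane.spec (hA : A.IsHermitian)
    (hloo : IsLOO S loo) (hS : Convex ℝ S) {x y x' : Vec n} {k k' : ℕ}
    (h : SepHyperplane loo A ε y k x k' x') (hx : x ∈ S) :
    x' ∈ S ∧ normSq A (x' - y) ≤ normSq A (x - y) ∧ k < k' ∧
      ((∀ z ∈ S, ⟪x' - y, A.app (x' - z)⟫_ℝ ≤ ε) ∨ normSq A (x' - y) ≤ 3 * ε) := by
  induction h with
  | halt h =>
    refine ⟨hx, le_rfl, Nat.lt_succ_self _, ?_⟩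
    rcases h with h | h
    · exact Or.inl fun z hz => (inner_le_loo_gap hA hloo _ _ _ hz).trans h
    · exact Or.inr h
  | @step k x v σ k' x' hv h hσ hmin next ih =>
    have hvS : v ∈ S := hv ▸ (hloo k _).1
    obtain ⟨h1, h2, h3, h4⟩ := ih (line_mem hS hx hvS hσ)
    have h0 := line_search_le hA hmin le_rfl (s := 0) (by simp)
    simp only [mul_zero, zero_mul] at h0
    exact ⟨h1, by linarith, by omega, h4⟩

/-- The potential rises by at least `1` per step and stays below `8D / ε`, so the number of steps is
at most the room left to it. The extra `1` is the oracle call of the successful test. -/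
theorem SepHyperplane.calls_le_of_near (hA : A.IsHermitian) (hpsd : ∀ x, 0 ≤ normSq A x)
    (hloo : IsLOO S loo) (hS : Convex ℝ S) {D : ℝ} (hε : 0 < ε) (hD : ε ≤ D)
    (hdiam : ∀ u ∈ S, ∀ v ∈ S, normSq A (u - v) ≤ D) {x y x' z : Vec n} {k k' : ℕ}
    (hz : z ∈ S) (hzmin : IsMinOn (fun u => normSq A (u - y)) S z)
    (h : SepHyperplane loo A ε y k x k' x') (hx : x ∈ S)
    (hδ : normSq A (x - y) - normSq A (z - y) ≤ D) :
    (k' : ℝ) ≤ k + 1 + 8 * D / ε - 16 * D / (normSq A (x - y) - normSq A (z - y) + 2 * ε) := by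
  have hDpos : 0 < D := hε.trans_le hD
  induction h with
  | @halt k x h =>
    have h0 : 0 ≤ normSq A (x - y) - normSq A (z - y) := sub_nonneg.2 (hzmin hx)
    have : 16 * D / (normSq A (x - y) - normSq A (z - y) + 2 * ε) ≤ 16 * D / (2 * ε) := by
      gcongr; linarith
    have e : 16 * D / (2 * ε) = 8 * D / ε := by field_simp; ring
    push_cast; linarith
  | @step k x v σ k' x' hv h hσ hmin next ih =>
    obtain ⟨h1, h2, h3, h4⟩ := fw_step hA hpsd hloo hS hε hD hdiam hx hz hzmin hv h hσ hmin
    have h5 := ih h1 h3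
    have h6 := h4 hδ
    push_cast at h5; linarith

/-- The number of oracle calls of the Frank-Wolfe subroutine. -/
theorem SepHyperplane.calls_le (hA : A.IsHermitian) (hpsd : ∀ x, 0 ≤ normSq A x)
    (hloo : IsLOO S loo) (hS : Convex ℝ S) (hc : IsCompact S) {D : ℝ} (hε : 0 < ε) (hD : ε ≤ D)
    (hdiam : ∀ u ∈ S, ∀ v ∈ S, normSq A (u - v) ≤ D) {x y x' : Vec n} {k k' : ℕ}
    (h : SepHyperplane loo A ε y k x k' x') (hx : x ∈ S) :
    (k' : ℝ) ≤ k + 2 + 8 * D / ε := by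
  have hDpos : 0 < D := hε.trans_le hD
  obtain ⟨z, hz, hzmin⟩ := exists_nearest hc ⟨x, hx⟩ A y
  -- The first step is counted separately: the target may be far away, so the error is known to be
  -- at most `D` only after one step.
  cases h with
  | halt h =>
    have : 0 ≤ 8 * D / ε := by positivity
    push_cast; linarith
  | step hv h hσ hmin next =>
    obtain ⟨h1, h2, h3, -⟩ := fw_step hA hpsd hloo hS hε hD hdiam hx hz hzmin hv h hσ hmin
    have h5 := next.calls_le_of_near hA hpsd hloo hS hε hD hdiam hz hzmin h1 h3
    have h6 : 0 ≤ normSq A (x + _ • (_ - x) - y) - normSq A (z - y) := sub_nonneg.2 (hzmin h1)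
    have : 0 ≤ 16 * D / (normSq A (x + _ • (_ - x) - y) - normSq A (z - y) + 2 * ε) :=
      div_nonneg (by positivity) (by linarith)
    push_cast at h5; linarith

/-- Frank-Wolfe terminates. -/
theorem SepHyperplane.exists_output (hA : A.IsHermitian) (hpsd : ∀ x, 0 ≤ normSq A x)
    (hloo : IsLOO S loo) (hS : Convex ℝ S) (hc : IsCompact S) (hε : 0 < ε) {x : Vec n}
    (hx : x ∈ S) (y : Vec n) (k : ℕ) : ∃ k' x', SepHyperplane loo A ε y k x k' x' := by
  obtain ⟨z, hz, hzmin⟩ := exists_nearest hc ⟨x, hx⟩ A y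
  -- The maximum with `ε` is needed because the set may be smaller than the tolerance.
  obtain ⟨D, hD, hdiam⟩ : ∃ D, ε ≤ D ∧ ∀ u ∈ S, ∀ v ∈ S, normSq A (u - v) ≤ D := by
    obtain ⟨D, hD⟩ := ((hc.prod hc).image_of_continuousOn
      (f := fun p : Vec n × Vec n => normSq A (p.1 - p.2))
      ((continuous_normSq A).comp (by fun_prop)).continuousOn).bddAbove
    refine ⟨max ε D, le_max_left _ _, fun u hu v hv => le_max_of_le_right (hD ?_)⟩
    exact ⟨(u, v), ⟨hu, hv⟩, rfl⟩
  have hDpos : 0 < D := hε.trans_le hD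
  -- Induction on an integer above the room left to the potential. Zero is impossible because a
  -- nonnegative error keeps the potential at most `8D / ε`.
  have key : ∀ (N : ℕ) (x : Vec n) (k : ℕ), x ∈ S →
      normSq A (x - y) - normSq A (z - y) ≤ D →
      8 * D / ε - 16 * D / (normSq A (x - y) - normSq A (z - y) + 2 * ε) < N →
      ∃ k' x', SepHyperplane loo A ε y k x k' x' := by
    intro N
    induction N with
    | zero =>
      intro x k hx _ hlt
      have h0 : 0 ≤ normSq A (x - y) - normSq A (z - y) := sub_nonneg.2 (hzmin hx)
      have : 16 * D / (normSq A (x - y) - normSq A (z - y) + 2 * ε) ≤ 16 * D / (2 * ε) := by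
        gcongr; linarith
      have e : 16 * D / (2 * ε) = 8 * D / ε := by field_simp; ring
      push_cast at hlt; linarith
    | succ N ih =>
      intro x k hx hδ hlt
      by_cases hst : FWStop A ε y x (loo k (A.app (x - y)))
      · exact ⟨_, _, .halt hst⟩
      · obtain ⟨σ, hσ, hmin⟩ := exists_line_search A x y (loo k (A.app (x - y)))
        obtain ⟨h1, h2, h3, h4⟩ :=
          fw_step hA hpsd hloo hS hε hD hdiam hx hz hzmin rfl hst hσ hmin
        have h6 := h4 hδ
        push_cast at hlt
        obtain ⟨k', x', h⟩ := ih _ (k + 1) h1 h3 (by linarith)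
        exact ⟨k', x', .step rfl hst hσ hmin h⟩
  by_cases hst : FWStop A ε y x (loo k (A.app (x - y)))
  · exact ⟨_, _, .halt hst⟩
  · obtain ⟨σ, hσ, hmin⟩ := exists_line_search A x y (loo k (A.app (x - y)))
    obtain ⟨h1, -, h3, -⟩ := fw_step hA hpsd hloo hS hε hD hdiam hx hz hzmin rfl hst hσ hmin
    obtain ⟨N, hN⟩ := exists_nat_gt (8 * D / ε - 16 * D /
      (normSq A (x + σ • (loo k (A.app (x - y)) - x) - y) - normSq A (z - y) + 2 * ε))
    obtain ⟨k', x', h⟩ := key N _ (k + 1) h1 h3 hN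
    exact ⟨k', x', .step rfl hst hσ hmin h⟩

/-- The step `2/3` leaves one third of the displacement. This gives the geometric rate behind the
number of pulls. -/
theorem normSq_pull (A : Mat n) (x y : Vec n) :
    normSq A (x - (y - (2 / 3 : ℝ) • (y - x))) = normSq A (x - y) / 9 := by
  have : x - (y - (2 / 3 : ℝ) • (y - x)) = (1 / 3 : ℝ) • (x - y) := by module
  rw [this, normSq_smul]; ring

/-- Pulling `y` towards `x` brings it closer to every feasible point. -/
theorem normSq_pull_le (hA : A.IsHermitian) (hpsd : ∀ x, 0 ≤ normSq A x) {x y z : Vec n} (h : 3 * ε < normSq A (x - y))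
    (hsep : ⟪x - y, A.app (x - z)⟫_ℝ ≤ ε) :
    normSq A (y - (2 / 3 : ℝ) • (y - x) - z) ≤ normSq A (y - z) := by
  have e1 : y - (2 / 3 : ℝ) • (y - x) - z = (y - z) - (2 / 3 : ℝ) • (y - x) := by module
  have e2 : y - z = (x - z) - (x - y) := by abel
  have e3 : ⟪y - z, A.app (y - x)⟫_ℝ = normSq A (x - y) - ⟪x - y, A.app (x - z)⟫_ℝ := by
    have : y - x = -(x - y) := by abel
    rw [this, Mat.app_neg, inner_neg_right, e2, inner_sub_left, ← inner_app_comm hA (x - z),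
      real_inner_comm]
    simp only [normSq]; ring
  rw [e1, normSq_sub hA, Mat.app_smul, real_inner_smul_right, normSq_smul, e3,
    normSq_sub_comm A y x]
  -- With `N = ‖x - y‖_A²` and gap `c`, the squared distance changes by `-(8/9) N + (4/3) c`. Since
  -- `c ≤ ε < N / 3`, this is below `-(4/9) N`.
  linarith [hpsd (x - y)]

theorem ProjLoop.spec (hA : A.IsHermitian) (hpsd : ∀ x, 0 ≤ normSq A x)
    (hloo : IsLOO S loo) (hS : Convex ℝ S) {x y x' y' : Vec n} {k k' : ℕ}
    (h : ProjLoop loo A ε k x y k' x' y') (hx : x ∈ S) :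
    x' ∈ S ∧ normSq A (x' - y') ≤ 3 * ε ∧ k ≤ k' ∧
      ∀ z ∈ S, normSq A (y' - z) ≤ normSq A (y - z) := by
  induction h with
  | ret sep h =>
    have hs := sep.spec hA hloo hS hx
    exact ⟨hs.1, h, hs.2.2.1.le, fun z _ => le_rfl⟩
  | pull sep h next ih =>
    obtain ⟨h1, h2, h3, h4⟩ := sep.spec hA hloo hS hx
    obtain ⟨i1, i2, i3, i4⟩ := ih h1
    refine ⟨i1, i2, by omega, fun z hz => (i4 z hz).trans ?_⟩
    -- The distance test failed, so Frank-Wolfe stopped because of its gap, and the gap separates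
    -- every feasible point at once.
    exact normSq_pull_le hA hpsd h ((h4.resolve_right (not_le.2 h)) z hz)

/-- The exponent `j` bounds the number of pulls still possible: Frank-Wolfe does not increase the
distance to its target, and each pull divides its square by `9`. -/
theorem ProjLoop.calls_le (hA : A.IsHermitian) (hpsd : ∀ x, 0 ≤ normSq A x)
    (hloo : IsLOO S loo) (hS : Convex ℝ S) (hc : IsCompact S) {D : ℝ} (hε : 0 < ε) (hD : ε ≤ D)
    (hdiam : ∀ u ∈ S, ∀ v ∈ S, normSq A (u - v) ≤ D) {x y x' y' : Vec n} {k k' : ℕ}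
    (h : ProjLoop loo A ε k x y k' x' y') (hx : x ∈ S) (j : ℕ)
    (hj : normSq A (x - y) ≤ 3 * ε * 9 ^ j) :
    (k' : ℝ) ≤ k + (j + 1) * (2 + 8 * D / ε) := by
  have hDpos : 0 < D := hε.trans_le hD
  have hpos : 0 < 2 + 8 * D / ε := by positivity
  induction h generalizing j with
  | ret sep h =>
    have hs := sep.calls_le hA hpsd hloo hS hc hε hD hdiam hx
    have : 0 ≤ (j : ℝ) * (2 + 8 * D / ε) := by positivity
    linarith
  | pull sep h next ih =>
    have hs := sep.calls_le hA hpsd hloo hS hc hε hD hdiam hx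
    obtain ⟨h1, h2, h3, h4⟩ := sep.spec hA hloo hS hx
    -- For exponent `0` the starting point is already close enough, so a pull would contradict
    -- monotonicity.
    cases j with
    | zero => simp only [pow_zero, mul_one] at hj; linarith
    | succ j =>
      have := ih h1 j (by rw [normSq_pull, pow_succ] at *; linarith)
      push_cast; linarith

theorem ProjLoop.exists_output (hA : A.IsHermitian) (hpsd : ∀ x, 0 ≤ normSq A x)
    (hloo : IsLOO S loo) (hS : Convex ℝ S) (hc : IsCompact S) (hε : 0 < ε) {x : Vec n}
    (hx : x ∈ S) (y : Vec n) (k : ℕ) : ∃ k' x' y', ProjLoop loo A ε k x y k' x' y' := by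
  obtain ⟨j, hj⟩ : ∃ j : ℕ, normSq A (x - y) ≤ 3 * ε * 9 ^ j := by
    obtain ⟨j, hj⟩ := pow_unbounded_of_one_lt (normSq A (x - y) / (3 * ε)) (y := 9) (by norm_num)
    refine ⟨j, ?_⟩
    rw [div_lt_iff₀ (by positivity)] at hj
    linarith
  induction j generalizing x y k with
  | zero =>
    obtain ⟨k', x', h⟩ := SepHyperplane.exists_output hA hpsd hloo hS hc hε hx y k
    have hs := h.spec hA hloo hS hx
    exact ⟨k', x', y, .ret h (by simp only [pow_zero, mul_one] at hj; linarith [hs.2.1])⟩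
  | succ j ih =>
    obtain ⟨k₁, x₁, h⟩ := SepHyperplane.exists_output hA hpsd hloo hS hc hε hx y k
    have hs := h.spec hA hloo hS hx
    by_cases h3 : normSq A (x₁ - y) ≤ 3 * ε
    · exact ⟨k₁, x₁, y, .ret h h3⟩
    · obtain ⟨k', x', y', h'⟩ := ih hs.1 (y - (2 / 3 : ℝ) • (y - x₁)) k₁
        (by rw [normSq_pull]; rw [pow_succ] at hj; linarith [hs.2.1])
      exact ⟨k', x', y', .pull h (not_le.1 h3) h'⟩

theorem ApproxProj.spec (hA : A.IsHermitian) (hpsd : ∀ x, 0 ≤ normSq A x)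
    (hloo : IsLOO S loo) (hS : Convex ℝ S) {x y x' y' : Vec n} {k k' : ℕ}
    (h : ApproxProj loo A ε k x y k' x' y') (hx : x ∈ S) :
    x' ∈ S ∧ normSq A (x' - y') ≤ 3 * ε ∧ k ≤ k' ∧
      ∀ z ∈ S, normSq A (y' - z) ≤ normSq A (y - z) := by
  rcases h with ⟨h, rfl, rfl, rfl⟩ | ⟨-, h⟩
  · exact ⟨hx, h, le_rfl, fun z _ => le_rfl⟩
  · exact h.spec hA hpsd hloo hS hx

theorem ApproxProj.calls_le (hA : A.IsHermitian) (hpsd : ∀ x, 0 ≤ normSq A x)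
    (hloo : IsLOO S loo) (hS : Convex ℝ S) (hc : IsCompact S) {D : ℝ} (hε : 0 < ε) (hD : ε ≤ D)
    (hdiam : ∀ u ∈ S, ∀ v ∈ S, normSq A (u - v) ≤ D) {x y x' y' : Vec n} {k k' : ℕ}
    (h : ApproxProj loo A ε k x y k' x' y') (hx : x ∈ S) (j : ℕ)
    (hj : normSq A (x - y) ≤ 3 * ε * 9 ^ j) :
    (k' : ℝ) ≤ k + (j + 1) * (2 + 8 * D / ε) := by
  rcases h with ⟨-, rfl, -, -⟩ | ⟨-, h⟩
  · have hDpos : 0 < D := hε.trans_le hD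
    have : 0 ≤ ((j : ℝ) + 1) * (2 + 8 * D / ε) := by positivity
    linarith
  · exact h.calls_le hA hpsd hloo hS hc hε hD hdiam hx j hj

theorem ApproxProj.exists_output (hA : A.IsHermitian) (hpsd : ∀ x, 0 ≤ normSq A x)
    (hloo : IsLOO S loo) (hS : Convex ℝ S) (hc : IsCompact S) (hε : 0 < ε) {x : Vec n}
    (hx : x ∈ S) (y : Vec n) (k : ℕ) : ∃ k' x' y', ApproxProj loo A ε k x y k' x' y' := by
  by_cases h : normSq A (x - y) ≤ 3 * ε
  · exact ⟨k, x, y, .inl ⟨h, rfl, rfl, rfl⟩⟩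
  · obtain ⟨k', x', y', h'⟩ := ProjLoop.exists_output hA hpsd hloo hS hc hε hx y k
    exact ⟨k', x', y', .inr ⟨not_le.1 h, h'⟩⟩

end Projection

/-! ### Existence of runs -/

section Existence

variable {n : ℕ} {S : Set (Vec n)} {loo : ℕ → Vec n → Vec n}

theorem add_outer_isHermitian {A : Mat n} (hA : A.IsHermitian) (u : Vec n) :
    (A + outer u).IsHermitian := hA.add (outer_isHermitian u)

theorem smul_one_isHermitian (c : ℝ) : (c • (1 : Mat n)).IsHermitian := by
  ext i j
  simp [Matrix.one_apply, eq_comm]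

/-- Feasibility of the first point, symmetry and semidefiniteness are what termination of the
projection needs. They are carried in the type of the state, so that the recursion can choose an
output in every block. -/
theorem exists_isRun (hloo : IsLOO S loo) (hS : Convex ℝ S) (hc : IsCompact S)
    (grad : ℕ → Vec n → Vec n) (p : Params n) (hε : 0 < p.ε) (hεI : 0 ≤ p.εI) (hx : p.x₁ ∈ S) :
    ∃ r : Run n, IsRun grad loo p r := by
  let Good : Vec n × Vec n × Mat n × ℕ → Prop := fun q =>
    q.1 ∈ S ∧ q.2.2.1.IsHermitian ∧ ∀ x, 0 ≤ normSq q.2.2.1 x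
  let bg : ℕ → Vec n → Vec n := fun m y => ∑ s ∈ Finset.range p.K, grad (m * p.K + s) y
  have step : ∀ (m : ℕ) (q : {q // Good q}), ∃ q' : {q // Good q},
      q'.1.2.2.1 = q.1.2.2.1 + outer (bg m q.1.2.1) ∧
      ApproxProj loo q'.1.2.2.1 p.ε q.1.2.2.2 q.1.1
        (q.1.2.1 - p.η • Mat.app (q'.1.2.2.1)⁻¹ (bg m q.1.2.1)) q'.1.2.2.2 q'.1.1 q'.1.2.1 := by
    rintro m ⟨⟨x, y, A, k⟩, hx, hA, hpsd⟩
    simp only at hx hA hpsd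
    have hA' := add_outer_isHermitian hA (bg m y)
    have hpsd' : ∀ z, 0 ≤ normSq (A + outer (bg m y)) z := fun z => by
      rw [normSq_add_outer]; have := hpsd z; positivity
    obtain ⟨k', x', y', h⟩ := ApproxProj.exists_output hA' hpsd' hloo hS hc hε hx
      (y - p.η • Mat.app (A + outer (bg m y))⁻¹ (bg m y)) k
    exact ⟨⟨⟨x', y', A + outer (bg m y), k'⟩, (h.spec hA' hpsd' hloo hS hx).1, hA', hpsd'⟩, rfl, h⟩
  choose next hnext using step
  let q₀ : {q // Good q} := ⟨⟨p.x₁, p.x₁, p.εI • (1 : Mat n), 0⟩, hx, smul_one_isHermitian _,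
    fun x => by rw [normSq_smul_one]; positivity⟩
  let q : ℕ → {q // Good q} := fun m => Nat.rec q₀ next m
  refine ⟨⟨fun m => (q m).1.1, fun m => (q m).1.2.1, fun m => (q m).1.2.2.1,
    fun m => (q m).1.2.2.2⟩, ?_⟩
  exact ⟨rfl, rfl, rfl, rfl, fun m _ => (hnext m (q m)).1, fun m _ => (hnext m (q m)).2⟩

end Existence

/-! ### Positive definite matrices and determinants -/

section LogDet

variable {n : ℕ}

theorem posDef_of_normSq_pos {A : Mat n} (hA : A.IsHermitian)
    (hpos : ∀ x, x ≠ 0 → 0 < normSq A x) : A.PosDef := by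
  refine Matrix.PosDef.of_dotProduct_mulVec_pos hA fun x hx => ?_
  have h := hpos (WithLp.toLp 2 x) (by simpa using hx)
  rw [normSq, inner_eq_dotProduct] at h
  simpa [Mat.app] using h

theorem app_inv_app {A : Mat n} (hA : A.PosDef) (g : Vec n) : A.app (Mat.app A⁻¹ g) = g := by
  rw [Mat.app_app, Matrix.mul_nonsing_inv _ ((Matrix.isUnit_iff_isUnit_det _).1 hA.isUnit)]
  ext i; simp [Mat.app]

theorem mul_outer (A : Mat n) (u : Vec n) :
    A * outer u = Matrix.vecMulVec (A.app u).ofLp u.ofLp := by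
  simp [outer, Mat.app, Matrix.mul_vecMulVec]

/-- The Sherman-Morrison formula. -/
theorem inv_add_outer {A : Mat n} (hA : A.PosDef) (g : Vec n)
    (hs : 1 + ⟪g, Mat.app A⁻¹ g⟫_ℝ ≠ 0) :
    (A + outer g)⁻¹ = A⁻¹ - (1 / (1 + ⟪g, Mat.app A⁻¹ g⟫_ℝ)) • outer (Mat.app A⁻¹ g) := by
  have hu : IsUnit A.det := (Matrix.isUnit_iff_isUnit_det _).1 hA.isUnit
  have hi : (A⁻¹).transpose = A⁻¹ := by
    rw [← Matrix.conjTranspose_eq_transpose_of_trivial]; exact hA.1.inv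
  apply Matrix.inv_eq_right_inv
  have e1 : A * outer (Mat.app A⁻¹ g) = Matrix.vecMulVec g.ofLp (Mat.app A⁻¹ g).ofLp := by
    rw [mul_outer, app_inv_app hA]
  have e2 : outer g * A⁻¹ = Matrix.vecMulVec g.ofLp (Mat.app A⁻¹ g).ofLp := by
    rw [outer, Matrix.vecMulVec_mul, ← Matrix.mulVec_transpose, hi]; rfl
  have e3 : outer g * outer (Mat.app A⁻¹ g) =
      ⟪g, Mat.app A⁻¹ g⟫_ℝ • Matrix.vecMulVec g.ofLp (Mat.app A⁻¹ g).ofLp := by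
    rw [inner_eq_dotProduct, outer, outer, Matrix.vecMulVec_mul_vecMulVec, Matrix.vecMulVec_smul]
  rw [add_mul, mul_sub, mul_sub, Matrix.mul_nonsing_inv _ hu, Matrix.mul_smul, Matrix.mul_smul, e1,
    e2, e3, smul_smul]
  have : ∀ V : Mat n, 1 - (1 / (1 + ⟪g, Mat.app A⁻¹ g⟫_ℝ)) • V +
      (V - (1 / (1 + ⟪g, Mat.app A⁻¹ g⟫_ℝ) * ⟪g, Mat.app A⁻¹ g⟫_ℝ) • V) = 1 := by
    intro V
    have h : V = (1 / (1 + ⟪g, Mat.app A⁻¹ g⟫_ℝ) +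
        1 / (1 + ⟪g, Mat.app A⁻¹ g⟫_ℝ) * ⟪g, Mat.app A⁻¹ g⟫_ℝ) • V := by
      rw [show 1 / (1 + ⟪g, Mat.app A⁻¹ g⟫_ℝ) + 1 / (1 + ⟪g, Mat.app A⁻¹ g⟫_ℝ) *
        ⟪g, Mat.app A⁻¹ g⟫_ℝ = 1 by field_simp, one_smul]
    rw [add_smul] at h
    nth_rewrite 2 [h]
    abel
  exact this _

theorem inner_inv_nonneg {A : Mat n} (hA : A.PosDef) (g : Vec n) :
    0 ≤ ⟪g, Mat.app A⁻¹ g⟫_ℝ := by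
  have h := hA.inv.posSemidef.dotProduct_mulVec_nonneg g.ofLp
  rw [inner_eq_dotProduct]
  simpa [Mat.app] using h

/-- On `g` itself the Sherman-Morrison correction is only a rescaling. Hence the local norm of `g`
passes from `s` to `s / (1 + s)` when `g` is added to the matrix. -/
theorem app_inv_add_outer {A : Mat n} (hA : A.PosDef) (g : Vec n) :
    Mat.app (A + outer g)⁻¹ g =
      (1 / (1 + ⟪g, Mat.app A⁻¹ g⟫_ℝ)) • Mat.app A⁻¹ g := by
  have hs : 1 + ⟪g, Mat.app A⁻¹ g⟫_ℝ ≠ 0 := by have := inner_inv_nonneg hA g; positivity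
  have e : ∀ (c : ℝ) (B : Mat n) (w : Vec n), Mat.app (B - c • outer w) g
      = Mat.app B g - (c * ⟪w, g⟫_ℝ) • w := by
    intro c B w
    rw [mul_smul, ← outer_app]
    ext i
    simp [Mat.app, Matrix.sub_mulVec, Matrix.smul_mulVec]
  rw [inv_add_outer hA g hs, e, real_inner_comm g (Mat.app A⁻¹ g)]
  have h : (1 : ℝ) = 1 / (1 + ⟪g, Mat.app A⁻¹ g⟫_ℝ) +
      1 / (1 + ⟪g, Mat.app A⁻¹ g⟫_ℝ) * ⟪g, Mat.app A⁻¹ g⟫_ℝ := by field_simp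
  nth_rewrite 1 [← one_smul ℝ (Mat.app A⁻¹ g)]
  rw [← sub_smul]
  congr 1
  linarith

/-- The matrix determinant lemma. It makes the logarithms of `1 + s` telescope to `log det` in
`sum_log_eq`. -/
theorem det_add_outer {A : Mat n} (hA : A.PosDef) (g : Vec n) :
    (A + outer g).det = A.det * (1 + ⟪g, Mat.app A⁻¹ g⟫_ℝ) := by
  have hu : IsUnit A.det := (Matrix.isUnit_iff_isUnit_det _).1 hA.isUnit
  rw [outer, Matrix.vecMulVec_eq Unit, Matrix.det_add_replicateCol_mul_replicateRow hu,
    inner_eq_dotProduct]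
  simp [Mat.app, Matrix.det_unique, Matrix.mul_apply, dotProduct, Matrix.mulVec,
    Finset.sum_mul, Finset.mul_sum, mul_assoc]
  exact Or.inl Finset.sum_comm

/-- Sum `log λ ≤ λ - 1` over the eigenvalues. -/
theorem log_det_le_trace {W : Mat n} (hW : W.PosDef) : Real.log W.det ≤ W.trace - n := by
  have h1 : W.det = ∏ i, hW.1.eigenvalues i := by simpa using hW.1.det_eq_prod_eigenvalues
  have h2 : W.trace = ∑ i, hW.1.eigenvalues i := by simpa using hW.1.trace_eq_sum_eigenvalues
  rw [h1, Real.log_prod (fun i _ => (hW.eigenvalues_pos i).ne'), h2]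
  calc ∑ i, Real.log (hW.1.eigenvalues i) ≤ ∑ i, (hW.1.eigenvalues i - 1) :=
        Finset.sum_le_sum fun i _ => Real.log_le_sub_one_of_pos (hW.eigenvalues_pos i)
    _ = _ := by simp

/-- A weighted form of Hadamard's inequality in the eigenbasis of a second matrix. -/
theorem log_det_le_weighted {A C : Mat n} (hA : A.PosDef) (hC : C.IsHermitian) {w : Fin n → ℝ}
    (hw : ∀ i, 0 < w i) :
    Real.log A.det ≤ ∑ i, (w i * normSq A (hC.eigenvectorBasis i) - 1 - Real.log (w i)) := by
  set U : Mat n := hC.eigenvectorUnitary.1 with hU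
  -- Conjugating `A` by the eigenvectors of `C`, scaled by `√(w i)`, multiplies the determinant by
  -- the product of the weights and puts the weighted quadratic forms on the diagonal. The trace
  -- bound then applies.
  set B : Mat n := U * Matrix.diagonal fun i => √(w i) with hB
  have hUU : U.conjTranspose * U = 1 := by
    have := Unitary.coe_star_mul_self hC.eigenvectorUnitary
    simpa [Matrix.star_eq_conjTranspose] using this
  have hdetU : U.det * U.det = 1 := by
    have := congrArg Matrix.det hUU
    simpa [Matrix.det_mul, Matrix.conjTranspose_eq_transpose_of_trivial] using this
  have hdetB : B.det * B.det = ∏ i, w i := by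
    have : ∏ i, w i = (∏ i, √(w i)) * ∏ i, √(w i) := by
      rw [← Finset.prod_mul_distrib]
      exact Finset.prod_congr rfl fun i _ => (Real.mul_self_sqrt (hw i).le).symm
    rw [hB, Matrix.det_mul, Matrix.det_diagonal, this, mul_mul_mul_comm, hdetU, one_mul]
  have hprod : 0 < ∏ i, w i := Finset.prod_pos fun i _ => hw i
  have hBdet : B.det ≠ 0 := fun h => by rw [h] at hdetB; simp at hdetB; linarith
  have hinj : Function.Injective B.mulVec := by
    rw [Matrix.mulVec_injective_iff_isUnit, Matrix.isUnit_iff_isUnit_det]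
    exact isUnit_iff_ne_zero.2 hBdet
  have hW := hA.conjTranspose_mul_mul_same hinj
  have h := log_det_le_trace hW
  have hdet : (B.conjTranspose * A * B).det = (∏ i, w i) * A.det := by
    rw [Matrix.det_mul, Matrix.det_mul, Matrix.conjTranspose_eq_transpose_of_trivial,
      Matrix.det_transpose, ← hdetB]; ring
  have hdiag : ∀ i, (B.conjTranspose * A * B) i i = w i * normSq A (hC.eigenvectorBasis i) := by
    intro i
    have e1 : ∀ k, B k i = √(w i) * hC.eigenvectorBasis i k := by
      intro k; simp [hB, hU, Matrix.mul_diagonal, mul_comm]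
    rw [normSq, inner_eq_dotProduct]
    simp only [Matrix.mul_apply, Matrix.conjTranspose_apply, star_trivial, e1, Mat.app, dotProduct,
      Matrix.mulVec, Finset.sum_mul, Finset.mul_sum]
    rw [Finset.sum_comm]
    refine Finset.sum_congr rfl fun j _ => Finset.sum_congr rfl fun k _ => ?_
    nth_rewrite 3 [← Real.mul_self_sqrt (hw i).le]
    ring
  rw [hdet, Real.log_mul hprod.ne' hA.det_pos.ne', Real.log_prod (fun i _ => (hw i).ne')] at h
  simp only [Matrix.trace, Matrix.diag_apply, hdiag] at h
  simp only [Finset.sum_sub_distrib, Finset.sum_const, Finset.card_univ, Fintype.card_fin,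
    nsmul_eq_mul, mul_one]
  linarith

theorem normSq_eigenvectorBasis {C : Mat n} (hC : C.IsHermitian) (i : Fin n) :
    normSq C (hC.eigenvectorBasis i) = hC.eigenvalues i := by
  have h : C.app (hC.eigenvectorBasis i) = hC.eigenvalues i • hC.eigenvectorBasis i := by
    ext j
    simp [Mat.app, hC.mulVec_eigenvectorBasis]
  rw [normSq, h, real_inner_smul_right, real_inner_self_eq_norm_sq,
    hC.eigenvectorBasis.orthonormal.1 i]
  simp

theorem card_fin_lt (N ρ : ℕ) (h : ρ ≤ N) :
    ∑ i : Fin N, (if ρ ≤ (i : ℕ) then (0 : ℝ) else 1) = ρ := by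
  rw [Fin.sum_univ_eq_sum_range (fun i => if ρ ≤ i then (0 : ℝ) else 1) N]
  obtain ⟨k, rfl⟩ := Nat.exists_eq_add_of_le h
  rw [Finset.sum_range_add, Finset.sum_congr rfl (g := fun _ => (1 : ℝ))]
  · simp
  · intro i hi; simp [not_le.2 (Finset.mem_range.1 hi)]

/-- The logarithm of the determinant of `e • 1 + Q`, for a matrix with quadratic form `q` that is
dominated by `κ • C`, in terms of the tail of the spectrum of `C`. -/
theorem log_det_le_tail {A C : Mat n} (hA : A.PosDef) (hC : C.IsHermitian) {e κ t : ℝ}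
    (he : 0 < e) (ht : 0 ≤ t) {q : Vec n → ℝ}
    (hq : ∀ x, normSq A x = e * ‖x‖ ^ 2 + q x) (hq0 : ∀ x, 0 ≤ q x)
    (hqC : ∀ x, q x ≤ κ * normSq C x) (hqt : ∑ i, q (hC.eigenvectorBasis i) ≤ t)
    {ρ : ℕ} (hρ : 1 ≤ ρ) (hρn : ρ ≤ n) :
    Real.log A.det - n * Real.log e ≤ ρ * Real.log (1 + t / (ρ * e)) +
      κ / e * ∑ i : Fin (Fintype.card (Fin n)), if ρ ≤ (i : ℕ) then hC.eigenvalues₀ i else 0 := by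
  have hρ0 : (0 : ℝ) < ρ := by exact_mod_cast hρ
  -- If the mass `t` is spread evenly over the `ρ` leading directions, `A` takes the value `a`
  -- there. With this choice `t / a + ρ (e / a - 1)` vanishes.
  set a : ℝ := e + t / ρ with ha
  have hapos : 0 < a := by positivity
  -- The same equivalence occurs in the definition of `eigenvalues`, which is why `rfl` identifies
  -- the two enumerations below.
  let E : Fin (Fintype.card (Fin n)) ≃ Fin n := Fintype.equivOfCardEq (Fintype.card_fin _)
  let w : Fin n → ℝ := fun i => if ρ ≤ (E.symm i : ℕ) then 1 / e else 1 / a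
  have hw : ∀ i, 0 < w i := by
    intro i; simp only [w]; split_ifs <;> positivity
  have h := log_det_le_weighted hA hC hw
  -- The term `q / a` is charged in every direction, although only the leading ones need it: this
  -- lets the bound on the whole sum of `q` be used.
  have hle : ∀ i, w i * normSq A (hC.eigenvectorBasis i) - 1 - Real.log (w i) ≤
      q (hC.eigenvectorBasis i) / a + ((if ρ ≤ (E.symm i : ℕ) then (0 : ℝ) else 1) *
        (e / a - 1 + Real.log a - Real.log e) +
      (Real.log e + κ / e * if ρ ≤ (E.symm i : ℕ) then hC.eigenvalues₀ (E.symm i) else 0)) := by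
    intro i
    have hn : ‖hC.eigenvectorBasis i‖ = 1 := hC.eigenvectorBasis.orthonormal.1 i
    have h1 := hqC (hC.eigenvectorBasis i)
    rw [normSq_eigenvectorBasis] at h1
    have h0 := hq0 (hC.eigenvectorBasis i)
    have hqa : 0 ≤ q (hC.eigenvectorBasis i) / a := by positivity
    rw [hq, hn]
    simp only [w]
    split_ifs with hi
    · have : hC.eigenvalues i = hC.eigenvalues₀ (E.symm i) := rfl
      rw [this] at h1
      have e1 : 1 / e * (e * 1 ^ 2 + q (hC.eigenvectorBasis i)) - 1 =
        q (hC.eigenvectorBasis i) / e := by field_simp; ring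
      have e2 : q (hC.eigenvectorBasis i) / e ≤ κ / e * hC.eigenvalues₀ (E.symm i) := by
        rw [div_mul_eq_mul_div]; gcongr
      have e3 : Real.log (1 / e) = - Real.log e := by rw [one_div, Real.log_inv]
      rw [e1, e3]; linarith
    · have e3 : Real.log (1 / a) = - Real.log a := by rw [one_div, Real.log_inv]
      have e1 : 1 / a * (e * 1 ^ 2 + q (hC.eigenvectorBasis i)) =
        q (hC.eigenvectorBasis i) / a + e / a := by ring
      rw [e1, e3]; linarith
  have hsum := h.trans (Finset.sum_le_sum fun i _ => hle i)
  rw [Finset.sum_add_distrib, Finset.sum_add_distrib, Finset.sum_add_distrib, ← Finset.sum_div,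
    ← Finset.sum_mul, ← Finset.mul_sum,
    E.symm.sum_comp fun i => if ρ ≤ (i : ℕ) then (0 : ℝ) else 1,
    E.symm.sum_comp fun i => if ρ ≤ (i : ℕ) then hC.eigenvalues₀ i else 0,
    card_fin_lt _ _ (by simpa using hρn)] at hsum
  simp only [Finset.sum_const, Finset.card_univ, Fintype.card_fin, nsmul_eq_mul] at hsum
  have h1 : (∑ i, q (hC.eigenvectorBasis i)) / a ≤ t / a := by gcongr
  have h2 : t / a + ρ * (e / a - 1) = 0 := by
    rw [ha]; field_simp; ring
  have h3 : Real.log (1 + t / (ρ * e)) = Real.log a - Real.log e := by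
    rw [← Real.log_div hapos.ne' he.ne', ha]; congr 1; field_simp
  rw [h3]
  linarith

end LogDet

/-! ### The regret of a run -/

theorem sum_range_blocks (f : ℕ → ℝ) (M K : ℕ) :
    ∑ t ∈ Finset.range (M * K), f t = ∑ m ∈ Finset.range M, ∑ s ∈ Finset.range K, f (m * K + s) := by
  induction M with
  | zero => simp
  | succ M ih => rw [Nat.succ_mul, Finset.sum_range_add, ih, Finset.sum_range_succ]

/-- A first-order bound for a function with Lipschitz gradient. -/
theorem sub_le_inner_gradientWithin {n : ℕ} {f : Vec n → ℝ} {C : Set (Vec n)} {β : ℝ}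
    (hC : Convex ℝ C) (hβ : 0 ≤ β) (hf : DifferentiableOn ℝ f C) (hs : IsSmoothOver f C β)
    {x y : Vec n} (hx : x ∈ C) (hy : y ∈ C) :
    f x - f y ≤ ⟪gradientWithin f C y, x - y⟫_ℝ + β * ‖x - y‖ ^ 2 := by
  have hsub : segment ℝ y x ⊆ C := hC.segment_subset hy hx
  -- The mean value inequality on the segment bounds the deviation of the gradient by its maximum
  -- and not by its average. It therefore gives `β`, not `β / 2`.
  have h := Convex.norm_image_sub_le_of_norm_hasFDerivWithin_le' (𝕜 := ℝ) (f := f)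
    (f' := fun z => InnerProductSpace.toDual ℝ (Vec n) (gradientWithin f C z))
    (φ := InnerProductSpace.toDual ℝ (Vec n) (gradientWithin f C y)) (C := β * ‖x - y‖)
    (s := segment ℝ y x) (x := y) (y := x)
    (fun z hz => ((hf z (hsub hz)).hasGradientWithinAt.hasFDerivWithinAt).mono hsub)
    (fun z hz => by
      rw [← map_sub, LinearIsometryEquiv.norm_map]
      refine (hs z (hsub hz) y hy).trans ?_
      gcongr
      have := norm_sub_le_of_mem_segment hz
      simpa [norm_sub_rev] using this)
    (convex_segment y x) (left_mem_segment ℝ y x) (right_mem_segment ℝ y x)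
  rw [InnerProductSpace.toDual_apply_apply, Real.norm_eq_abs] at h
  have := (abs_le.1 h).2
  nlinarith

section Regret

variable {n T : ℕ} {S : Set (Vec n)} {R G α β : ℝ} {f : ℕ → Vec n → ℝ}
  {loo : ℕ → Vec n → Vec n} {p : Params n} {r : Run n} {grad : ℕ → Vec n → Vec n}

theorem IsRun.A_isHermitian (hr : IsRun grad loo p r) {m : ℕ} (hm : m ≤ p.T / p.K) :
    (r.A m).IsHermitian := by
  induction m with
  | zero => rw [hr.A_zero]; exact smul_one_isHermitian _
  | succ m ih => rw [hr.A_succ m hm]; exact add_outer_isHermitian (ih (by omega)) _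

theorem IsRun.normSq_A (hr : IsRun grad loo p r) {m : ℕ} (hm : m ≤ p.T / p.K) (x : Vec n) :
    normSq (r.A m) x =
      p.εI * ‖x‖ ^ 2 + ∑ j ∈ Finset.range m, ⟪blockGrad grad p.K r j, x⟫_ℝ ^ 2 := by
  induction m with
  | zero => rw [hr.A_zero, normSq_smul_one]; simp
  | succ m ih => rw [hr.A_succ m hm, normSq_add_outer, ih (by omega), Finset.sum_range_succ]; ring

theorem IsRun.le_normSq_A (hr : IsRun grad loo p r) {m : ℕ} (hm : m ≤ p.T / p.K) (x : Vec n) :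
    p.εI * ‖x‖ ^ 2 ≤ normSq (r.A m) x := by
  rw [hr.normSq_A hm]
  have : 0 ≤ ∑ j ∈ Finset.range m, ⟪blockGrad grad p.K r j, x⟫_ℝ ^ 2 :=
    Finset.sum_nonneg fun _ _ => sq_nonneg _
  linarith

theorem IsRun.normSq_A_nonneg (hr : IsRun grad loo p r) (hεI : 0 < p.εI) {m : ℕ}
    (hm : m ≤ p.T / p.K) (x : Vec n) : 0 ≤ normSq (r.A m) x :=
  le_trans (by positivity) (hr.le_normSq_A hm x)

theorem IsRun.A_posDef (hr : IsRun grad loo p r) (hεI : 0 < p.εI) {m : ℕ}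
    (hm : m ≤ p.T / p.K) : (r.A m).PosDef := by
  refine posDef_of_normSq_pos (hr.A_isHermitian hm) fun x hx => ?_
  have : 0 < ‖x‖ := norm_pos_iff.2 hx
  exact lt_of_lt_of_le (by positivity) (hr.le_normSq_A hm x)

theorem IsRun.feasible (hr : IsRun grad loo p r) (hεI : 0 < p.εI) (hε : 0 < p.ε)
    (hloo : IsLOO S loo) (hS : Convex ℝ S) (hx₁ : p.x₁ ∈ S) {m : ℕ} (hm : m ≤ p.T / p.K) :
    r.x m ∈ S ∧ normSq (r.A m) (r.x m - r.y m) ≤ 3 * p.ε := by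
  induction m with
  | zero =>
    rw [hr.x_zero, hr.y_zero]
    refine ⟨hx₁, ?_⟩
    simp only [sub_self, normSq, inner_zero_left]
    positivity
  | succ m ih =>
    have h := (hr.proj m hm).spec (hr.A_isHermitian hm) (hr.normSq_A_nonneg hεI hm) hloo hS
      (ih (by omega)).1
    exact ⟨h.1, h.2.1⟩

/-- The matrix dominates `εI` times the identity, so closeness in the local norm implies closeness
in the Euclidean norm. -/
theorem IsRun.norm_sub_sq_le (hr : IsRun grad loo p r) (hεI : 0 < p.εI) (hε : 0 < p.ε)
    (hloo : IsLOO S loo) (hS : Convex ℝ S) (hx₁ : p.x₁ ∈ S) {m : ℕ} (hm : m ≤ p.T / p.K) :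
    ‖r.x m - r.y m‖ ^ 2 ≤ 3 * p.ε / p.εI := by
  rw [le_div_iff₀ hεI, mul_comm]
  exact (hr.le_normSq_A hm _).trans (hr.feasible hεI hε hloo hS hx₁ hm).2

/-- The infeasible points stay in the domain of the losses. -/
theorem IsRun.y_mem (hr : IsRun grad loo p r) (hεI : 0 < p.εI) (hε : 0 < p.ε)
    (hloo : IsLOO S loo) (hS : Convex ℝ S) (hx₁ : p.x₁ ∈ S) (hR : 0 < R)
    (hSR : S ⊆ Metric.closedBall 0 R) (hεR : 3 * p.ε / p.εI ≤ 4 * R ^ 2) {m : ℕ}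
    (hm : m ≤ p.T / p.K) : r.y m ∈ Metric.closedBall (0 : Vec n) (3 * R) := by
  have h1 := (hr.norm_sub_sq_le hεI hε hloo hS hx₁ hm).trans hεR
  have h2 : ‖r.x m‖ ≤ R := by simpa using hSR (hr.feasible hεI hε hloo hS hx₁ hm).1
  have h3 : ‖r.x m - r.y m‖ ≤ 2 * R := by
    apply le_of_sq_le_sq (by nlinarith) (by positivity)
  rw [mem_closedBall_zero_iff]
  calc ‖r.y m‖ = ‖r.x m - (r.x m - r.y m)‖ := by congr 1; abel
    _ ≤ ‖r.x m‖ + ‖r.x m - r.y m‖ := norm_sub_le _ _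
    _ ≤ 3 * R := by linarith

theorem closedBall_subset_three_mul (hR : 0 < R) :
    Metric.closedBall (0 : Vec n) R ⊆ Metric.closedBall 0 (3 * R) :=
  Metric.closedBall_subset_closedBall (by linarith)

theorem norm_blockGrad_le (hset : OCOSetup S R G α β T f) {K m : ℕ} (hm : m * K + K ≤ T)
    (hy : r.y m ∈ Metric.closedBall (0 : Vec n) (3 * R)) :
    ‖blockGrad (lossGrad R f) K r m‖ ≤ K * G := by
  calc ‖blockGrad (lossGrad R f) K r m‖
      ≤ ∑ s ∈ Finset.range K, ‖lossGrad R f (m * K + s) (r.y m)‖ := norm_sum_le _ _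
    _ ≤ ∑ s ∈ Finset.range K, G := Finset.sum_le_sum fun s hs =>
        (hset.gradBound (m * K + s) (by have := Finset.mem_range.1 hs; omega)).2 _ hy
    _ = K * G := by simp

/-- The squared local norm of the gradient is at most its squared norm, scaled. -/
theorem inner_inv_le {A : Mat n} (hA : A.PosDef) {e : ℝ} (he : 0 < e)
    (hle : ∀ x, e * ‖x‖ ^ 2 ≤ normSq A x) (g : Vec n) :
    ⟪g, Mat.app A⁻¹ g⟫_ℝ ≤ ‖g‖ ^ 2 / e := by
  set w := Mat.app A⁻¹ g with hw
  have h1 : normSq A w = ⟪g, w⟫_ℝ := by rw [normSq, app_inv_app hA, real_inner_comm]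
  have h2 := hle w
  have h3 : ⟪g, w⟫_ℝ ≤ ‖g‖ * ‖w‖ := real_inner_le_norm g w
  rw [h1] at h2
  rw [le_div_iff₀ he]
  have h4 := inner_inv_nonneg hA g
  rw [← hw] at h4
  rcases h4.eq_or_lt with h | h
  · rw [← h]; simp
  -- Combine `e ‖w‖² ≤ ⟪g, w⟫` with `⟪g, w⟫ ≤ ‖g‖ ‖w‖`, and cancel one positive factor `⟪g, w⟫`.
  · have : (⟪g, w⟫_ℝ * e) * ⟪g, w⟫_ℝ ≤ ‖g‖ ^ 2 * ⟪g, w⟫_ℝ := by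
      have h5 : ⟪g, w⟫_ℝ ^ 2 ≤ (‖g‖ * ‖w‖) ^ 2 := by gcongr
      nlinarith [sq_nonneg ‖g‖]
    exact le_of_mul_le_mul_right this h

/-- Cauchy-Schwarz between the norm of `A` and its dual. It turns the linear error of playing `x`
instead of `y` into a local gradient norm times the tolerance. -/
theorem inner_sq_le_inv {A : Mat n} (hA : A.PosDef) (hpsd : ∀ x, 0 ≤ normSq A x) (g u : Vec n) :
    ⟪g, u⟫_ℝ ^ 2 ≤ ⟪g, Mat.app A⁻¹ g⟫_ℝ * normSq A u := by
  have h := inner_app_sq_le hA.1 hpsd (Mat.app A⁻¹ g) u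
  rw [← inner_app_comm hA.1, app_inv_app hA, normSq, app_inv_app hA,
    real_inner_comm g (Mat.app A⁻¹ g)] at h
  exact h

/-- The analysis of one Newton step. -/
theorem newton_step {A : Mat n} (hA : A.PosDef) {η : ℝ} (hη : 0 < η) (g y z : Vec n) :
    ⟪g, y - z⟫_ℝ - 1 / (2 * η) * ⟪g, y - z⟫_ℝ ^ 2 ≤
      1 / (2 * η) * (normSq A (y - z) -
        normSq (A + outer g) (y - η • Mat.app (A + outer g)⁻¹ g - z)) +
      η / 2 * Real.log (1 + ⟪g, Mat.app A⁻¹ g⟫_ℝ) := by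
  set s := ⟪g, Mat.app A⁻¹ g⟫_ℝ with hs
  have hs0 : 0 ≤ s := inner_inv_nonneg hA g
  have hH := add_outer_isHermitian hA.1 g
  set w := Mat.app (A + outer g)⁻¹ g with hw
  have hwg : ⟪g, w⟫_ℝ = s / (1 + s) := by
    rw [hw, app_inv_add_outer hA, real_inner_smul_right, ← hs]; ring
  have hAw : Mat.app (A + outer g) w = g := by
    rw [hw, app_inv_add_outer hA, Mat.app_smul, Mat.add_app, app_inv_app hA, outer_app, ← hs]
    rw [smul_add, smul_smul, ← add_smul]
    rw [show 1 / (1 + s) + 1 / (1 + s) * s = 1 by field_simp, one_smul]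
  have e1 : y - η • w - z = (y - z) - η • w := by abel
  have hlog : s / (1 + s) ≤ Real.log (1 + s) := by
    have := Real.one_sub_inv_le_log_of_pos (x := 1 + s) (by positivity)
    have e : 1 - (1 + s)⁻¹ = s / (1 + s) := by field_simp; ring
    linarith
  rw [e1, normSq_sub hH, normSq_smul, Mat.app_smul, real_inner_smul_right, hAw, normSq_add_outer]
  have e2 : normSq (A + outer g) w = s / (1 + s) := by
    rw [normSq, hAw, real_inner_comm, hwg]
  rw [e2, real_inner_comm g (y - z)]
  -- An identity: the rank-one part of the new matrix reproduces the curvature square. The only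
  -- inequality in the Newton step is `s / (1 + s) ≤ log (1 + s)`.
  have e3 : 1 / (2 * η) * (normSq A (y - z) - (normSq A (y - z) + ⟪g, y - z⟫_ℝ ^ 2 -
      2 * (η * ⟪g, y - z⟫_ℝ) + η ^ 2 * (s / (1 + s)))) =
      ⟪g, y - z⟫_ℝ - 1 / (2 * η) * ⟪g, y - z⟫_ℝ ^ 2 - η / 2 * (s / (1 + s)) := by
    field_simp; ring
  rw [e3]
  nlinarith

/-- The curvature condition, summed over a block. -/
theorem block_curvature (hset : OCOSetup S R G α β T f) {K m : ℕ} (hK : 0 < K)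
    (hm : m * K + K ≤ T) {η : ℝ} (hη : max (12 * K * G * R) (2 * K / α) ≤ η) {y z : Vec n}
    (hy : y ∈ Metric.closedBall (0 : Vec n) (3 * R))
    (hz : z ∈ Metric.closedBall (0 : Vec n) (3 * R)) :
    ∑ s ∈ Finset.range K, (f (m * K + s) y - f (m * K + s) z) ≤
      ⟪∑ s ∈ Finset.range K, lossGrad R f (m * K + s) y, y - z⟫_ℝ
        - 1 / (2 * η) * ⟪∑ s ∈ Finset.range K, lossGrad R f (m * K + s) y, y - z⟫_ℝ ^ 2 := by
  have hK' : (0 : ℝ) < K := by exact_mod_cast hK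
  have hα := hset.α_pos
  have hη0 : 0 < η := lt_of_lt_of_le (by positivity) ((le_max_right _ _).trans hη)
  -- The condition is used with `η / K` in each round. Cauchy-Schwarz over the `K` rounds loses the
  -- factor `K` and restores `η`.
  have hη' : max (4 * G * (3 * R)) (2 / α) ≤ η / K := by
    rw [max_le_iff] at hη ⊢
    rw [le_div_iff₀ hK', le_div_iff₀ hK']
    refine ⟨by linarith [hη.1], ?_⟩
    calc 2 / α * K = 2 * K / α := by ring
      _ ≤ η := hη.2
  have h1 : ∀ s ∈ Finset.range K, f (m * K + s) y - f (m * K + s) z ≤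
      ⟪lossGrad R f (m * K + s) y, y - z⟫_ℝ -
        1 / (2 * (η / K)) * ⟪lossGrad R f (m * K + s) y, y - z⟫_ℝ ^ 2 := fun s hs =>
    hset.curvature (m * K + s) (by have := Finset.mem_range.1 hs; omega) (η / K) hη' y hy z hz
  refine (Finset.sum_le_sum h1).trans ?_
  rw [Finset.sum_sub_distrib, ← Finset.mul_sum, sum_inner]
  have h2 := sq_sum_le_card_mul_sum_sq (s := Finset.range K)
    (f := fun s => ⟪lossGrad R f (m * K + s) y, y - z⟫_ℝ)
  rw [Finset.card_range] at h2
  have h3 : 1 / (2 * η) * (∑ s ∈ Finset.range K, ⟪lossGrad R f (m * K + s) y, y - z⟫_ℝ) ^ 2 ≤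
      1 / (2 * η) * (K * ∑ s ∈ Finset.range K, ⟪lossGrad R f (m * K + s) y, y - z⟫_ℝ ^ 2) := by
    gcongr
  have e : 1 / (2 * (η / K)) = 1 / (2 * η) * K := by field_simp
  rw [e]; linarith

/-- The regret within one block. -/
theorem block_regret (hset : OCOSetup S R G α β p.T f) (hloo : IsLOO S loo) (hx₁ : p.x₁ ∈ S)
    (hK : 0 < p.K) (hadm : p.Admissible G R α) (hεI : 0 < p.εI) (hη : 0 < p.η)
    (hr : IsRun (lossGrad R f) loo p r) {m : ℕ} (hm : m < p.T / p.K) {z : Vec n} (hz : z ∈ S) :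
    ∑ s ∈ Finset.range p.K, (f (m * p.K + s) (r.x m) - f (m * p.K + s) z) ≤
      ⟪blockGrad (lossGrad R f) p.K r m, r.x m - r.y m⟫_ℝ + p.K * (β * (3 * p.ε / p.εI)) +
      1 / (2 * p.η) * (normSq (r.A m) (r.y m - z) - normSq (r.A (m + 1)) (r.y (m + 1) - z)) +
      p.η / 2 * Real.log (1 + ⟪blockGrad (lossGrad R f) p.K r m,
        Mat.app (r.A m)⁻¹ (blockGrad (lossGrad R f) p.K r m)⟫_ℝ) := by
  obtain ⟨h1, h2, hε, hεR⟩ := hadm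
  have hR := hset.R_pos
  have hmT : m * p.K + p.K ≤ p.T := by
    have := Nat.mul_le_mul_right p.K (Nat.succ_le_of_lt hm)
    have := Nat.div_mul_le_self p.T p.K
    rw [Nat.succ_mul] at *; omega
  have hy := hr.y_mem hεI hε hloo hset.convex hx₁ hR hset.subset_ball hεR hm.le
  have hxS := (hr.feasible hεI hε hloo hset.convex hx₁ hm.le).1
  have hxB := closedBall_subset_three_mul hR (hset.subset_ball hxS)
  have hzB := closedBall_subset_three_mul hR (hset.subset_ball hz)
  have hA := hr.A_posDef hεI hm.le
  set g := blockGrad (lossGrad R f) p.K r m with hg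
  have hcurv := block_curvature hset hK hmT h1 hy hzB
  rw [← blockGrad, ← hg] at hcurv
  have hnewton := newton_step hA hη g (r.y m) z
  rw [← hr.A_succ m hm] at hnewton
  have hproj := ((hr.proj m hm).spec (hr.A_isHermitian hm) (hr.normSq_A_nonneg hεI hm) hloo
    hset.convex hxS).2.2.2 z hz
  have hsmooth : ∑ s ∈ Finset.range p.K, (f (m * p.K + s) (r.x m) - f (m * p.K + s) (r.y m)) ≤
      ⟪g, r.x m - r.y m⟫_ℝ + p.K * (β * (3 * p.ε / p.εI)) := by
    have : ∀ s ∈ Finset.range p.K, f (m * p.K + s) (r.x m) - f (m * p.K + s) (r.y m) ≤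
        ⟪lossGrad R f (m * p.K + s) (r.y m), r.x m - r.y m⟫_ℝ + β * (3 * p.ε / p.εI) := by
      intro s hs
      have hst : m * p.K + s < p.T := by have := Finset.mem_range.1 hs; omega
      refine (sub_le_inner_gradientWithin (convex_closedBall 0 (3 * R)) hset.β_nonneg
        (hset.gradBound _ hst).1 (hset.smooth _ hst) hxB hy).trans ?_
      have := hset.β_nonneg
      gcongr
      · exact le_rfl
      · exact hr.norm_sub_sq_le hεI hε hloo hset.convex hx₁ hm.le
    refine (Finset.sum_le_sum this).trans ?_
    rw [Finset.sum_add_distrib, ← sum_inner, ← blockGrad, ← hg]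
    simp
  -- The pulls only shorten the distance to `z` in the norm of the new matrix, so the unprojected
  -- Newton point may replace `y (m + 1)`.
  have hmono : 1 / (2 * p.η) * normSq (r.A (m + 1)) (r.y (m + 1) - z) ≤ 1 / (2 * p.η) *
      normSq (r.A (m + 1)) (r.y m - p.η • Mat.app (r.A (m + 1))⁻¹ g - z) := by gcongr
  have hsplit : ∑ s ∈ Finset.range p.K, (f (m * p.K + s) (r.x m) - f (m * p.K + s) z) =
      ∑ s ∈ Finset.range p.K, (f (m * p.K + s) (r.x m) - f (m * p.K + s) (r.y m)) +
      ∑ s ∈ Finset.range p.K, (f (m * p.K + s) (r.y m) - f (m * p.K + s) z) := by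
    rw [← Finset.sum_add_distrib]
    exact Finset.sum_congr rfl fun s _ => by ring
  rw [hsplit]
  rw [mul_sub] at hnewton ⊢
  linarith

/-- The local norms of the gradients, summed up, are controlled by the growth of `log det A`. -/
theorem sum_log_eq (hεI : 0 < p.εI) (hr : IsRun grad loo p r) {m : ℕ} (hm : m ≤ p.T / p.K) :
    ∑ j ∈ Finset.range m, Real.log (1 + ⟪blockGrad grad p.K r j,
        Mat.app (r.A j)⁻¹ (blockGrad grad p.K r j)⟫_ℝ) =
      Real.log (r.A m).det - n * Real.log p.εI := by
  induction m with
  | zero =>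
    rw [hr.A_zero]
    simp [Real.log_pow]
  | succ m ih =>
    have hA := hr.A_posDef hεI (m := m) (by omega)
    have h0 := inner_inv_nonneg hA (blockGrad grad p.K r m)
    rw [Finset.sum_range_succ, ih (by omega), hr.A_succ m hm, det_add_outer hA,
      Real.log_mul hA.det_pos.ne' (by positivity)]
    ring

/-- Cauchy-Schwarz inside each block costs the factor `K`. This is the constant `κ` with which
`log_det_le_tail` is applied. -/
theorem sum_inner_sq_le_tail (r : Run n) (hK : 0 < p.K) (hKT : p.K ∣ p.T)
    (x : Vec n) :
    ∑ j ∈ Finset.range (p.T / p.K), ⟪blockGrad grad p.K r j, x⟫_ℝ ^ 2 ≤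
      p.K * normSq (gradCov grad p r) x := by
  have h1 : normSq (gradCov grad p r) x =
      ∑ t ∈ Finset.range p.T, ⟪grad t (r.y (t / p.K)), x⟫_ℝ ^ 2 := by
    have : ∀ N, normSq (∑ t ∈ Finset.range N, outer (grad t (r.y (t / p.K)))) x =
        ∑ t ∈ Finset.range N, ⟪grad t (r.y (t / p.K)), x⟫_ℝ ^ 2 := by
      intro N
      induction N with
      | zero => simp [normSq, Mat.app]
      | succ N ih => rw [Finset.sum_range_succ, normSq_add_outer, ih, Finset.sum_range_succ]
    exact this _
  rw [h1]
  conv_rhs => rw [← Nat.div_mul_cancel hKT]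
  rw [sum_range_blocks, Finset.mul_sum]
  refine Finset.sum_le_sum fun m _ => ?_
  have e : ∀ s ∈ Finset.range p.K, ⟪grad (m * p.K + s) (r.y ((m * p.K + s) / p.K)), x⟫_ℝ ^ 2 =
      ⟪grad (m * p.K + s) (r.y m), x⟫_ℝ ^ 2 := by
    intro s hs
    have : (m * p.K + s) / p.K = m := by
      rw [mul_comm, Nat.mul_add_div hK, Nat.div_eq_of_lt (Finset.mem_range.1 hs), add_zero]
    rw [this]
  rw [Finset.sum_congr rfl e, blockGrad, sum_inner]
  simpa using sq_sum_le_card_mul_sum_sq (s := Finset.range p.K)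
    (f := fun s => ⟪grad (m * p.K + s) (r.y m), x⟫_ℝ)

theorem log_det_run_le (hr : IsRun grad loo p r) (hεI : 0 < p.εI) (hK : 0 < p.K)
    (hKT : p.K ∣ p.T) {G : ℝ}
    (hg : ∀ m < p.T / p.K, ‖blockGrad grad p.K r m‖ ≤ p.K * G) {ρ : ℕ} (hρ : 1 ≤ ρ)
    (hρn : ρ ≤ n) :
    Real.log (r.A (p.T / p.K)).det - n * Real.log p.εI ≤
      ρ * Real.log (1 + (p.T / p.K : ℕ) * (p.K * G) ^ 2 / (ρ * p.εI)) +
        p.K / p.εI * tailEigenvalues grad p r ρ := by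
  refine log_det_le_tail (hr.A_posDef hεI le_rfl) (gradCov_isHermitian grad p r) hεI
    (by positivity) (fun x => hr.normSq_A le_rfl x)
    (fun x => Finset.sum_nonneg fun _ _ => sq_nonneg _) (sum_inner_sq_le_tail r hK hKT) ?_ hρ hρn
  -- By Parseval, the quadratic form of the block gradients summed over the eigenbasis is the sum of
  -- their squared norms.
  rw [Finset.sum_comm]
  calc ∑ j ∈ Finset.range (p.T / p.K), ∑ i, ⟪blockGrad grad p.K r j,
        (gradCov_isHermitian grad p r).eigenvectorBasis i⟫_ℝ ^ 2
      = ∑ j ∈ Finset.range (p.T / p.K), ‖blockGrad grad p.K r j‖ ^ 2 := by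
        refine Finset.sum_congr rfl fun j _ => ?_
        rw [← (gradCov_isHermitian grad p r).eigenvectorBasis.sum_sq_norm_inner_left]
        simp
    _ ≤ ∑ j ∈ Finset.range (p.T / p.K), (p.K * G) ^ 2 := Finset.sum_le_sum fun j hj => by
        have := hg j (Finset.mem_range.1 hj)
        gcongr
    _ = _ := by simp

theorem tailEigenvalues_nonneg (grad : ℕ → Vec n → Vec n) (p : Params n) (r : Run n) (ρ : ℕ) :
    0 ≤ tailEigenvalues grad p r ρ := by
  have hpsd : (gradCov grad p r).PosSemidef := by
    refine Matrix.posSemidef_sum _ fun t _ => ?_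
    simpa [outer] using Matrix.posSemidef_vecMulVec_self_star (grad t (r.y (t / p.K))).ofLp
  refine Finset.sum_nonneg fun i _ => ?_
  split_ifs
  · have := hpsd.eigenvalues_nonneg ((Fintype.equivOfCardEq (Fintype.card_fin _)) i)
    simpa [Matrix.IsHermitian.eigenvalues] using this
  · exact le_rfl

theorem block_add_le {T K m : ℕ} (hm : m < T / K) : m * K + K ≤ T := by
  have h1 := Nat.mul_le_mul_right K (Nat.succ_le_of_lt hm)
  have h2 := Nat.div_mul_le_self T K
  rw [Nat.succ_mul] at h1; omega

theorem run_norm_blockGrad_le (hset : OCOSetup S R G α β p.T f) (hloo : IsLOO S loo)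
    (hx₁ : p.x₁ ∈ S) (hadm : p.Admissible G R α) (hεI : 0 < p.εI)
    (hr : IsRun (lossGrad R f) loo p r) {m : ℕ} (hm : m < p.T / p.K) :
    ‖blockGrad (lossGrad R f) p.K r m‖ ≤ p.K * G :=
  norm_blockGrad_le hset (block_add_le hm)
    (hr.y_mem hεI hadm.2.2.1 hloo hset.convex hx₁ hset.R_pos hset.subset_ball hadm.2.2.2 hm.le)

/-- The regret bound in terms of the parameters and of a bound `Λ` for the growth of
`log det A`. -/
theorem regret_le (hset : OCOSetup S R G α β p.T f) (hloo : IsLOO S loo) (hx₁ : p.x₁ ∈ S)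
    (hK : 0 < p.K) (hKT : p.K ∣ p.T) (hadm : p.Admissible G R α) (hεI : 0 < p.εI) (hη : 0 < p.η)
    (hKG : 2 * (p.K * G) ^ 2 ≤ p.εI) (hr : IsRun (lossGrad R f) loo p r) {z : Vec n} (hz : z ∈ S)
    {Λ : ℝ} (hΛ : Real.log (r.A (p.T / p.K)).det - n * Real.log p.εI ≤ Λ) :
    ∑ t ∈ Finset.range p.T, f t (r.played p.K t) - ∑ t ∈ Finset.range p.T, f t z ≤
      p.T * (β * (3 * p.ε / p.εI)) + 2 * R ^ 2 * p.εI / p.η + p.η / 2 * Λ +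
        √((p.T / p.K : ℕ) * (3 * p.ε) * (3 / 2 * Λ)) := by
  have hε := hadm.2.2.1
  set M := p.T / p.K with hM
  set g := blockGrad (lossGrad R f) p.K r with hg
  set s : ℕ → ℝ := fun m => ⟪g m, Mat.app (r.A m)⁻¹ (g m)⟫_ℝ with hs
  have hT : (p.T : ℝ) = M * p.K := by
    rw [← Nat.cast_mul, hM, Nat.div_mul_cancel hKT]
  have hblocks : ∑ t ∈ Finset.range p.T, f t (r.played p.K t) - ∑ t ∈ Finset.range p.T, f t z =
      ∑ m ∈ Finset.range M, ∑ i ∈ Finset.range p.K,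
        (f (m * p.K + i) (r.x m) - f (m * p.K + i) z) := by
    rw [← Finset.sum_sub_distrib]
    conv_lhs => rw [← Nat.div_mul_cancel hKT]
    rw [sum_range_blocks]
    refine Finset.sum_congr rfl fun m _ => Finset.sum_congr rfl fun i hi => ?_
    have : (m * p.K + i) / p.K = m := by
      rw [mul_comm, Nat.mul_add_div hK, Nat.div_eq_of_lt (Finset.mem_range.1 hi), add_zero]
    rw [Run.played, this]
  rw [hblocks]
  refine (Finset.sum_le_sum fun m hm => block_regret hset hloo hx₁ hK hadm hεI hη hr
    (Finset.mem_range.1 hm) hz).trans ?_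
  rw [Finset.sum_add_distrib, Finset.sum_add_distrib, Finset.sum_add_distrib, Finset.sum_const,
    ← Finset.mul_sum, ← Finset.mul_sum, Finset.sum_range_sub', sum_log_eq hεI hr le_rfl]
  have hlog : ∑ m ∈ Finset.range M, Real.log (1 + s m) ≤ Λ := by
    rw [← sum_log_eq hεI hr le_rfl] at hΛ; exact hΛ
  have hs0 : ∀ m < M, 0 ≤ s m := fun m hm => inner_inv_nonneg (hr.A_posDef hεI hm.le) _
  -- This is where `2 (KG)² ≤ εI` enters. On `[0, 1/2]` the number `s` and `log (1 + s)` agree up to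
  -- the factor `3/2`.
  have hs1 : ∀ m < M, s m ≤ 1 / 2 := by
    intro m hm
    refine (inner_inv_le (hr.A_posDef hεI hm.le) hεI (hr.le_normSq_A hm.le) (g m)).trans ?_
    rw [div_le_iff₀ hεI]
    have := run_norm_blockGrad_le hset hloo hx₁ hadm hεI hr hm
    have h2 : ‖g m‖ ^ 2 ≤ (p.K * G) ^ 2 := by gcongr
    linarith
  have hslog : ∀ m < M, s m ≤ 3 / 2 * Real.log (1 + s m) := by
    intro m hm
    have h0 := hs0 m hm
    have h1 := hs1 m hm
    have := Real.one_sub_inv_le_log_of_pos (x := 1 + s m) (by positivity)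
    have e : 2 / 3 * s m ≤ 1 - (1 + s m)⁻¹ := by
      rw [show 1 - (1 + s m)⁻¹ = s m / (1 + s m) by field_simp; ring, le_div_iff₀ (by positivity)]
      nlinarith
    linarith
  -- Cauchy-Schwarz twice: over the blocks, which gives the factor `M`, and in the geometry of `A
  -- m`, which gives tolerance times local gradient norm.
  have hlin : ∑ m ∈ Finset.range M, ⟪g m, r.x m - r.y m⟫_ℝ ≤
      √(M * (3 * p.ε) * (3 / 2 * Λ)) := by
    apply Real.le_sqrt_of_sq_le
    refine sq_sum_le_card_mul_sum_sq.trans ?_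
    rw [Finset.card_range, mul_assoc]
    refine mul_le_mul_of_nonneg_left ?_ (Nat.cast_nonneg _)
    calc ∑ m ∈ Finset.range M, ⟪g m, r.x m - r.y m⟫_ℝ ^ 2
        ≤ ∑ m ∈ Finset.range M, (3 * p.ε) * (3 / 2 * Real.log (1 + s m)) := by
          refine Finset.sum_le_sum fun m hm => ?_
          have hm := Finset.mem_range.1 hm
          refine (inner_sq_le_inv (hr.A_posDef hεI hm.le) (hr.normSq_A_nonneg hεI hm.le)
            (g m) _).trans ?_
          rw [mul_comm]
          have h1 := (hr.feasible hεI hε hloo hset.convex hx₁ hm.le).2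
          have h2 := hslog m hm
          have h3 := hs0 m hm
          exact mul_le_mul h1 h2 h3 (by positivity)
      _ = (3 * p.ε) * (3 / 2 * ∑ m ∈ Finset.range M, Real.log (1 + s m)) := by
          rw [Finset.mul_sum, Finset.mul_sum]
      _ ≤ _ := by gcongr
  have hend := hr.normSq_A_nonneg hεI (m := M) le_rfl (r.y M - z)
  have hstart : normSq (r.A 0) (r.y 0 - z) ≤ 4 * R ^ 2 * p.εI := by
    rw [hr.normSq_A (Nat.zero_le _), hr.y_zero]
    have h1 : ‖p.x₁‖ ≤ R := by simpa using hset.subset_ball hx₁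
    have h2 : ‖z‖ ≤ R := by simpa using hset.subset_ball hz
    have h3 : ‖p.x₁ - z‖ ≤ 2 * R := (norm_sub_le _ _).trans (by linarith)
    have h4 : ‖p.x₁ - z‖ ^ 2 ≤ (2 * R) ^ 2 := by gcongr
    simp only [Finset.range_zero, Finset.sum_empty, add_zero]
    nlinarith
  have hβT : (Finset.range M).card • ((p.K : ℝ) * (β * (3 * p.ε / p.εI))) =
      p.T * (β * (3 * p.ε / p.εI)) := by rw [hT]; simp; ring
  -- The final distance is dropped. The initial one is at most `(2R)²` times `εI`, because the
  -- initial matrix is a multiple of the identity.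
  have htel : 1 / (2 * p.η) * (normSq (r.A 0) (r.y 0 - z) - normSq (r.A M) (r.y M - z)) ≤
      2 * R ^ 2 * p.εI / p.η := by
    calc _ ≤ 1 / (2 * p.η) * (4 * R ^ 2 * p.εI) := by gcongr; linarith
      _ = _ := by field_simp; ring
  have hlogη : p.η / 2 * (Real.log (r.A M).det - n * Real.log p.εI) ≤ p.η / 2 * Λ := by gcongr
  linarith

theorem exists_best_point (hset : OCOSetup S R G α β T f) :
    ∃ z ∈ S, IsMinOn (fun w => ∑ t ∈ Finset.range T, f t w) S z := by
  refine hset.compact.exists_isMinOn hset.nonempty ?_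
  refine continuousOn_finsetSum _ fun t ht => ?_
  exact ((hset.gradBound t (Finset.mem_range.1 ht)).1.continuousOn).mono
    (hset.subset_ball.trans (closedBall_subset_three_mul hset.R_pos))

end Regret

/-! ### The number of oracle calls of a run -/

section Calls

variable {n : ℕ} {S : Set (Vec n)} {R G α β : ℝ} {f : ℕ → Vec n → ℝ}
  {loo : ℕ → Vec n → Vec n} {p : Params n} {r : Run n}

theorem normSq_A_le (hset : OCOSetup S R G α β p.T f) (hloo : IsLOO S loo)
    (hx₁ : p.x₁ ∈ S) (hadm : p.Admissible G R α) (hεI : 0 < p.εI)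
    (hr : IsRun (lossGrad R f) loo p r) {m : ℕ} (hm : m ≤ p.T / p.K) (x : Vec n) :
    normSq (r.A m) x ≤ (p.εI + m * (p.K * G) ^ 2) * ‖x‖ ^ 2 := by
  rw [hr.normSq_A hm, add_mul]
  gcongr
  calc ∑ j ∈ Finset.range m, ⟪blockGrad (lossGrad R f) p.K r j, x⟫_ℝ ^ 2
      ≤ ∑ j ∈ Finset.range m, (p.K * G) ^ 2 * ‖x‖ ^ 2 := by
        refine Finset.sum_le_sum fun j hj => ?_
        have h1 := run_norm_blockGrad_le hset hloo hx₁ hadm hεI hr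
          (m := j) (by have := Finset.mem_range.1 hj; omega)
        rw [← sq_abs, ← mul_pow]
        gcongr
        exact (abs_real_inner_le_norm _ _).trans (by gcongr)
    _ = m * (p.K * G) ^ 2 * ‖x‖ ^ 2 := by simp; ring

/-- The distance between the feasible point and the target of the projection. -/
theorem normSq_target_le (hset : OCOSetup S R G α β p.T f) (hloo : IsLOO S loo)
    (hx₁ : p.x₁ ∈ S) (hadm : p.Admissible G R α) (hεI : 0 < p.εI)
    (hr : IsRun (lossGrad R f) loo p r) {m : ℕ} (hm : m < p.T / p.K) :
    normSq (r.A (m + 1)) (r.x m - (r.y m -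
        p.η • Mat.app (r.A (m + 1))⁻¹ (blockGrad (lossGrad R f) p.K r m))) ≤
      12 * p.ε + 2 * p.η ^ 2 * ((p.K * G) ^ 2 / p.εI) := by
  have hε := hadm.2.2.1
  set g := blockGrad (lossGrad R f) p.K r m with hg
  have hgn : ‖g‖ ^ 2 ≤ (p.K * G) ^ 2 := by
    have := run_norm_blockGrad_le hset hloo hx₁ hadm hεI hr hm
    rw [← hg] at this; gcongr
  have hH : (r.A (m + 1)).IsHermitian := hr.A_isHermitian hm
  have hA : (r.A (m + 1)).PosDef := hr.A_posDef hεI hm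
  set w := Mat.app (r.A (m + 1))⁻¹ g with hw
  -- Closeness is known for the old matrix. The rank-one update adds at most another `3ε`, because
  -- `(KG)² ≤ εI`.
  have h1 : normSq (r.A (m + 1)) (r.x m - r.y m) ≤ 6 * p.ε := by
    have hf := (hr.feasible hεI hε hloo hset.convex hx₁ hm.le).2
    have hn := hr.norm_sub_sq_le hεI hε hloo hset.convex hx₁ hm.le
    rw [hr.A_succ m hm, normSq_add_outer, ← hg]
    have hi : ⟪g, r.x m - r.y m⟫_ℝ ^ 2 ≤ ‖g‖ ^ 2 * ‖r.x m - r.y m‖ ^ 2 := by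
      rw [← sq_abs, ← mul_pow]
      gcongr
      exact abs_real_inner_le_norm _ _
    have h2 : ‖g‖ ^ 2 * ‖r.x m - r.y m‖ ^ 2 ≤ p.εI * (3 * p.ε / p.εI) := by
      have := hadm.2.1
      exact mul_le_mul (hgn.trans this) hn (by positivity) hεI.le
    rw [mul_div_cancel₀ _ hεI.ne'] at h2
    linarith
  have h2 : normSq (r.A (m + 1)) w ≤ (p.K * G) ^ 2 / p.εI := by
    rw [normSq, hw, app_inv_app hA, real_inner_comm]
    refine (inner_inv_le hA hεI (hr.le_normSq_A hm) g).trans ?_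
    gcongr
  have e : r.x m - (r.y m - p.η • w) = (r.x m - r.y m) + p.η • w := by abel
  -- The parallelogram law avoids the cross term between the old error and the Newton step.
  have e2 : normSq (r.A (m + 1)) ((r.x m - r.y m) + p.η • w) +
      normSq (r.A (m + 1)) ((r.x m - r.y m) - p.η • w) =
      2 * normSq (r.A (m + 1)) (r.x m - r.y m) + 2 * (p.η ^ 2 * normSq (r.A (m + 1)) w) := by
    rw [normSq_add hH, normSq_sub hH (r.x m - r.y m), normSq_smul]; ring
  have h3 := hr.normSq_A_nonneg hεI hm ((r.x m - r.y m) - p.η • w)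
  rw [e]
  have h4 : p.η ^ 2 * normSq (r.A (m + 1)) w ≤ p.η ^ 2 * ((p.K * G) ^ 2 / p.εI) := by gcongr
  linarith

/-- Each block costs at most `(j + 1)(2 + 8D / ε)` calls, with `D` a bound for the squared diameter
of the feasible set in the current norm. `D` grows linearly with the block number, hence the
quadratic term. -/
theorem run_calls_le (hset : OCOSetup S R G α β p.T f) (hloo : IsLOO S loo)
    (hx₁ : p.x₁ ∈ S) (hadm : p.Admissible G R α) (hεI : 0 < p.εI)
    (hr : IsRun (lossGrad R f) loo p r) {j : ℕ}
    (hj : 12 * p.ε + 2 * p.η ^ 2 * ((p.K * G) ^ 2 / p.εI) ≤ 3 * p.ε * 9 ^ j)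
    {m : ℕ} (hm : m ≤ p.T / p.K) :
    (r.calls m : ℝ) ≤ (j + 1) *
      (2 * m + 32 * R ^ 2 / p.ε * (m * p.εI + (p.K * G) ^ 2 * (m * (m + 1) / 2))) := by
  have hε := hadm.2.2.1
  have hR := hset.R_pos
  induction m with
  | zero => simp [hr.calls_zero]
  | succ m ih =>
    set D : ℝ := (p.εI + (m + 1 : ℕ) * (p.K * G) ^ 2) * (4 * R ^ 2) with hDdef
    have hεD : p.ε ≤ D := by
      have h := hadm.2.2.2
      rw [div_le_iff₀ hεI] at h
      have : 0 ≤ (m + 1 : ℕ) * (p.K * G) ^ 2 * (4 * R ^ 2) := by positivity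
      rw [hDdef, add_mul]
      nlinarith
    have hdiam : ∀ u ∈ S, ∀ v ∈ S, normSq (r.A (m + 1)) (u - v) ≤ D := by
      intro u hu v hv
      refine (normSq_A_le hset hloo hx₁ hadm hεI hr hm _).trans ?_
      have h1 : ‖u‖ ≤ R := by simpa using hset.subset_ball hu
      have h2 : ‖v‖ ≤ R := by simpa using hset.subset_ball hv
      have h3 : ‖u - v‖ ≤ 2 * R := (norm_sub_le _ _).trans (by linarith)
      have h4 : ‖u - v‖ ^ 2 ≤ (2 * R) ^ 2 := by gcongr
      rw [hDdef]
      gcongr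
      linarith
    have h := (hr.proj m hm).calls_le (hr.A_isHermitian hm) (hr.normSq_A_nonneg hεI hm) hloo
      hset.convex hset.compact hε hεD hdiam
      (hr.feasible hεI hε hloo hset.convex hx₁ (by omega)).1 j
      ((normSq_target_le hset hloo hx₁ hadm hεI hr hm).trans hj)
    have hi := ih (by omega)
    refine h.trans ((add_le_add_left hi _).trans (le_of_eq ?_))
    rw [hDdef]; push_cast; field_simp; ring

end Calls

/-! ### The tuned parameters -/

section Tuning

variable {n d T K : ℕ} {G R α : ℝ} {x₁ : Vec n}

theorem rpow_third_pow (k : ℕ) {x : ℝ} (hx : 0 ≤ x) :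
    x ^ ((k : ℝ) / 3) = (x ^ (1 / 3 : ℝ)) ^ k := by
  rw [← Real.rpow_natCast, ← Real.rpow_mul hx]; congr 1; ring

/-- The tuned parameters in terms of `τ = T^{1/3}` and `δ = d^{1/3}`. -/
structure TuningFacts (d T K : ℕ) (G R α τ δ L ℓ l : ℝ) : Prop where
  τ_eq : (T : ℝ) ^ (1 / 3 : ℝ) = τ
  δ_eq : (d : ℝ) ^ (1 / 3 : ℝ) = δ
  τ_cube : τ ^ 3 = T
  δ_cube : δ ^ 3 = d
  δ_ge : 1 ≤ δ
  τ_ge : 10 * L ≤ τ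
  K_eq : (K : ℝ) = 4 * τ ^ 2 / δ
  blocks_eq : ((T / K : ℕ) : ℝ) = δ * τ / 4
  L_eq : L = Real.log (19 + 8 * (12 + 1 / (3 * R ^ 2 * G ^ 2 * α ^ 2)) * (τ / δ ^ 4))
  L_ge : 2.9 ≤ L
  L_le : L ≤ ℓ
  l_le : l ≤ ℓ
  log_le : Real.log (1 + τ / 8) ≤ l

theorem tuned_eq (n : ℕ) (x₁ : Vec n) {τ δ L ℓ l : ℝ} (h : TuningFacts d T K G R α τ δ L ℓ l) :
    tuned d T K G R α x₁ = ⟨T, K, 8 * max (6 * G * R) (1 / α) * τ ^ 2 / δ,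
      32 * G ^ 2 * τ ^ 4, 96 * G ^ 2 * R ^ 2 * L * τ ^ 3, x₁⟩ := by
  have hT : (0 : ℝ) ≤ T := Nat.cast_nonneg _
  have hd : (0 : ℝ) ≤ d := Nat.cast_nonneg _
  have e1 : (T : ℝ) ^ (2 / 3 : ℝ) = τ ^ 2 := by
    rw [← h.τ_eq, ← rpow_third_pow 2 hT]; norm_num
  have e2 : (T : ℝ) ^ (4 / 3 : ℝ) = τ ^ 4 := by
    rw [← h.τ_eq, ← rpow_third_pow 4 hT]; norm_num
  have e3 : (d : ℝ) ^ (-(1 / 3) : ℝ) = δ⁻¹ := by rw [Real.rpow_neg hd, h.δ_eq]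
  have e4 : (d : ℝ) ^ (-(4 / 3) : ℝ) = (δ ^ 4)⁻¹ := by
    rw [Real.rpow_neg hd, ← h.δ_eq, ← rpow_third_pow 4 hd]; norm_num
  simp only [tuned, e1, e2, e3, e4, h.τ_eq, h.L_eq]
  congr 1
  · ring
  · rw [mul_assoc (8 * _) (δ ^ 4)⁻¹ τ, inv_mul_eq_div, h.τ_cube]

/-- Explains the `19` in the tuning: it forces `L ≥ 2.9`, which `exists_nine_pow` needs. -/
theorem exp_le_19 : Real.exp 2.9 ≤ 19 := by
  have h : Real.exp 2.9 = Real.exp 1 ^ 3 / Real.exp 0.1 := by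
    rw [← Real.exp_nat_mul, ← Real.exp_sub]; norm_num
  rw [h, div_le_iff₀ (Real.exp_pos _)]
  have h1 := Real.exp_one_lt_d9
  have h2 := Real.add_one_le_exp (0.1 : ℝ)
  have h3 : Real.exp 1 ^ 3 ≤ 2.7182818286 ^ 3 := by gcongr
  linarith

/-- Converts the fractional powers into monomials in `τ` and `δ`. The threshold constant is `1000 =
10³`, so that the cube root of the horizon condition reads `10 L ≤ τ`. -/
theorem tuningFacts (hd : 1 ≤ d) (hT : 0 < T) (hG : 0 < G) (hR : 0 < R) (hα : 0 < α)
    (hK : (K : ℝ) = blockLength d T) (hKT : K ∣ T) (hT₀ : horizonThreshold 1000 d T G R α ≤ T) :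
    TuningFacts d T K G R α ((T : ℝ) ^ (1 / 3 : ℝ)) ((d : ℝ) ^ (1 / 3 : ℝ))
      (Real.log (19 + 8 * (12 + 1 / (3 * R ^ 2 * G ^ 2 * α ^ 2)) *
        ((T : ℝ) ^ (1 / 3 : ℝ) / ((d : ℝ) ^ (1 / 3 : ℝ)) ^ 4)))
      (logFactor 1000 T G R α) (Real.log (1000 * (T : ℝ) ^ (1 / 3 : ℝ))) := by
  have hT1 : (1 : ℝ) ≤ T := by exact_mod_cast hT
  have hd1 : (1 : ℝ) ≤ d := by exact_mod_cast hd
  have hT0 : (0 : ℝ) ≤ T := by linarith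
  have hd0 : (0 : ℝ) ≤ d := by linarith
  have hτ1 : 1 ≤ (T : ℝ) ^ (1 / 3 : ℝ) := Real.one_le_rpow hT1 (by norm_num)
  have hδ1 : 1 ≤ (d : ℝ) ^ (1 / 3 : ℝ) := Real.one_le_rpow hd1 (by norm_num)
  have hτ3 : ((T : ℝ) ^ (1 / 3 : ℝ)) ^ 3 = T := by rw [← rpow_third_pow 3 hT0]; norm_num
  have hδ3 : ((d : ℝ) ^ (1 / 3 : ℝ)) ^ 3 = d := by rw [← rpow_third_pow 3 hd0]; norm_num
  have e1 : (T : ℝ) ^ (2 / 3 : ℝ) = ((T : ℝ) ^ (1 / 3 : ℝ)) ^ 2 := by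
    rw [← rpow_third_pow 2 hT0]; norm_num
  have e3 : (d : ℝ) ^ (-(1 / 3) : ℝ) = ((d : ℝ) ^ (1 / 3 : ℝ))⁻¹ := by rw [Real.rpow_neg hd0]
  have e4 : (d : ℝ) ^ (-(4 / 3) : ℝ) = (((d : ℝ) ^ (1 / 3 : ℝ)) ^ 4)⁻¹ := by
    rw [Real.rpow_neg hd0, ← rpow_third_pow 4 hd0]; norm_num
  rw [blockLength, e1, e3] at hK
  rw [horizonThreshold, e4] at hT₀
  rw [logFactor]
  set τ := (T : ℝ) ^ (1 / 3 : ℝ) with hτ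
  set δ := (d : ℝ) ^ (1 / 3 : ℝ) with hδ
  have hτ0 : 0 < τ := by linarith
  have hδ0 : 0 < δ := by linarith
  have hq : 1 / (3 * R ^ 2 * G ^ 2 * α ^ 2) = 1 / (R ^ 2 * G ^ 2 * α ^ 2) / 3 := by
    field_simp
  have hq' : 1000 / (R ^ 2 * G ^ 2 * α ^ 2) = 1000 * (1 / (R ^ 2 * G ^ 2 * α ^ 2)) := by ring
  set q := 1 / (R ^ 2 * G ^ 2 * α ^ 2) with hqdef
  have hq0 : 0 < q := by positivity
  rw [hq'] at hT₀
  rw [hq, hq']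
  have hu : 0 < τ / δ ^ 4 := by positivity
  have hδ4 : 1 ≤ δ ^ 4 := one_le_pow₀ hδ1
  have hu' : τ / δ ^ 4 ≤ τ := div_le_self hτ0.le hδ4
  set u := τ / δ ^ 4 with hudef
  have hX : 19 ≤ 19 + 8 * (12 + q / 3) * u := by
    have : 0 ≤ 8 * (12 + q / 3) * u := by positivity
    linarith
  have hqu : 0 ≤ q * u := by positivity
  have hL : 2.9 ≤ Real.log (19 + 8 * (12 + q / 3) * u) := by
    rw [Real.le_log_iff_exp_le (by linarith)]
    exact exp_le_19.trans hX
  have hK4 : (K : ℝ) = 4 * τ ^ 2 / δ := by rw [hK]; ring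
  have hKpos : (0 : ℝ) < K := by rw [hK4]; positivity
  refine ⟨rfl, rfl, hτ3, hδ3, hδ1, ?_, hK4, ?_, by rw [hq], hL, ?_, ?_, ?_⟩
  · have h1 : Real.log (19 + 8 * (12 + q / 3) * u) ≤
        Real.log (1000 + (1000 + 1000 * q) * (δ ^ 4)⁻¹ * τ) := by
      apply Real.log_le_log (by linarith)
      have : (1000 + 1000 * q) * (δ ^ 4)⁻¹ * τ = (1000 + 1000 * q) * u := by rw [hudef]; ring
      rw [this]; nlinarith
    have h2 : (10 * Real.log (19 + 8 * (12 + q / 3) * u)) ^ 3 ≤ τ ^ 3 := by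
      rw [hτ3]
      refine le_trans ?_ hT₀
      rw [mul_pow]
      norm_num only
      have : 0 ≤ Real.log (19 + 8 * (12 + q / 3) * u) := by linarith
      gcongr
    exact le_of_pow_le_pow_left₀ (by norm_num) hτ0.le h2
  -- Divisibility makes the natural quotient exact, so the number of blocks follows by cancelling
  -- `K`.
  · have h1 : ((T / K : ℕ) : ℝ) * K = τ ^ 3 := by
      rw [← Nat.cast_mul, Nat.div_mul_cancel hKT, hτ3]
    have h2 : δ * τ / 4 * K = τ ^ 3 := by rw [hK4]; field_simp
    exact mul_right_cancel₀ hKpos.ne' (h1.trans h2.symm)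
  · apply Real.log_le_log (by linarith)
    have : q * u ≤ q * τ := by gcongr
    nlinarith
  · apply Real.log_le_log (by positivity)
    have : 0 ≤ q * τ := by positivity
    nlinarith
  · apply Real.log_le_log (by positivity)
    linarith

variable {τ δ L ℓ l : ℝ}

theorem tuned_admissible (hG : 0 < G) (hR : 0 < R)
    (h : TuningFacts d T K G R α τ δ L ℓ l) :
    (tuned d T K G R α x₁).Admissible G R α ∧ 2 * (K * G) ^ 2 ≤ (tuned d T K G R α x₁).εI := by
  have hL := h.L_ge
  have hτ := h.τ_ge
  have hδ := h.δ_ge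
  have hτ0 : 0 < τ := by linarith
  have hδ0 : 0 < δ := by linarith
  have hKG : 2 * (K * G) ^ 2 ≤ 32 * G ^ 2 * τ ^ 4 := by
    rw [h.K_eq]
    have e : 2 * (4 * τ ^ 2 / δ * G) ^ 2 = 32 * G ^ 2 * τ ^ 4 / δ ^ 2 := by field_simp; ring
    rw [e]
    exact div_le_self (by positivity) (one_le_pow₀ hδ)
  rw [tuned_eq n x₁ h]
  refine ⟨⟨?_, ?_, ?_, ?_⟩, hKG⟩
  · simp only
    rw [h.K_eq, max_le_iff]
    have h1 := le_max_left (6 * G * R) (1 / α)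
    have h2 := le_max_right (6 * G * R) (1 / α)
    constructor
    · calc 12 * (4 * τ ^ 2 / δ) * G * R = 8 * (6 * G * R) * τ ^ 2 / δ := by ring
        _ ≤ _ := by gcongr
    · calc 2 * (4 * τ ^ 2 / δ) / α = 8 * (1 / α) * τ ^ 2 / δ := by ring
        _ ≤ _ := by gcongr
  · simp only
    have : 0 ≤ (K * G) ^ 2 := by positivity
    linarith
  · simp only; positivity
  · simp only
    rw [div_le_iff₀ (by positivity)]
    have : 96 * 3 * L ≤ 4 * 32 * τ := by linarith
    calc 3 * (96 * G ^ 2 * R ^ 2 * L * τ ^ 3) = (96 * 3 * L) * (G ^ 2 * R ^ 2 * τ ^ 3) := by ring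
      _ ≤ (4 * 32 * τ) * (G ^ 2 * R ^ 2 * τ ^ 3) := by gcongr
      _ = _ := by ring

variable {S : Set (Vec n)} {β : ℝ} {f : ℕ → Vec n → ℝ} {loo : ℕ → Vec n → Vec n} {r : Run n}

/-- Since `e² ≤ 9`, the exponent `⌈L / 2⌉` suffices. It is less than `L / 2 + 1`, and adding one
more stays below `1.2 L` because `2 ≤ 0.7 L`. -/
theorem exists_nine_pow (hL : 2.9 ≤ L) : ∃ j : ℕ, (j : ℝ) + 1 ≤ 1.2 * L ∧ Real.exp L ≤ 9 ^ j := by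
  refine ⟨⌈L / 2⌉₊, ?_, ?_⟩
  · have : (⌈L / 2⌉₊ : ℝ) < L / 2 + 1 := Nat.ceil_lt_add_one (by linarith)
    linarith
  · have hj1 : L / 2 ≤ ⌈L / 2⌉₊ := Nat.le_ceil _
    generalize ⌈L / 2⌉₊ = j at hj1
    have h1 : Real.exp 1 ^ 2 ≤ 9 := by
      have := Real.exp_one_lt_d9
      have h3 : Real.exp 1 ^ 2 ≤ 3 ^ 2 := by gcongr; linarith
      linarith
    calc Real.exp L ≤ Real.exp ((j : ℝ) * 2) := Real.exp_le_exp.2 (by linarith)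
      _ = (Real.exp 1 ^ 2) ^ j := by
          rw [← pow_mul, ← Real.exp_nat_mul]; congr 1; push_cast; ring
      _ ≤ 9 ^ j := by gcongr

theorem max_sq_le (hG : 0 < G) (hR : 0 < R) (hα : 0 < α) :
    max (6 * G * R) (1 / α) ^ 2 ≤ 36 * G ^ 2 * R ^ 2 + 1 / α ^ 2 := by
  have e1 : (1 / α) ^ 2 = 1 / α ^ 2 := by ring
  have h1 : 0 < 1 / α ^ 2 := by positivity
  have h2 : 0 ≤ G ^ 2 * R ^ 2 := by positivity
  rcases max_cases (6 * G * R) (1 / α) with ⟨e, -⟩ | ⟨e, -⟩ <;> rw [e]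
  · linarith [show (6 * G * R) ^ 2 = 36 * G ^ 2 * R ^ 2 by ring]
  · rw [e1]; linarith

/-- The argument of the logarithm in `ε` is made for this: multiplied by `3ε`, its constant part
exceeds `12ε`, and its part proportional to `τ / δ⁴` covers the squared Newton step. -/
theorem tuned_target_le (hG : 0 < G) (hR : 0 < R) (hα : 0 < α)
    (h : TuningFacts d T K G R α τ δ L ℓ l) {j : ℕ} (h9 : Real.exp L ≤ 9 ^ j) :
    12 * (96 * G ^ 2 * R ^ 2 * L * τ ^ 3) +
      2 * (8 * max (6 * G * R) (1 / α) * τ ^ 2 / δ) ^ 2 * ((K * G) ^ 2 / (32 * G ^ 2 * τ ^ 4)) ≤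
      3 * (96 * G ^ 2 * R ^ 2 * L * τ ^ 3) * 9 ^ j := by
  have hL := h.L_ge
  have hτ := h.τ_ge
  have hδ := h.δ_ge
  have hτ0 : 0 < τ := by linarith
  have hδ0 : 0 < δ := by linarith
  have hmax := max_sq_le hG hR hα
  have hX : 0 < 19 + 8 * (12 + 1 / (3 * R ^ 2 * G ^ 2 * α ^ 2)) * (τ / δ ^ 4) := by positivity
  have hexp : Real.exp L = 19 + 8 * (12 + 1 / (3 * R ^ 2 * G ^ 2 * α ^ 2)) * (τ / δ ^ 4) := by
    rw [h.L_eq, Real.exp_log hX]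
  generalize max (6 * G * R) (1 / α) = μ at hmax
  have e1 : 2 * (8 * μ * τ ^ 2 / δ) ^ 2 *
      ((K * G) ^ 2 / (32 * G ^ 2 * τ ^ 4)) = 64 * τ ^ 4 / δ ^ 4 * μ ^ 2 := by
    rw [h.K_eq]; field_simp; ring
  have e2 : 3 * (96 * G ^ 2 * R ^ 2 * L * τ ^ 3) * Real.exp L =
      57 * (96 * G ^ 2 * R ^ 2 * L * τ ^ 3) +
      12 * L * (64 * τ ^ 4 / δ ^ 4 * (36 * G ^ 2 * R ^ 2 + 1 / α ^ 2)) := by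
    rw [hexp]; field_simp; ring
  have h1 : 3 * (96 * G ^ 2 * R ^ 2 * L * τ ^ 3) * Real.exp L ≤
    3 * (96 * G ^ 2 * R ^ 2 * L * τ ^ 3) * 9 ^ j := by gcongr
  have h2 : 64 * τ ^ 4 / δ ^ 4 * μ ^ 2 ≤
      64 * τ ^ 4 / δ ^ 4 * (36 * G ^ 2 * R ^ 2 + 1 / α ^ 2) := by gcongr
  have h3 : 1 * (64 * τ ^ 4 / δ ^ 4 * (36 * G ^ 2 * R ^ 2 + 1 / α ^ 2)) ≤
      12 * L * (64 * τ ^ 4 / δ ^ 4 * (36 * G ^ 2 * R ^ 2 + 1 / α ^ 2)) := by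
    gcongr; linarith
  have h4 : 0 ≤ 96 * G ^ 2 * R ^ 2 * L * τ ^ 3 := by positivity
  rw [e1]; linarith

/-- The number of Frank-Wolfe runs is at most `1.2 L`, while `1 / ε` carries `1 / L`, so the
logarithms cancel in the main terms. The one that survives is absorbed by `L ≤ τ`. -/
theorem tuned_calls_arith (hG : 0 < G) (hR : 0 < R) (hL : 2.9 ≤ L) (hτ : 10 * L ≤ τ)
    (hδ : 1 ≤ δ) {N : ℝ} (hN : N ≤ 1.2 * L) :
    N * (2 * (δ * τ / 4) + 32 * R ^ 2 / (96 * G ^ 2 * R ^ 2 * L * τ ^ 3) *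
      (δ * τ / 4 * (32 * G ^ 2 * τ ^ 4) + (4 * τ ^ 2 / δ * G) ^ 2 *
        (δ * τ / 4 * (δ * τ / 4 + 1) / 2))) ≤ 0.65 * (8 * δ * τ ^ 2 + τ ^ 3) := by
  have hL0 : 0 < L := by linarith
  have hτ0 : 0 < τ := by linarith
  have hδ0 : 0 < δ := by linarith
  have e : 2 * (δ * τ / 4) + 32 * R ^ 2 / (96 * G ^ 2 * R ^ 2 * L * τ ^ 3) *
      (δ * τ / 4 * (32 * G ^ 2 * τ ^ 4) + (4 * τ ^ 2 / δ * G) ^ 2 *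
        (δ * τ / 4 * (δ * τ / 4 + 1) / 2)) =
      δ * τ / 2 + (8 * δ * τ ^ 2 + τ ^ 3 / 2 + 2 * τ ^ 2 / δ) / (3 * L) := by
    field_simp; ring
  have hδi : 2 * τ ^ 2 / δ ≤ 2 * δ * τ ^ 2 := by
    rw [div_le_iff₀ hδ0]
    have h1 : 1 ≤ δ * δ := by nlinarith
    have h2 : 2 * τ ^ 2 * 1 ≤ 2 * τ ^ 2 * (δ * δ) := by gcongr
    linarith
  rw [e]
  calc N * (δ * τ / 2 + (8 * δ * τ ^ 2 + τ ^ 3 / 2 + 2 * τ ^ 2 / δ) / (3 * L))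
      ≤ 1.2 * L * (δ * τ / 2 + (8 * δ * τ ^ 2 + τ ^ 3 / 2 + 2 * δ * τ ^ 2) / (3 * L)) := by
        gcongr
    _ = 0.6 * δ * τ * L + 4 * δ * τ ^ 2 + 0.2 * τ ^ 3 := by field_simp; ring
    _ ≤ 0.6 * δ * τ * τ + 4 * δ * τ ^ 2 + 0.65 * τ ^ 3 := by
        gcongr
        · linarith
        · norm_num
    _ ≤ 0.65 * (8 * δ * τ ^ 2 + τ ^ 3) := by
        have : 0 ≤ δ * τ ^ 2 := by positivity
        nlinarith

theorem tuned_calls_le (hset : OCOSetup S R G α β T f) (hloo : IsLOO S loo) (hx₁ : x₁ ∈ S)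
    (hdn : d ≤ n) (h : TuningFacts d T K G R α τ δ L ℓ l)
    (hr : IsRun (lossGrad R f) loo (tuned d T K G R α x₁) r) :
    (r.calls (T / K) : ℝ) ≤
      0.65 * (8 * (n : ℝ) ^ (1 / 3 : ℝ) * (T : ℝ) ^ (2 / 3 : ℝ) + T) := by
  have hG := hset.G_pos
  have hR := hset.R_pos
  have hτ0 : 0 < τ := by linarith [h.L_ge, h.τ_ge]
  obtain ⟨hadm, -⟩ := tuned_admissible (x₁ := x₁) hG hR h
  rw [tuned_eq n x₁ h] at hr hadm
  obtain ⟨j, hN, h9⟩ := exists_nine_pow h.L_ge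
  have hc := run_calls_le (p := ⟨T, K, 8 * max (6 * G * R) (1 / α) * τ ^ 2 / δ,
      32 * G ^ 2 * τ ^ 4, 96 * G ^ 2 * R ^ 2 * L * τ ^ 3, x₁⟩) hset hloo hx₁ hadm
      (by simp only; positivity) hr (tuned_target_le hG hR hset.α_pos h h9) le_rfl
  simp only at hc
  rw [h.blocks_eq, h.K_eq] at hc
  have hT23 : (T : ℝ) ^ (2 / 3 : ℝ) = τ ^ 2 := by
    rw [← h.τ_eq, ← rpow_third_pow 2 (Nat.cast_nonneg _)]; norm_num
  have hn : δ ≤ (n : ℝ) ^ (1 / 3 : ℝ) := by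
    rw [← h.δ_eq]
    exact Real.rpow_le_rpow (Nat.cast_nonneg _) (by exact_mod_cast hdn) (by norm_num)
  rw [hT23, ← h.τ_cube]
  refine (hc.trans (tuned_calls_arith hG hR h.L_ge h.τ_ge h.δ_ge hN)).trans ?_
  gcongr

/-- The rank `ρ` of the analysis is kept separate from the `d` of the tuning; all regret bounds of
the theorem are specialisations. -/
theorem tuned_regret_le (hset : OCOSetup S R G α β T f) (hloo : IsLOO S loo) (hx₁ : x₁ ∈ S)
    (hK : 0 < K) (hKT : K ∣ T) (h : TuningFacts d T K G R α τ δ L ℓ l)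
    (hr : IsRun (lossGrad R f) loo (tuned d T K G R α x₁) r) {z : Vec n} (hz : z ∈ S)
    {ρ : ℕ} (hρ : 1 ≤ ρ) (hρn : ρ ≤ n) {Ω : ℝ}
    (hΩ : tailEigenvalues (lossGrad R f) (tuned d T K G R α x₁) r ρ = Ω) :
    ∑ t ∈ Finset.range T, f t (r.played K t) - ∑ t ∈ Finset.range T, f t z ≤
      9 * β * R ^ 2 * τ ^ 2 * ℓ + 2 * R * G * δ * τ ^ 2
        + (24 * G * R + 4 / α) * (ρ / δ) * τ ^ 2 * l + 12 * G * R * √(ρ * δ) * τ ^ 2 * ℓ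
        + 5 * R * τ * √Ω * √ℓ + (3 * G * R + 1 / (2 * α)) / (G ^ 2 * δ ^ 2) * Ω := by
  have hG := hset.G_pos
  have hR := hset.R_pos
  have hα := hset.α_pos
  have hβ := hset.β_nonneg
  have hL := h.L_ge
  have hτ := h.τ_ge
  have hδ := h.δ_ge
  have hτ0 : 0 < τ := by linarith
  have hδ0 : 0 < δ := by linarith
  have hL0 : 0 < L := by linarith
  have hℓ0 : 0 < ℓ := by linarith [h.L_le]
  have hρ1 : (1 : ℝ) ≤ ρ := by exact_mod_cast hρ
  have hl0 : 0 ≤ l := (Real.log_nonneg (by linarith)).trans h.log_le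
  have hΩ0 : 0 ≤ Ω := hΩ ▸ tailEigenvalues_nonneg _ _ _ _
  obtain ⟨hadm, hKG⟩ := tuned_admissible (x₁ := x₁) hG hR h
  rw [tuned_eq n x₁ h] at hr hadm hKG hΩ
  set p : Params n := ⟨T, K, 8 * max (6 * G * R) (1 / α) * τ ^ 2 / δ,
      32 * G ^ 2 * τ ^ 4, 96 * G ^ 2 * R ^ 2 * L * τ ^ 3, x₁⟩ with hp
  have hmax0 : 0 < max (6 * G * R) (1 / α) := lt_max_of_lt_left (by positivity)
  have hεI : 0 < p.εI := by simp only [hp]; positivity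
  have hη : 0 < p.η := by simp only [hp]; positivity
  have hlogdet := log_det_run_le hr hεI hK hKT
    (fun m hm => run_norm_blockGrad_le hset hloo hx₁ hadm hεI hr hm) hρ hρn
  rw [hΩ] at hlogdet
  have hΛ : Real.log (r.A (p.T / p.K)).det - n * Real.log p.εI ≤
      ρ * l + Ω / (8 * G ^ 2 * δ * τ ^ 2) := by
    refine hlogdet.trans (add_le_add ?_ (le_of_eq ?_))
    · refine mul_le_mul_of_nonneg_left (le_trans ?_ h.log_le) (by positivity)
      simp only [hp]
      rw [h.blocks_eq, h.K_eq]
      apply Real.log_le_log (by positivity)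
      have e : δ * τ / 4 * (4 * τ ^ 2 / δ * G) ^ 2 / (ρ * (32 * G ^ 2 * τ ^ 4)) =
          τ / 8 / (δ * ρ) := by field_simp; ring
      rw [e]
      have : τ / 8 / (δ * ρ) ≤ τ / 8 := div_le_self (by positivity) (by nlinarith)
      linarith
    · simp only [hp]; rw [h.K_eq]; field_simp; ring
  have hmain := regret_le hset hloo hx₁ hK hKT hadm hεI hη hKG hr hz hΛ
  simp only [hp] at hmain
  rw [h.blocks_eq] at hmain
  refine hmain.trans ?_
  have t1 : (T : ℝ) * (β * (3 * (96 * G ^ 2 * R ^ 2 * L * τ ^ 3) / (32 * G ^ 2 * τ ^ 4))) ≤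
      9 * β * R ^ 2 * τ ^ 2 * ℓ := by
    rw [← h.τ_cube]
    calc τ ^ 3 * (β * (3 * (96 * G ^ 2 * R ^ 2 * L * τ ^ 3) / (32 * G ^ 2 * τ ^ 4)))
        = 9 * β * R ^ 2 * τ ^ 2 * L := by field_simp; ring
      _ ≤ _ := by gcongr; exact h.L_le
  -- Here `η` is a denominator, so only the part `6GR` of the maximum is kept. In the next term it
  -- is a factor, and the maximum is replaced by the sum.
  have t2 : 2 * R ^ 2 * (32 * G ^ 2 * τ ^ 4) / (8 * max (6 * G * R) (1 / α) * τ ^ 2 / δ) ≤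
      2 * R * G * δ * τ ^ 2 := by
    calc 2 * R ^ 2 * (32 * G ^ 2 * τ ^ 4) / (8 * max (6 * G * R) (1 / α) * τ ^ 2 / δ)
        ≤ 2 * R ^ 2 * (32 * G ^ 2 * τ ^ 4) / (8 * (6 * G * R) * τ ^ 2 / δ) := by
          gcongr; exact le_max_left _ _
      _ = 4 / 3 * (R * G * δ * τ ^ 2) := by field_simp; ring
      _ ≤ _ := by have : 0 ≤ R * G * δ * τ ^ 2 := by positivity
                  linarith
  have t3 : 8 * max (6 * G * R) (1 / α) * τ ^ 2 / δ / 2 * (ρ * l + Ω / (8 * G ^ 2 * δ * τ ^ 2)) ≤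
      (24 * G * R + 4 / α) * (ρ / δ) * τ ^ 2 * l +
        (3 * G * R + 1 / (2 * α)) / (G ^ 2 * δ ^ 2) * Ω := by
    calc 8 * max (6 * G * R) (1 / α) * τ ^ 2 / δ / 2 * (ρ * l + Ω / (8 * G ^ 2 * δ * τ ^ 2))
        ≤ 8 * (6 * G * R + 1 / α) * τ ^ 2 / δ / 2 * (ρ * l + Ω / (8 * G ^ 2 * δ * τ ^ 2)) := by
          gcongr
          exact max_le_add_of_nonneg (by positivity) (by positivity)
      _ = _ := by field_simp; ring
  have t4 : √(δ * τ / 4 * (3 * (96 * G ^ 2 * R ^ 2 * L * τ ^ 3)) *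
      (3 / 2 * (ρ * l + Ω / (8 * G ^ 2 * δ * τ ^ 2)))) ≤
      12 * G * R * √(ρ * δ) * τ ^ 2 * ℓ + 5 * R * τ * √Ω * √ℓ := by
    -- Amounts to `√(a² + b²) ≤ a + b`, with slack from rounding: `108 ≤ 12²` and `27/2 ≤ 5²`.
    apply Real.sqrt_le_iff.2 ⟨by positivity, ?_⟩
    have s1 : √(ρ * δ) ^ 2 = ρ * δ := Real.sq_sqrt (by positivity)
    have s2 : √Ω ^ 2 = Ω := Real.sq_sqrt hΩ0
    have s3 : √ℓ ^ 2 = ℓ := Real.sq_sqrt hℓ0.le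
    have hcross : 0 ≤ (12 * G * R * √(ρ * δ) * τ ^ 2 * ℓ) * (5 * R * τ * √Ω * √ℓ) := by positivity
    have hLl : L * l ≤ ℓ * ℓ := mul_le_mul h.L_le h.l_le hl0 hℓ0.le
    calc _ = 108 * (G ^ 2 * R ^ 2 * τ ^ 4 * (ρ * δ)) * (L * l) +
          27 / 2 * (R ^ 2 * τ ^ 2 * Ω) * L := by field_simp; ring
      _ ≤ 144 * (G ^ 2 * R ^ 2 * τ ^ 4 * (ρ * δ)) * (ℓ * ℓ) + 25 * (R ^ 2 * τ ^ 2 * Ω) * ℓ := by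
          have := h.L_le
          gcongr <;> norm_num
      _ = (12 * G * R * √(ρ * δ) * τ ^ 2 * ℓ) ^ 2 + (5 * R * τ * √Ω * √ℓ) ^ 2 := by
          simp only [mul_pow, s1, s2, s3]; ring
      _ ≤ _ := by nlinarith
  linarith

/-- There is no index beyond the dimension, so the dimension-dependent bound is the `ρ = n` case of
the tail bound. -/
theorem tailEigenvalues_dim (grad : ℕ → Vec n → Vec n) (p : Params n) (r : Run n) :
    tailEigenvalues grad p r n = 0 := by
  refine Finset.sum_eq_zero fun i _ => if_neg ?_
  have := i.2
  simp only [Fintype.card_fin] at this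
  omega

end Tuning

/-! ### Reasoning about programs of the real RAM -/

namespace RealRAM

section Basics

variable {n : ℕ} {env : Env n}

@[simp] theorem tick_reg (s : State n) (c : ℕ) : (s.tick c).reg = s.reg := rfl
@[simp] theorem tick_mem (s : State n) (c : ℕ) : (s.tick c).mem = s.mem := rfl
@[simp] theorem tick_plays (s : State n) (c : ℕ) : (s.tick c).plays = s.plays := rfl
@[simp] theorem tick_looCalls (s : State n) (c : ℕ) : (s.tick c).looCalls = s.looCalls := rfl
@[simp] theorem tick_time (s : State n) (c : ℕ) : (s.tick c).time = s.time + c := rfl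
@[simp] theorem tick_space (s : State n) (c : ℕ) : (s.tick c).space = s.space := rfl
@[simp] theorem touch_reg (s : State n) (b : ℕ) : (s.touch b).reg = s.reg := rfl
@[simp] theorem touch_mem (s : State n) (b : ℕ) : (s.touch b).mem = s.mem := rfl
@[simp] theorem touch_space (s : State n) (b : ℕ) : (s.touch b).space = max s.space b := rfl
@[simp] theorem touch_time (s : State n) (b : ℕ) : (s.touch b).time = s.time := rfl
@[simp] theorem setReg_reg (s : State n) (i v : ℕ) :
    (s.setReg i v).reg = Function.update s.reg i v := rfl
@[simp] theorem setMem_reg (s : State n) (a : ℕ) (v : ℝ) : (s.setMem a v).reg = s.reg := rfl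
@[simp] theorem setMem_mem (s : State n) (a : ℕ) (v : ℝ) :
    (s.setMem a v).mem = Function.update s.mem a v := rfl
@[simp] theorem setMem_space (s : State n) (a : ℕ) (v : ℝ) :
    (s.setMem a v).space = max s.space (a + 1) := rfl
@[simp] theorem setMem_time (s : State n) (a : ℕ) (v : ℝ) : (s.setMem a v).time = s.time := rfl
@[simp] theorem setVec_mem (s : State n) (a : ℕ) (v : Vec n) :
    (s.setVec a v).mem = writeVec s.mem a v := rfl

/-- The memory above the first three cells is divided into slots of `n` cells each. The program uses
slots `0, …, 28` for vectors and for scalars (in their first cells), slot `29` as scratch space,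
the `n` slots from `30` on for the rows of the matrix `A`, and the next `n` slots for the rows of
its inverse. The content of the scratch slot is hidden. -/
def view (s : State n) (k : ℕ) : Vec n := if k = 29 then 0 else readVec s.mem (3 + k * n)

/-- An upper bound for the addresses in use. -/
def memBound (n : ℕ) : ℕ := 3 + (30 + 2 * n) * n

/-- Change a single cell. -/
noncomputable def setCell (M : ℕ → Vec n) (k : ℕ) (i : Fin n) (v : ℝ) : ℕ → Vec n :=
  Function.update M k (WithLp.toLp 2 (Function.update (M k).ofLp i v))

/-- `a` is the address of cell `i` of slot `k`. -/
structure At (a k : ℕ) (i : Fin n) : Prop where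
  addr : a = 3 + k * n + i
  ne : k ≠ 29
  lt : k < 30 + 2 * n

theorem cell_lt {k : ℕ} (hk : k < 30 + 2 * n) (i : Fin n) : 3 + k * n + i + 1 ≤ memBound n := by
  have h1 : (k + 1) * n ≤ (30 + 2 * n) * n := Nat.mul_le_mul_right n hk
  have := i.2
  rw [memBound]
  rw [Nat.succ_mul] at h1
  omega

theorem slot_le {k : ℕ} (hk : k < 30 + 2 * n) : 3 + k * n + n ≤ memBound n := by
  have h1 : (k + 1) * n ≤ (30 + 2 * n) * n := Nat.mul_le_mul_right n hk
  rw [memBound]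
  rw [Nat.succ_mul] at h1
  omega

theorem At.le {a k : ℕ} {i : Fin n} (h : At a k i) : a + 1 ≤ memBound n := by
  rw [h.addr]; exact cell_lt h.lt i

theorem mem_eq_view {s : State n} {a k : ℕ} {i : Fin n} (h : At a k i) :
    s.mem a = view s k i := by
  rw [h.addr, view, if_neg h.ne]; rfl

theorem view_congr {s s' : State n} (h : s'.mem = s.mem) : view s' = view s := by
  funext k; simp only [view, h]

@[simp] theorem view_tick (s : State n) (c : ℕ) : view (s.tick c) = view s := view_congr rfl

theorem cell_inj {k k' : ℕ} {i i' : Fin n} (h : 3 + k * n + i = 3 + k' * n + i') :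
    k = k' ∧ i = i' := by
  have hn : 0 < n := i.pos
  have h1 : (i + n * k) / n = (i' + n * k') / n := by
    congr 1; rw [mul_comm n k, mul_comm n k']; omega
  rw [Nat.add_mul_div_left _ _ hn, Nat.add_mul_div_left _ _ hn, Nat.div_eq_of_lt i.2,
    Nat.div_eq_of_lt i'.2, zero_add, zero_add] at h1
  subst h1
  exact ⟨rfl, Fin.ext (by omega)⟩

theorem view_update {s s' : State n} {a k : ℕ} {i : Fin n} {v : ℝ} (ha : At a k i)
    (h : s'.mem = Function.update s.mem a v) : view s' = setCell (view s) k i v := by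
  rw [ha.addr] at h
  funext k'
  by_cases hk : k' = k
  · subst hk
    simp only [setCell, Function.update_self, view, if_neg ha.ne]
    ext i'
    simp only [readVec, h, Function.update_apply]
    by_cases hi : i' = i
    · subst hi; simp
    · have : ¬ 3 + k' * n + (i' : ℕ) = 3 + k' * n + (i : ℕ) := fun e => hi (cell_inj e).2
      rw [if_neg this, if_neg hi]
  · simp only [setCell, Function.update_of_ne hk, view]
    split_ifs with h29
    · rfl
    · ext i'
      have : ¬ 3 + k' * n + (i' : ℕ) = 3 + k * n + (i : ℕ) := fun e => hk (cell_inj e).1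
      simp [readVec, h, Function.update_apply, this]

/-- The scratch slot is hidden in `view` so that intermediate products leave no trace in
specifications. -/
theorem view_update_scratch {s s' : State n} {i : Fin n} {v : ℝ}
    (h : s'.mem = Function.update s.mem (3 + 29 * n + i) v) : view s' = view s := by
  funext k'
  simp only [view]
  split_ifs with h29
  · rfl
  · ext i'
    have : ¬ 3 + k' * n + (i' : ℕ) = 3 + 29 * n + (i : ℕ) := fun e => h29 (cell_inj e).1
    simp only [readVec, h, Function.update_apply, if_neg this]

theorem view_writeVec {s s' : State n} {k : ℕ} {v : Vec n} (hk : k ≠ 29)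
    (h : s'.mem = writeVec s.mem (3 + k * n) v) : view s' = Function.update (view s) k v := by
  funext k'
  by_cases hk' : k' = k
  · subst hk'
    simp only [Function.update_self, view, if_neg hk, h]
    ext i
    simp [readVec, writeVec]
  · simp only [Function.update_of_ne hk', view, h]
    split_ifs with h29
    · rfl
    · ext i
      simp only [readVec, writeVec]
      rw [dif_neg]
      rintro ⟨h1, h2⟩
      have h3 : 3 + k' * n + (i : ℕ) = 3 + k * n + (⟨3 + k' * n + i - (3 + k * n), by omega⟩ : Fin n) := by
        simp only; omega
      exact hk' (cell_inj h3).1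

/-- The computation from `s` to `s'` takes at most `t` steps, does not change the registers below
`lo`, and does not interact with the environment. -/
structure Keeps (lo t : ℕ) (s s' : State n) : Prop where
  plays : s'.plays = s.plays
  looCalls : s'.looCalls = s.looCalls
  reg : ∀ j < lo, s'.reg j = s.reg j
  time : s'.time ≤ s.time + t
  space : s'.space ≤ max s.space (memBound n)

theorem Keeps.refl (lo : ℕ) (s : State n) : Keeps lo 0 s s :=
  ⟨rfl, rfl, fun _ _ => rfl, le_rfl, le_max_left _ _⟩

theorem Keeps.trans {lo t t' : ℕ} {s s₁ s₂ : State n} (h : Keeps lo t s s₁)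
    (h' : Keeps lo t' s₁ s₂) : Keeps lo (t + t') s s₂ :=
  ⟨h'.plays.trans h.plays, h'.looCalls.trans h.looCalls,
    fun j hj => (h'.reg j hj).trans (h.reg j hj), by have := h.time; have := h'.time; omega,
    h'.space.trans (max_le h.space (le_max_right _ _))⟩

theorem Keeps.mono {lo lo' t t' : ℕ} {s s' : State n} (h : Keeps lo t s s') (hlo : lo' ≤ lo)
    (ht : t ≤ t') : Keeps lo' t' s s' :=
  ⟨h.plays, h.looCalls, fun j hj => h.reg j (by omega), h.time.trans (by omega), h.space⟩

theorem Keeps.tick (lo c : ℕ) (s : State n) : Keeps lo c s (s.tick c) :=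
  ⟨rfl, rfl, fun _ _ => rfl, le_rfl, le_max_left _ _⟩

/-- The standing assumptions on the registers. -/
structure Regs (s : State n) : Prop where
  dim : s.reg 0 = n
  one : s.reg 3 = 1
  zero : s.reg 4 = 0
  slot : ∀ k ≤ 30, s.reg (10 + k) = 3 + k * n
  inv : s.reg 41 = 3 + (30 + n) * n

/-- Registers are layered so that nested code does not interfere: vector loops use those from `60`,
matrix loops those from `50`, the projection flag is `45`, and the round counters are `42` and `43`.
Everything below `42` is fixed after initialisation. -/
theorem Keeps.regs {lo t : ℕ} {s s' : State n} (h : Keeps lo t s s') (hlo : 42 ≤ lo)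
    (hr : Regs s) : Regs s' :=
  ⟨(h.reg 0 (by omega)).trans hr.dim, (h.reg 3 (by omega)).trans hr.one,
    (h.reg 4 (by omega)).trans hr.zero,
    fun k hk => (h.reg (10 + k) (by omega)).trans (hr.slot k hk),
    (h.reg 41 (by omega)).trans hr.inv⟩

theorem Regs.at_zero {s : State n} (h : Regs s) (hn : 0 < n) {k : ℕ} (hk : k < 29) :
    At (s.reg (10 + k)) k (⟨0, hn⟩ : Fin n) :=
  ⟨h.slot k (by omega), by omega, by omega⟩

theorem natAdd_spec {lo i : ℕ} (j k : ℕ) (hi : lo ≤ i) (s : State n) :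
    ∃ s', Exec env (.natAdd i j k) s s' ∧ Keeps lo 1 s s' ∧
      s'.reg = Function.update s.reg i (s.reg j + s.reg k) ∧ view s' = view s :=
  ⟨_, .natAdd i j k s, ⟨rfl, rfl, fun l hl => Function.update_of_ne (by omega) _ _, le_rfl,
    le_max_left _ _⟩, rfl, view_congr rfl⟩

theorem natConst_spec {lo i : ℕ} (c : ℕ) (hi : lo ≤ i) (s : State n) :
    ∃ s', Exec env (.natConst i c) s s' ∧ Keeps lo 1 s s' ∧
      s'.reg = Function.update s.reg i c ∧ view s' = view s :=
  ⟨_, .natConst i c s, ⟨rfl, rfl, fun l hl => Function.update_of_ne (by omega) _ _, le_rfl,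
    le_max_left _ _⟩, rfl, view_congr rfl⟩

theorem realConst_spec {d k : ℕ} {i : Fin n} (lo : ℕ) (q : ℚ) {s : State n}
    (hd : At (s.reg d) k i) :
    ∃ s', Exec env (.realConst d q) s s' ∧ Keeps lo 1 s s' ∧ s'.reg = s.reg ∧
      view s' = setCell (view s) k i q :=
  ⟨_, .realConst d q s, ⟨rfl, rfl, fun _ _ => rfl, le_rfl,
    max_le_max le_rfl hd.le⟩, rfl, view_update hd rfl⟩

theorem realCopy_spec {d a k k' : ℕ} {i i' : Fin n} (lo : ℕ) {s : State n}
    (hd : At (s.reg d) k i) (ha : At (s.reg a) k' i') :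
    ∃ s', Exec env (.realCopy d a) s s' ∧ Keeps lo 1 s s' ∧ s'.reg = s.reg ∧
      view s' = setCell (view s) k i (view s k' i') :=
  ⟨_, .realCopy d a s, ⟨rfl, rfl, fun _ _ => rfl, le_rfl,
    max_le (max_le_max le_rfl hd.le) (le_max_of_le_right ha.le)⟩, rfl,
    view_update hd (by simp [mem_eq_view ha])⟩

theorem realOp_spec {op : ArithOp} {d a b kd ka kb : ℕ} {id ia ib : Fin n} (lo : ℕ) {s : State n}
    (hd : At (s.reg d) kd id) (ha : At (s.reg a) ka ia) (hb : At (s.reg b) kb ib)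
    (hdiv : op = .div → view s kb ib ≠ 0) :
    ∃ s', Exec env (.realOp op d a b) s s' ∧ Keeps lo 1 s s' ∧ s'.reg = s.reg ∧
      view s' = setCell (view s) kd id (op.eval (view s ka ia) (view s kb ib)) :=
  ⟨_, .realOp op d a b s (by rwa [mem_eq_view hb]), ⟨rfl, rfl, fun _ _ => rfl, le_rfl,
    max_le (max_le (max_le_max le_rfl hd.le) (le_max_of_le_right ha.le))
      (le_max_of_le_right hb.le)⟩, rfl,
    view_update hd (by simp [mem_eq_view ha, mem_eq_view hb])⟩

/-- `mem (reg d) := mem (reg a) + mem (reg b) * mem (reg c)` -/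
def fma (d a b c : ℕ) : Cmd := .seq (.realOp .mul 39 b c) (.realOp .add d a 39)

theorem fma_spec {d a b c kd ka kb kc : ℕ} {id ia ib ic : Fin n} (lo : ℕ) {s : State n}
    (hs : s.reg 39 = 3 + 29 * n) (hd : At (s.reg d) kd id) (ha : At (s.reg a) ka ia)
    (hb : At (s.reg b) kb ib) (hc : At (s.reg c) kc ic) :
    ∃ s', Exec env (fma d a b c) s s' ∧ Keeps lo 2 s s' ∧ s'.reg = s.reg ∧
      view s' = setCell (view s) kd id (view s ka ia + view s kb ib * view s kc ic) := by
  have hn : 0 < n := id.pos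
  have hs' : s.reg 39 = 3 + 29 * n + (⟨0, hn⟩ : Fin n) := hs
  have hle : s.reg 39 + 1 ≤ memBound n := by rw [hs']; exact cell_lt (by omega) _
  -- The addend is read after the product has overwritten the scratch cell, so it must not be stored
  -- there.
  have hne : s.reg a ≠ s.reg 39 := by
    rw [hs', ha.addr]; exact fun e => ha.ne (cell_inj e).1
  refine ⟨_, .seq (.realOp .mul 39 b c s (by simp)) (.realOp .add d a 39 _ (by simp)), ?_, rfl, ?_⟩
  · refine ⟨rfl, rfl, fun _ _ => rfl, by simp, ?_⟩
    simp only [tick_space, touch_space, setMem_space, tick_reg, touch_reg, setMem_reg]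
    have := hd.le; have := ha.le; have := hb.le; have := hc.le
    omega
  · set s₁ := ((((s.setMem (s.reg 39) (ArithOp.mul.eval (s.mem (s.reg b)) (s.mem (s.reg c)))).touch
      (s.reg b + 1)).touch (s.reg c + 1)).tick 1) with hs₁
    have h1 : view s₁ = view s := view_update_scratch (i := ⟨0, hn⟩) (s' := s₁)
      (by rw [hs₁]; simp only [tick_mem, touch_mem, setMem_mem]; rw [← hs'])
    have hv : ∀ x, Function.update s₁.mem (s.reg d) (s.mem (s.reg a) + s.mem (s.reg b) * s.mem (s.reg c))
        = x → x = Function.update s₁.mem (s.reg d)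
          (view s ka ia + view s kb ib * view s kc ic) := by
      rintro x rfl; rw [mem_eq_view ha, mem_eq_view hb, mem_eq_view hc]
    rw [← h1] at hv ⊢
    refine view_update (s := s₁) hd (hv _ ?_)
    simp only [tick_mem, touch_mem, setMem_mem, hs₁, tick_reg, touch_reg, setMem_reg,
      Function.update_self, Function.update_of_ne hne, ArithOp.eval]

/-- Total correctness of a loop with a known number of iterations. -/
theorem while_spec {i j : ℕ} {P : Cmd} (Inv : ℕ → State n → Prop) (N : ℕ)
    (hstep : ∀ k < N, ∀ s, Inv k s →
      s.reg i < s.reg j ∧ ∃ s', Exec env P (s.tick 1) s' ∧ Inv (k + 1) s')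
    (hend : ∀ s, Inv N s → ¬ s.reg i < s.reg j) {s : State n} (h0 : Inv 0 s) :
    ∃ s', Exec env (.whileNatLt i j P) s (s'.tick 1) ∧ Inv N s' := by
  suffices H : ∀ m, m ≤ N → ∀ s, Inv (N - m) s →
      ∃ s', Exec env (.whileNatLt i j P) s (s'.tick 1) ∧ Inv N s' from
    H N le_rfl s (by simpa using h0)
  intro m
  induction m with
  | zero => intro _ s hs; exact ⟨s, .while_false (hend s hs), hs⟩
  | succ m ih =>
    intro hm s hs
    obtain ⟨h1, s₁, e1, i1⟩ := hstep (N - (m + 1)) (by omega) s hs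
    obtain ⟨s', e2, i2⟩ := ih (by omega) s₁ (by
      rw [show N - m = N - (m + 1) + 1 by omega]; exact i1)
    exact ⟨s', .while_true h1 e1 e2, i2⟩

/-! ### Vector operations -/

/-- `a` is the address of slot `k`. -/
structure AtSlot (n a k : ℕ) : Prop where
  addr : a = 3 + k * n
  ne : k ≠ 29
  lt : k < 30 + 2 * n

theorem AtSlot.cell {a k : ℕ} (h : AtSlot n a k) (i : Fin n) : At (a + i) k i :=
  ⟨by rw [h.addr], h.ne, h.lt⟩

theorem Regs.atSlot {s : State n} (h : Regs s) {k : ℕ} (hk : k < 29) :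
    AtSlot n (s.reg (10 + k)) k :=
  ⟨h.slot k (by omega), by omega, by omega⟩

/-- For `i < n`: `mem (reg rd + i) := mem (reg ra + i) + mem (reg rs) * mem (reg rb + i)`. -/
def axpy (rd ra rb rs : ℕ) : Cmd :=
  .seq (.natConst 60 0) (.whileNatLt 60 0
    (.seq (.natAdd 61 ra 60) (.seq (.natAdd 62 rb 60) (.seq (.natAdd 63 rd 60)
      (.seq (fma 63 61 rs 62) (.natAdd 60 60 3))))))

/-- `mem (reg rd) := ∑ i, mem (reg ra + i) * mem (reg rb + i)` -/
def dot (rd ra rb : ℕ) : Cmd :=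
  .seq (.realConst rd 0) (.seq (.natConst 60 0) (.whileNatLt 60 0
    (.seq (.natAdd 61 ra 60) (.seq (.natAdd 62 rb 60)
      (.seq (fma rd rd 61 62) (.natAdd 60 60 3))))))

/-- The target may coincide with either operand. Only the scalar must lie elsewhere, since it is
reread in every iteration. -/
theorem axpy_spec {rd ra rb rs kd ka kb ks : ℕ} {js : Fin n} {s : State n} (hr : Regs s)
    (hrd : rd < 60) (hra : ra < 60) (hrb : rb < 60) (hrs : rs < 60)
    (hd : AtSlot n (s.reg rd) kd) (ha : AtSlot n (s.reg ra) ka) (hb : AtSlot n (s.reg rb) kb)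
    (hs : At (s.reg rs) ks js) (hsd : ks ≠ kd) :
    ∃ s', Exec env (axpy rd ra rb rs) s s' ∧ Keeps 60 (10 * n + 2) s s' ∧
      view s' = Function.update (view s) kd (view s ka + view s ks js • view s kb) := by
  obtain ⟨s₀, e0, k0, r0, v0⟩ := natConst_spec (env := env) (lo := 60) (i := 60) 0 le_rfl s
  let Inv : ℕ → State n → Prop := fun k s' =>
    Keeps 60 (k * 10) s₀ s' ∧ s'.reg 60 = k ∧ view s' = Function.update (view s) kd
      (WithLp.toLp 2 fun i => if (i : ℕ) < k then view s ka i + view s ks js * view s kb i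
        else view s kd i)
  have hstep : ∀ k < n, ∀ s₁, Inv k s₁ → s₁.reg 60 < s₁.reg 0 ∧ ∃ s', Exec env
      (.seq (.natAdd 61 ra 60) (.seq (.natAdd 62 rb 60) (.seq (.natAdd 63 rd 60)
      (.seq (fma 63 61 rs 62) (.natAdd 60 60 3))))) (s₁.tick 1) s' ∧ Inv (k + 1) s' := by
    rintro k hk s₁ ⟨hk1, hreg, hv⟩
    have hks : Keeps 60 (1 + k * 10) s s₁ := k0.trans hk1
    have hdim : s₁.reg 0 = n := (hks.regs (by norm_num) hr).dim
    refine ⟨by rw [hreg, hdim]; exact hk, ?_⟩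
    have hks' : Keeps 60 (k * 10 + 1) s₀ (s₁.tick 1) := hk1.trans (.tick _ _ _)
    set s₂ := s₁.tick 1 with hs₂
    have hr2 : ∀ j < 60, s₂.reg j = s.reg j := hks.reg
    obtain ⟨s₃, e3, k3, r3, v3⟩ := natAdd_spec (env := env) (lo := 60) (i := 61) ra 60
      (by norm_num) s₂
    obtain ⟨s₄, e4, k4, r4, v4⟩ := natAdd_spec (env := env) (lo := 60) (i := 62) rb 60
      (by norm_num) s₃
    obtain ⟨s₅, e5, k5, r5, v5⟩ := natAdd_spec (env := env) (lo := 60) (i := 63) rd 60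
      (by norm_num) s₄
    have h60 : s₂.reg 60 = (⟨k, hk⟩ : Fin n) := hreg
    have r61 : s₅.reg 61 = s.reg ra + (⟨k, hk⟩ : Fin n) := by
      rw [r5, r4, r3]; simp [h60, hr2 ra hra]
    have r62 : s₅.reg 62 = s.reg rb + (⟨k, hk⟩ : Fin n) := by
      rw [r5, r4, r3]; simp [h60, hr2 rb hrb, show rb ≠ 61 by omega]
    have r63 : s₅.reg 63 = s.reg rd + (⟨k, hk⟩ : Fin n) := by
      rw [r5, r4, r3]; simp [h60, hr2 rd hrd, show rd ≠ 61 by omega, show rd ≠ 62 by omega]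
    have k5' := k3.trans (k4.trans k5)
    have hr5 : ∀ j < 60, s₅.reg j = s.reg j := fun j hj => (k5'.reg j hj).trans (hr2 j hj)
    have hv5 : view s₅ = view s₁ := by rw [v5, v4, v3]; exact view_congr rfl
    obtain ⟨s₆, e6, k6, r6, v6⟩ := fma_spec (env := env) 60 (s := s₅)
      (by rw [hr5 39 (by norm_num)]; exact hr.slot 29 (by norm_num))
      (r63 ▸ hd.cell ⟨k, hk⟩) (r61 ▸ ha.cell ⟨k, hk⟩) (by rw [hr5 rs hrs]; exact hs)
      (r62 ▸ hb.cell ⟨k, hk⟩)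
    obtain ⟨s₇, e7, k7, r7, v7⟩ := natAdd_spec (env := env) (lo := 60) (i := 60) 60 3
      le_rfl s₆
    refine ⟨s₇, .seq e3 (.seq e4 (.seq e5 (.seq e6 e7))), ?_, ?_, ?_⟩
    · exact (hks'.trans (k5'.trans (k6.trans k7))).mono le_rfl (by omega)
    · rw [r7, r6]
      simp only [Function.update_self]
      rw [hr5 3 (by norm_num), hr.one, r5, r4, r3]
      simp [h60]
    · rw [v7, v6, hv5, hv]
      -- Cell `k` has not been overwritten yet, so even an aliased operand still shows its original
      -- entry.
      have hka : Function.update (view s) kd (WithLp.toLp 2 fun i => if (i : ℕ) < k then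
          view s ka i + view s ks js * view s kb i else view s kd i) ka ⟨k, hk⟩
          = view s ka ⟨k, hk⟩ := by
        by_cases h : ka = kd
        · subst h; simp
        · rw [Function.update_of_ne h]
      have hkb : Function.update (view s) kd (WithLp.toLp 2 fun i => if (i : ℕ) < k then
          view s ka i + view s ks js * view s kb i else view s kd i) kb ⟨k, hk⟩
          = view s kb ⟨k, hk⟩ := by
        by_cases h : kb = kd
        · subst h; simp
        · rw [Function.update_of_ne h]
      rw [hka, hkb, Function.update_of_ne hsd, setCell, Function.update_self,
        Function.update_idem]
      congr 1
      ext i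
      simp only [Function.update_apply]
      by_cases hi : i = ⟨k, hk⟩
      · subst hi; simp
      · have : (i : ℕ) ≠ k := fun e => hi (Fin.ext e)
        rw [if_neg hi]
        have h2 : (i : ℕ) < k + 1 ↔ (i : ℕ) < k := by omega
        simp [h2]
  obtain ⟨s', e', k', r', v'⟩ := while_spec (env := env) Inv n hstep
    (fun s₁ ⟨hk1, hreg, _⟩ => by
      rw [hreg, ((k0.trans hk1).regs (by norm_num) hr).dim]; exact lt_irrefl _)
    (s := s₀) ⟨by simpa using Keeps.refl 60 s₀, by rw [r0]; simp, by
      rw [v0]; simp [Function.update_eq_self]⟩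
  refine ⟨s'.tick 1, .seq e0 e', ?_, ?_⟩
  · exact (k0.trans (k'.trans (.tick _ 1 _))).mono le_rfl (by omega)
  · rw [view_tick, v']
    congr 1
    ext i
    simp

theorem dot_spec {rd ra rb kd ka kb : ℕ} {jd : Fin n} {s : State n} (hr : Regs s)
    (hrd : rd < 60) (hra : ra < 60) (hrb : rb < 60)
    (hd : At (s.reg rd) kd jd) (ha : AtSlot n (s.reg ra) ka) (hb : AtSlot n (s.reg rb) kb)
    (had : ka ≠ kd) (hbd : kb ≠ kd) :
    ∃ s', Exec env (dot rd ra rb) s s' ∧ Keeps 60 (10 * n + 3) s s' ∧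
      view s' = setCell (view s) kd jd ⟪view s ka, view s kb⟫_ℝ := by
  obtain ⟨s₀', e0', k0', r0', v0'⟩ := realConst_spec (env := env) 60 0 hd
  obtain ⟨s₀, e0, k0, r0, v0⟩ := natConst_spec (env := env) (lo := 60) (i := 60) 0 le_rfl s₀'
  let Inv : ℕ → State n → Prop := fun k s' =>
    Keeps 60 (k * 10) s₀ s' ∧ s'.reg 60 = k ∧ view s' = setCell (view s) kd jd
      (∑ i : Fin n, if (i : ℕ) < k then view s ka i * view s kb i else 0)
  have hstep : ∀ k < n, ∀ s₁, Inv k s₁ → s₁.reg 60 < s₁.reg 0 ∧ ∃ s', Exec env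
      (.seq (.natAdd 61 ra 60) (.seq (.natAdd 62 rb 60)
      (.seq (fma rd rd 61 62) (.natAdd 60 60 3)))) (s₁.tick 1) s' ∧ Inv (k + 1) s' := by
    rintro k hk s₁ ⟨hk1, hreg, hv⟩
    have hks : Keeps 60 (1 + (1 + k * 10)) s s₁ := k0'.trans (k0.trans hk1)
    have hdim : s₁.reg 0 = n := (hks.regs (by norm_num) hr).dim
    refine ⟨by rw [hreg, hdim]; exact hk, ?_⟩
    have hks' : Keeps 60 (k * 10 + 1) s₀ (s₁.tick 1) := hk1.trans (.tick _ _ _)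
    set s₂ := s₁.tick 1 with hs₂
    have hr2 : ∀ j < 60, s₂.reg j = s.reg j := hks.reg
    obtain ⟨s₃, e3, k3, r3, v3⟩ := natAdd_spec (env := env) (lo := 60) (i := 61) ra 60
      (by norm_num) s₂
    obtain ⟨s₄, e4, k4, r4, v4⟩ := natAdd_spec (env := env) (lo := 60) (i := 62) rb 60
      (by norm_num) s₃
    have h60 : s₂.reg 60 = (⟨k, hk⟩ : Fin n) := hreg
    have r61 : s₄.reg 61 = s.reg ra + (⟨k, hk⟩ : Fin n) := by
      rw [r4, r3]; simp [h60, hr2 ra hra]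
    have r62 : s₄.reg 62 = s.reg rb + (⟨k, hk⟩ : Fin n) := by
      rw [r4, r3]; simp [h60, hr2 rb hrb, show rb ≠ 61 by omega]
    have k5' := k3.trans k4
    have hr5 : ∀ j < 60, s₄.reg j = s.reg j := fun j hj => (k5'.reg j hj).trans (hr2 j hj)
    have hv5 : view s₄ = view s₁ := by rw [v4, v3]; exact view_congr rfl
    obtain ⟨s₆, e6, k6, r6, v6⟩ := fma_spec (env := env) 60 (s := s₄)
      (by rw [hr5 39 (by norm_num)]; exact hr.slot 29 (by norm_num))
      (by rw [hr5 rd hrd]; exact hd) (by rw [hr5 rd hrd]; exact hd) (r61 ▸ ha.cell ⟨k, hk⟩)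
      (r62 ▸ hb.cell ⟨k, hk⟩)
    obtain ⟨s₇, e7, k7, r7, v7⟩ := natAdd_spec (env := env) (lo := 60) (i := 60) 60 3
      le_rfl s₆
    refine ⟨s₇, .seq e3 (.seq e4 (.seq e6 e7)), ?_, ?_, ?_⟩
    · exact (hks'.trans (k5'.trans (k6.trans k7))).mono le_rfl (by omega)
    · rw [r7, r6]
      simp only [Function.update_self]
      rw [hr5 3 (by norm_num), hr.one, r4, r3]
      simp [h60]
    · rw [v7, v6, hv5, hv]
      have hka : setCell (view s) kd jd (∑ i : Fin n, if (i : ℕ) < k then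
          view s ka i * view s kb i else 0) ka = view s ka := Function.update_of_ne had _ _
      have hkb : setCell (view s) kd jd (∑ i : Fin n, if (i : ℕ) < k then
          view s ka i * view s kb i else 0) kb = view s kb := Function.update_of_ne hbd _ _
      have hsum : (∑ i : Fin n, if (i : ℕ) < k + 1 then view s ka i * view s kb i else 0) =
          (∑ i : Fin n, if (i : ℕ) < k then view s ka i * view s kb i else 0) +
            view s ka ⟨k, hk⟩ * view s kb ⟨k, hk⟩ := by
        have e1 : ∀ i : Fin n, (if (i : ℕ) < k + 1 then view s ka i * view s kb i else 0) =
            (if (i : ℕ) < k then view s ka i * view s kb i else 0) +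
            if i = ⟨k, hk⟩ then view s ka i * view s kb i else 0 := by
          intro i
          by_cases hi : i = ⟨k, hk⟩
          · subst hi; simp
          · have : (i : ℕ) ≠ k := fun e => hi (Fin.ext e)
            have h2 : (i : ℕ) < k + 1 ↔ (i : ℕ) < k := by omega
            simp [hi, h2]
        rw [Finset.sum_congr rfl fun i _ => e1 i, Finset.sum_add_distrib]
        simp
      rw [hka, hkb, hsum]
      simp [setCell]
  obtain ⟨s', e', k', r', v'⟩ := while_spec (env := env) Inv n hstep
    (fun s₁ ⟨hk1, hreg, _⟩ => by
      rw [hreg, ((k0'.trans (k0.trans hk1)).regs (by norm_num) hr).dim]; exact lt_irrefl _)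
    (s := s₀) ⟨by simpa using Keeps.refl 60 s₀, by rw [r0]; simp, by
      rw [v0, v0']; simp⟩
  refine ⟨s'.tick 1, .seq e0' (.seq e0 e'), ?_, ?_⟩
  · exact (k0'.trans (k0.trans (k'.trans (.tick _ 1 _)))).mono le_rfl (by omega)
  · rw [view_tick, v', inner_eq_dotProduct]
    simp [dotProduct]

end Basics

end RealRAM

/-! ### Matrix operations on the real RAM. -/

namespace RealRAM

section Matrices

variable {n : ℕ} {env : Env n}

/-- The matrix stored in the slots from `b` on, row by row. -/
def matOf (M : ℕ → Vec n) (b : ℕ) : Mat n := Matrix.of fun i j => M (b + i) j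

theorem matOf_congr {M M' : ℕ → Vec n} {b : ℕ} (h : ∀ i : Fin n, M' (b + i) = M (b + i)) :
    matOf M' b = matOf M b := by
  ext i j; simp [matOf, h i]

theorem matOf_app (M : ℕ → Vec n) (b : ℕ) (x : Vec n) :
    (matOf M b).app x = WithLp.toLp 2 fun i : Fin n => ⟪M (b + i), x⟫_ℝ := by
  ext i
  simp [Mat.app, matOf, Matrix.mulVec, inner_eq_dotProduct]

/-- Multiply the matrix at `rM` by the vector at `rb`, and store the result at `rd`. -/
def matvec (rd rM rb : ℕ) : Cmd :=
  .seq (.natConst 50 0) (.seq (.natAdd 51 rM 4) (.seq (.natAdd 52 rd 4) (.whileNatLt 50 0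
    (.seq (dot 52 51 rb) (.seq (.natAdd 51 51 0) (.seq (.natAdd 52 52 3) (.natAdd 50 50 3)))))))

theorem matvec_spec {rd rM rb kd kM kb : ℕ} {s : State n} (hr : Regs s)
    (hrd : rd < 50) (hrM : rM < 50) (hrb : rb < 50)
    (hd : AtSlot n (s.reg rd) kd) (hM : s.reg rM = 3 + kM * n) (hb : AtSlot n (s.reg rb) kb)
    (hM30 : 30 ≤ kM) (hMn : kM + n ≤ 30 + 2 * n) (hd30 : kd < 30) (hbd : kb ≠ kd) :
    ∃ s', Exec env (matvec rd rM rb) s s' ∧ Keeps 50 (20 * n ^ 2 + 4) s s' ∧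
      view s' = Function.update (view s) kd ((matOf (view s) kM).app (view s kb)) := by
  obtain ⟨s₀, e0, k0, r0, v0⟩ := natConst_spec (env := env) (lo := 50) (i := 50) 0 le_rfl s
  -- Register `4` holds zero, so adding it copies a register.
  obtain ⟨s₁, e1, k1, r1, v1⟩ := natAdd_spec (env := env) (lo := 50) (i := 51) rM 4 (by norm_num) s₀
  obtain ⟨s₂, e2, k2, r2, v2⟩ := natAdd_spec (env := env) (lo := 50) (i := 52) rd 4 (by norm_num) s₁
  have k02 := k0.trans (k1.trans k2)
  let Inv : ℕ → State n → Prop := fun k s' =>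
    Keeps 50 (k * (10 * n + 7)) s₂ s' ∧ s'.reg 50 = k ∧ s'.reg 51 = 3 + (kM + k) * n ∧
      s'.reg 52 = s.reg rd + k ∧ view s' = Function.update (view s) kd
      (WithLp.toLp 2 fun i => if (i : ℕ) < k then ⟪view s (kM + i), view s kb⟫_ℝ
        else view s kd i)
  have hstep : ∀ k < n, ∀ s₁, Inv k s₁ → s₁.reg 50 < s₁.reg 0 ∧ ∃ s', Exec env
      (.seq (dot 52 51 rb) (.seq (.natAdd 51 51 0) (.seq (.natAdd 52 52 3) (.natAdd 50 50 3))))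
      (s₁.tick 1) s' ∧ Inv (k + 1) s' := by
    rintro k hk t₁ ⟨hk1, h50, h51, h52, hv⟩
    have hks := k02.trans hk1
    have hregs : Regs t₁ := hks.regs (by norm_num) hr
    refine ⟨by rw [h50, hregs.dim]; exact hk, ?_⟩
    have hks' : Keeps 50 (k * (10 * n + 7) + 1) s₂ (t₁.tick 1) := hk1.trans (.tick _ _ _)
    have hregs' : Regs (t₁.tick 1) := ⟨hregs.1, hregs.2, hregs.3, hregs.4, hregs.5⟩
    obtain ⟨t₂, f2, l2, w2⟩ := dot_spec (env := env) (rd := 52) (ra := 51) (rb := rb)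
      (kd := kd) (ka := kM + k) (kb := kb) (jd := ⟨k, hk⟩) hregs' (by norm_num) (by norm_num)
      (by omega) (by simp only [tick_reg, h52]; exact hd.cell ⟨k, hk⟩)
      ⟨by simp only [tick_reg, h51], by omega, by omega⟩
      (by simp only [tick_reg, hks.reg rb hrb]; exact hb) (by omega) hbd
    obtain ⟨t₃, f3, l3, q3, w3⟩ := natAdd_spec (env := env) (lo := 50) (i := 51) 51 0
      (by norm_num) t₂
    obtain ⟨t₄, f4, l4, q4, w4⟩ := natAdd_spec (env := env) (lo := 50) (i := 52) 52 3
      (by norm_num) t₃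
    obtain ⟨t₅, f5, l5, q5, w5⟩ := natAdd_spec (env := env) (lo := 50) (i := 50) 50 3
      (by norm_num) t₄
    have hr0 : t₂.reg 0 = n := (l2.reg 0 (by norm_num)).trans hregs.dim
    have hr3 : t₂.reg 3 = 1 := (l2.reg 3 (by norm_num)).trans hregs.one
    have hr50 : t₂.reg 50 = k := (l2.reg 50 (by norm_num)).trans h50
    have hr51 : t₂.reg 51 = 3 + (kM + k) * n := (l2.reg 51 (by norm_num)).trans h51
    have hr52 : t₂.reg 52 = s.reg rd + k := (l2.reg 52 (by norm_num)).trans h52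
    refine ⟨t₅, .seq f2 (.seq f3 (.seq f4 f5)), ?_, ?_, ?_, ?_, ?_⟩
    · refine (hks'.trans ((l2.mono (by norm_num) le_rfl).trans (l3.trans (l4.trans l5)))).mono
        le_rfl ?_
      rw [Nat.succ_mul k]; omega
    · rw [q5, q4, q3]; simp [hr50, hr3]
    · rw [q5, q4, q3]; simp [hr51, hr0]; ring
    · rw [q5, q4, q3]; simp [hr52, hr3]; ring
    · rw [w5, w4, w3, w2, view_tick, hv, Function.update_of_ne hbd,
        Function.update_of_ne (by omega), setCell, Function.update_self, Function.update_idem]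
      congr 1
      ext i
      simp only [Function.update_apply]
      by_cases hi : i = ⟨k, hk⟩
      · subst hi; simp
      · have : (i : ℕ) ≠ k := fun e => hi (Fin.ext e)
        rw [if_neg hi]
        have h2 : (i : ℕ) < k + 1 ↔ (i : ℕ) < k := by omega
        simp [h2]
  have hz : s.reg 4 = 0 := hr.zero
  obtain ⟨s', e', k', -, -, -, v'⟩ := while_spec (env := env) Inv n hstep
    (fun t ⟨hk1, h50, _⟩ => by
      rw [h50, ((k02.trans hk1).regs (by norm_num) hr).dim]; exact lt_irrefl _)
    (s := s₂) ⟨by simpa using Keeps.refl 50 s₂, by rw [r2, r1, r0]; simp,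
      by rw [r2, r1, r0]; simp [show rM ≠ 50 by omega, hz, hM],
      by rw [r2, r1, r0]; simp [show rd ≠ 50 by omega, show rd ≠ 51 by omega, hz],
      by rw [v2, v1, v0]; simp [Function.update_eq_self]⟩
  refine ⟨s'.tick 1, .seq e0 (.seq e1 (.seq e2 e')), ?_, ?_⟩
  · refine (k02.trans (k'.trans (.tick _ 1 _))).mono le_rfl ?_
    have : n ≤ n ^ 2 := Nat.le_self_pow (by norm_num) n
    nlinarith
  · rw [view_tick, v', matOf_app]
    congr 1
    ext i
    simp

/-- Add the outer product of the vectors at `ru` and `rv` to the matrix at `rM`. -/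
def rankOne (rM ru rv : ℕ) : Cmd :=
  .seq (.natConst 50 0) (.seq (.natAdd 51 rM 4) (.seq (.natAdd 52 ru 4) (.whileNatLt 50 0
    (.seq (axpy 51 51 rv 52)
      (.seq (.natAdd 51 51 0) (.seq (.natAdd 52 52 3) (.natAdd 50 50 3)))))))

theorem rankOne_spec {rM ru rv kM ku kv : ℕ} {s : State n} (hr : Regs s)
    (hrM : rM < 50) (hru : ru < 50) (hrv : rv < 50)
    (hu : AtSlot n (s.reg ru) ku) (hM : s.reg rM = 3 + kM * n) (hv : AtSlot n (s.reg rv) kv)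
    (hM30 : 30 ≤ kM) (hMn : kM + n ≤ 30 + 2 * n) (hu30 : ku < 30) (hv30 : kv < 30) :
    ∃ s', Exec env (rankOne rM ru rv) s s' ∧ Keeps 50 (20 * n ^ 2 + 4) s s' ∧
      matOf (view s') kM =
        matOf (view s) kM + Matrix.vecMulVec (view s ku).ofLp (view s kv).ofLp ∧
      ∀ j, (∀ i : Fin n, j ≠ kM + i) → view s' j = view s j := by
  obtain ⟨s₀, e0, k0, r0, v0⟩ := natConst_spec (env := env) (lo := 50) (i := 50) 0 le_rfl s
  obtain ⟨s₁, e1, k1, r1, v1⟩ := natAdd_spec (env := env) (lo := 50) (i := 51) rM 4 (by norm_num) s₀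
  obtain ⟨s₂, e2, k2, r2, v2⟩ := natAdd_spec (env := env) (lo := 50) (i := 52) ru 4 (by norm_num) s₁
  have k02 := k0.trans (k1.trans k2)
  let Inv : ℕ → State n → Prop := fun k s' =>
    Keeps 50 (k * (10 * n + 7)) s₂ s' ∧ s'.reg 50 = k ∧ s'.reg 51 = 3 + (kM + k) * n ∧
      s'.reg 52 = s.reg ru + k ∧
      (∀ i : Fin n, view s' (kM + i) = if (i : ℕ) < k then
        view s (kM + i) + view s ku i • view s kv else view s (kM + i)) ∧
      ∀ j, (∀ i : Fin n, j ≠ kM + i) → view s' j = view s j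
  have hstep : ∀ k < n, ∀ s₁, Inv k s₁ → s₁.reg 50 < s₁.reg 0 ∧ ∃ s', Exec env
      (.seq (axpy 51 51 rv 52)
        (.seq (.natAdd 51 51 0) (.seq (.natAdd 52 52 3) (.natAdd 50 50 3))))
      (s₁.tick 1) s' ∧ Inv (k + 1) s' := by
    rintro k hk t₁ ⟨hk1, h50, h51, h52, hw, hfr⟩
    have hks := k02.trans hk1
    have hregs : Regs t₁ := hks.regs (by norm_num) hr
    refine ⟨by rw [h50, hregs.dim]; exact hk, ?_⟩
    have hks' : Keeps 50 (k * (10 * n + 7) + 1) s₂ (t₁.tick 1) := hk1.trans (.tick _ _ _)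
    have hregs' : Regs (t₁.tick 1) := ⟨hregs.1, hregs.2, hregs.3, hregs.4, hregs.5⟩
    have hslot : AtSlot n ((t₁.tick 1).reg 51) (kM + k) :=
      ⟨by simp only [tick_reg, h51], by omega, by omega⟩
    obtain ⟨t₂, f2, l2, w2⟩ := axpy_spec (env := env) (rd := 51) (ra := 51) (rb := rv) (rs := 52)
      (kd := kM + k) (ka := kM + k) (kb := kv) (ks := ku) (js := ⟨k, hk⟩) hregs' (by norm_num)
      (by norm_num) (by omega) (by norm_num) hslot hslot
      (by simp only [tick_reg, hks.reg rv hrv]; exact hv)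
      (by simp only [tick_reg, h52]; exact hu.cell ⟨k, hk⟩) (by omega)
    obtain ⟨t₃, f3, l3, q3, w3⟩ := natAdd_spec (env := env) (lo := 50) (i := 51) 51 0
      (by norm_num) t₂
    obtain ⟨t₄, f4, l4, q4, w4⟩ := natAdd_spec (env := env) (lo := 50) (i := 52) 52 3
      (by norm_num) t₃
    obtain ⟨t₅, f5, l5, q5, w5⟩ := natAdd_spec (env := env) (lo := 50) (i := 50) 50 3
      (by norm_num) t₄
    have hr0 : t₂.reg 0 = n := (l2.reg 0 (by norm_num)).trans hregs.dim
    have hr3 : t₂.reg 3 = 1 := (l2.reg 3 (by norm_num)).trans hregs.one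
    have hr50 : t₂.reg 50 = k := (l2.reg 50 (by norm_num)).trans h50
    have hr51 : t₂.reg 51 = 3 + (kM + k) * n := (l2.reg 51 (by norm_num)).trans h51
    have hr52 : t₂.reg 52 = s.reg ru + k := (l2.reg 52 (by norm_num)).trans h52
    have hku : view t₁ ku = view s ku := hfr ku fun i => by omega
    have hkv : view t₁ kv = view s kv := hfr kv fun i => by omega
    refine ⟨t₅, .seq f2 (.seq f3 (.seq f4 f5)), ?_, ?_, ?_, ?_, ?_, ?_⟩
    · refine (hks'.trans ((l2.mono (by norm_num) le_rfl).trans (l3.trans (l4.trans l5)))).mono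
        le_rfl ?_
      rw [Nat.succ_mul k]; omega
    · rw [q5, q4, q3]; simp [hr50, hr3]
    · rw [q5, q4, q3]; simp [hr51, hr0]; ring
    · rw [q5, q4, q3]; simp [hr52, hr3]; ring
    · intro i
      rw [w5, w4, w3, w2, view_tick]
      by_cases hi : (i : ℕ) = k
      · have hi' : i = ⟨k, hk⟩ := Fin.ext hi
        have hwk := hw i
        rw [if_neg (by omega)] at hwk
        subst hi'
        simp only [Function.update_self, hku, hkv]
        simp only at hwk
        rw [hwk, if_pos (by omega)]
      · rw [Function.update_of_ne (by omega), hw i]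
        have h2 : (i : ℕ) < k + 1 ↔ (i : ℕ) < k := by omega
        simp [h2]
    · intro j hj
      rw [w5, w4, w3, w2, view_tick, Function.update_of_ne (hj ⟨k, hk⟩), hfr j hj]
  have hz : s.reg 4 = 0 := hr.zero
  have hv2 : view s₂ = view s := by rw [v2, v1, v0]
  obtain ⟨s', e', k', -, -, -, v', fr'⟩ := while_spec (env := env) Inv n hstep
    (fun t ⟨hk1, h50, _⟩ => by
      rw [h50, ((k02.trans hk1).regs (by norm_num) hr).dim]; exact lt_irrefl _)
    (s := s₂) ⟨by simpa using Keeps.refl 50 s₂, by rw [r2, r1, r0]; simp,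
      by rw [r2, r1, r0]; simp [show rM ≠ 50 by omega, hz, hM],
      by rw [r2, r1, r0]; simp [show ru ≠ 50 by omega, show ru ≠ 51 by omega, hz],
      fun i => by rw [hv2]; simp, fun j _ => by rw [hv2]⟩
  refine ⟨s'.tick 1, .seq e0 (.seq e1 (.seq e2 e')), ?_, ?_, ?_⟩
  · refine (k02.trans (k'.trans (.tick _ 1 _))).mono le_rfl ?_
    have : n ≤ n ^ 2 := Nat.le_self_pow (by norm_num) n
    nlinarith
  · ext i j
    simp [matOf, v' i, Matrix.vecMulVec_apply]
  · intro j hj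
    rw [view_tick, fr' j hj]

/-- Write the number at `rs` on the diagonal of the matrix at `rM`. -/
def diag (rM rs : ℕ) : Cmd :=
  .seq (.natConst 50 0) (.seq (.natAdd 51 rM 4) (.whileNatLt 50 0
    (.seq (.realCopy 51 rs) (.seq (.natAdd 51 51 0) (.seq (.natAdd 51 51 3) (.natAdd 50 50 3))))))

theorem diag_spec {rM rs kM ks : ℕ} {js : Fin n} {s : State n} (hr : Regs s)
    (hrM : rM < 50) (hrs : rs < 50) (hM : s.reg rM = 3 + kM * n) (hs : At (s.reg rs) ks js)
    (hM30 : 30 ≤ kM) (hMn : kM + n ≤ 30 + 2 * n) (hs30 : ks < 30)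
    (hzero : ∀ i : Fin n, view s (kM + i) = 0) :
    ∃ s', Exec env (diag rM rs) s s' ∧ Keeps 50 (10 * n + 4) s s' ∧
      matOf (view s') kM = view s ks js • (1 : Mat n) ∧
      ∀ j, (∀ i : Fin n, j ≠ kM + i) → view s' j = view s j := by
  obtain ⟨s₀, e0, k0, r0, v0⟩ := natConst_spec (env := env) (lo := 50) (i := 50) 0 le_rfl s
  obtain ⟨s₁, e1, k1, r1, v1⟩ := natAdd_spec (env := env) (lo := 50) (i := 51) rM 4 (by norm_num) s₀
  have k02 := k0.trans k1
  -- The address advances by `n + 1` per iteration and so runs down the diagonal.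
  let Inv : ℕ → State n → Prop := fun k s' =>
    Keeps 50 (k * 7) s₁ s' ∧ s'.reg 50 = k ∧ s'.reg 51 = 3 + (kM + k) * n + k ∧
      (∀ i : Fin n, view s' (kM + i) = if (i : ℕ) < k then
        WithLp.toLp 2 (Pi.single i (view s ks js)) else 0) ∧
      ∀ j, (∀ i : Fin n, j ≠ kM + i) → view s' j = view s j
  have hstep : ∀ k < n, ∀ s₁, Inv k s₁ → s₁.reg 50 < s₁.reg 0 ∧ ∃ s', Exec env
      (.seq (.realCopy 51 rs) (.seq (.natAdd 51 51 0) (.seq (.natAdd 51 51 3) (.natAdd 50 50 3))))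
      (s₁.tick 1) s' ∧ Inv (k + 1) s' := by
    rintro k hk t₁ ⟨hk1, h50, h51, hw, hfr⟩
    have hks := k02.trans hk1
    have hregs : Regs t₁ := hks.regs (by norm_num) hr
    refine ⟨by rw [h50, hregs.dim]; exact hk, ?_⟩
    have hks' : Keeps 50 (k * 7 + 1) s₁ (t₁.tick 1) := hk1.trans (.tick _ _ _)
    obtain ⟨t₂, f2, l2, q2, w2⟩ := realCopy_spec (env := env) (d := 51) (a := rs) 50
      (k := kM + k) (k' := ks) (i := ⟨k, hk⟩) (i' := js) (s := t₁.tick 1)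
      ⟨by simp only [tick_reg, h51], by omega, by omega⟩
      (by simp only [tick_reg, hks.reg rs hrs]; exact hs)
    obtain ⟨t₃, f3, l3, q3, w3⟩ := natAdd_spec (env := env) (lo := 50) (i := 51) 51 0
      (by norm_num) t₂
    obtain ⟨t₄, f4, l4, q4, w4⟩ := natAdd_spec (env := env) (lo := 50) (i := 51) 51 3
      (by norm_num) t₃
    obtain ⟨t₅, f5, l5, q5, w5⟩ := natAdd_spec (env := env) (lo := 50) (i := 50) 50 3
      (by norm_num) t₄
    have hr0 : t₂.reg 0 = n := (l2.reg 0 (by norm_num)).trans hregs.dim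
    have hr3 : t₂.reg 3 = 1 := (l2.reg 3 (by norm_num)).trans hregs.one
    have hr50 : t₂.reg 50 = k := by rw [q2]; exact h50
    have hr51 : t₂.reg 51 = 3 + (kM + k) * n + k := by rw [q2]; exact h51
    have hkss : view t₁ ks = view s ks := hfr ks fun i => by omega
    refine ⟨t₅, .seq f2 (.seq f3 (.seq f4 f5)), ?_, ?_, ?_, ?_, ?_⟩
    · exact (hks'.trans (l2.trans (l3.trans (l4.trans l5)))).mono le_rfl (by omega)
    · rw [q5, q4, q3]; simp [hr50, hr3]
    · rw [q5, q4, q3]; simp [hr51, hr0, hr3]; ring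
    · intro i
      rw [w5, w4, w3, w2, view_tick]
      by_cases hi : (i : ℕ) = k
      · have hi' : i = ⟨k, hk⟩ := Fin.ext hi
        have hwk := hw i
        rw [if_neg (by omega)] at hwk
        subst hi'
        simp only at hwk
        simp only [setCell, Function.update_self, hwk, hkss]
        rw [if_pos (by omega)]
        rfl
      · rw [setCell, Function.update_of_ne (by omega), hw i]
        have h2 : (i : ℕ) < k + 1 ↔ (i : ℕ) < k := by omega
        simp [h2]
    · intro j hj
      rw [w5, w4, w3, w2, view_tick, setCell, Function.update_of_ne (hj ⟨k, hk⟩), hfr j hj]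
  have hz : s.reg 4 = 0 := hr.zero
  have hv2 : view s₁ = view s := by rw [v1, v0]
  obtain ⟨s', e', k', -, -, v', fr'⟩ := while_spec (env := env) Inv n hstep
    (fun t ⟨hk1, h50, _⟩ => by
      rw [h50, ((k02.trans hk1).regs (by norm_num) hr).dim]; exact lt_irrefl _)
    (s := s₁) ⟨by simpa using Keeps.refl 50 s₁, by rw [r1, r0]; simp,
      by rw [r1, r0]; simp [show rM ≠ 50 by omega, hz, hM],
      fun i => by rw [hv2, hzero]; simp, fun j _ => by rw [hv2]⟩
  refine ⟨s'.tick 1, .seq e0 (.seq e1 e'), ?_, ?_, ?_⟩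
  · exact (k02.trans (k'.trans (.tick _ 1 _))).mono le_rfl (by omega)
  · ext i j
    simp [matOf, v' i, Matrix.one_apply, eq_comm]
  · intro j hj
    rw [view_tick, fr' j hj]

theorem matOf_update (M : ℕ → Vec n) {k b : ℕ} (v : Vec n) (hk : k < 30) (hb : 30 ≤ b) :
    matOf (Function.update M k v) b = matOf M b :=
  matOf_congr fun _ => Function.update_of_ne (by omega) _ _

theorem setCell_of_ne (M : ℕ → Vec n) {k j : ℕ} (i : Fin n) (v : ℝ) (h : j ≠ k) :
    setCell M k i v j = M j := Function.update_of_ne h _ _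

theorem setCell_self (M : ℕ → Vec n) {k : ℕ} (i : Fin n) (v : ℝ) :
    setCell M k i v k i = v := by simp [setCell]

end Matrices

end RealRAM

/-! ### Oracle instructions, branches, and the projection program. -/

namespace RealRAM

section Programs

variable {n : ℕ} {env : Env n}

/-- The computation from `s` to `s'` takes at most `t` steps, does not change the registers below
`lo`, makes `c` oracle calls, and plays the points `ps`. -/
structure Effect (lo t c : ℕ) (ps : List (Vec n)) (s s' : State n) : Prop where
  plays : s'.plays = s.plays ++ ps
  looCalls : s'.looCalls = s.looCalls + c
  reg : ∀ j < lo, s'.reg j = s.reg j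
  time : s'.time ≤ s.time + t
  space : s'.space ≤ max s.space (memBound n)

theorem Keeps.effect {lo t : ℕ} {s s' : State n} (h : Keeps lo t s s') : Effect lo t 0 [] s s' :=
  ⟨by rw [h.plays, List.append_nil], h.looCalls, h.reg, h.time, h.space⟩

theorem Effect.trans {lo t t' c c' : ℕ} {ps ps' : List (Vec n)} {s s₁ s₂ : State n}
    (h : Effect lo t c ps s s₁) (h' : Effect lo t' c' ps' s₁ s₂) :
    Effect lo (t + t') (c + c') (ps ++ ps') s s₂ :=
  ⟨by rw [h'.plays, h.plays, List.append_assoc], by rw [h'.looCalls, h.looCalls, add_assoc],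
    fun j hj => (h'.reg j hj).trans (h.reg j hj), by have := h.time; have := h'.time; omega,
    h'.space.trans (max_le h.space (le_max_right _ _))⟩

theorem Effect.mono {lo lo' t t' c : ℕ} {ps : List (Vec n)} {s s' : State n}
    (h : Effect lo t c ps s s') (hlo : lo' ≤ lo) (ht : t ≤ t') : Effect lo' t' c ps s s' :=
  ⟨h.plays, h.looCalls, fun j hj => h.reg j (by omega), h.time.trans (by omega), h.space⟩

theorem Regs.congr {s s' : State n} (hr : Regs s) (h : s'.reg = s.reg) : Regs s' :=
  ⟨by rw [h]; exact hr.1, by rw [h]; exact hr.2, by rw [h]; exact hr.3, by rw [h]; exact hr.4,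
    by rw [h]; exact hr.5⟩

theorem readVec_eq_view {s : State n} {a k : ℕ} (h : AtSlot n a k) :
    readVec s.mem a = view s k := by
  rw [view, if_neg h.ne, h.addr]

theorem AtSlot.le {a k : ℕ} (h : AtSlot n a k) : a + n ≤ memBound n := by
  rw [h.addr]; exact slot_le h.lt

theorem loo_spec {d a kd ka : ℕ} (lo : ℕ) {s : State n} (hd : AtSlot n (s.reg d) kd)
    (ha : AtSlot n (s.reg a) ka) :
    ∃ s', Exec env (.loo d a) s s' ∧ Effect lo (n + 1) 1 [] s s' ∧ s'.reg = s.reg ∧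
      view s' = Function.update (view s) kd (env.loo s.looCalls (view s ka)) :=
  ⟨_, .loo d a s, ⟨(List.append_nil _).symm, rfl, fun _ _ => rfl, le_rfl,
    max_le (max_le_max le_rfl hd.le) (le_max_of_le_right ha.le)⟩, rfl,
    view_writeVec hd.ne (by
      simp only [tick_mem, touch_mem, setVec_mem]; rw [readVec_eq_view ha, hd.addr])⟩

theorem play_spec {a ka : ℕ} (lo : ℕ) {s : State n} (ha : AtSlot n (s.reg a) ka) :
    ∃ s', Exec env (.play a) s s' ∧ Effect lo (n + 1) 0 [view s ka] s s' ∧ s'.reg = s.reg ∧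
      view s' = view s :=
  ⟨_, .play a s, ⟨by rw [← readVec_eq_view ha]; rfl, rfl, fun _ _ => rfl, le_rfl,
    max_le_max le_rfl ha.le⟩, rfl, view_congr rfl⟩

theorem grad_spec {d a kd ka : ℕ} (lo : ℕ) {s : State n} (hd : AtSlot n (s.reg d) kd)
    (ha : AtSlot n (s.reg a) ka) (hplay : s.plays ≠ []) (hdom : view s ka ∈ env.dom) :
    ∃ s', Exec env (.grad d a) s s' ∧ Keeps lo (n + 1) s s' ∧ s'.reg = s.reg ∧
      view s' = Function.update (view s) kd (env.grad (s.plays.length - 1) (view s ka)) :=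
  ⟨_, .grad d a s hplay (by rw [readVec_eq_view ha]; exact hdom), ⟨rfl, rfl, fun _ _ => rfl, le_rfl,
    max_le (max_le_max le_rfl hd.le) (le_max_of_le_right ha.le)⟩, rfl,
    view_writeVec hd.ne (by
      simp only [tick_mem, touch_mem, setVec_mem]; rw [readVec_eq_view ha, hd.addr])⟩

theorem ifRealLe_true_spec {a b ka kb : ℕ} {ia ib : Fin n} (lo : ℕ) {s : State n}
    (ha : At (s.reg a) ka ia) (hb : At (s.reg b) kb ib) (h : view s ka ia ≤ view s kb ib)
    (P Q : Cmd) :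
    ∃ s₀, Keeps lo 1 s s₀ ∧ s₀.reg = s.reg ∧ view s₀ = view s ∧
      ∀ s', Exec env P s₀ s' → Exec env (.ifRealLe a b P Q) s s' :=
  ⟨((s.touch (s.reg a + 1)).touch (s.reg b + 1)).tick 1, ⟨rfl, rfl, fun _ _ => rfl, le_rfl,
    max_le (max_le_max le_rfl ha.le) (le_max_of_le_right hb.le)⟩, rfl, view_congr rfl,
    fun _ e => .ifRealLe_true (by rwa [mem_eq_view ha, mem_eq_view hb]) e⟩

theorem ifRealLe_false_spec {a b ka kb : ℕ} {ia ib : Fin n} (lo : ℕ) {s : State n}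
    (ha : At (s.reg a) ka ia) (hb : At (s.reg b) kb ib) (h : ¬ view s ka ia ≤ view s kb ib)
    (P Q : Cmd) :
    ∃ s₀, Keeps lo 1 s s₀ ∧ s₀.reg = s.reg ∧ view s₀ = view s ∧
      ∀ s', Exec env Q s₀ s' → Exec env (.ifRealLe a b P Q) s s' :=
  ⟨((s.touch (s.reg a + 1)).touch (s.reg b + 1)).tick 1, ⟨rfl, rfl, fun _ _ => rfl, le_rfl,
    max_le (max_le_max le_rfl ha.le) (le_max_of_le_right hb.le)⟩, rfl, view_congr rfl,
    fun _ e => .ifRealLe_false (by rwa [mem_eq_view ha, mem_eq_view hb]) e⟩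

/-! ### Operations on slots -/

theorem axpy_slots {d a b k : ℕ} {s : State n} (hn : 0 < n) (hr : Regs s) (hd : d < 29)
    (ha : a < 29) (hb : b < 29) (hk : k < 29) (hkd : k ≠ d) :
    ∃ s', Exec env (axpy (10 + d) (10 + a) (10 + b) (10 + k)) s s' ∧ Keeps 50 (12 * n ^ 2) s s' ∧
      Regs s' ∧
      view s' = Function.update (view s) d (view s a + view s k ⟨0, hn⟩ • view s b) := by
  obtain ⟨s', e, h, v⟩ := axpy_spec (env := env) hr (by omega) (by omega) (by omega) (by omega)
    (hr.atSlot hd) (hr.atSlot ha) (hr.atSlot hb) (hr.at_zero hn hk) hkd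
  exact ⟨s', e, h.mono (by norm_num) (by nlinarith), h.regs (by norm_num) hr, v⟩

theorem dot_slots {d a b : ℕ} {s : State n} (hn : 0 < n) (hr : Regs s) (hd : d < 29)
    (ha : a < 29) (hb : b < 29) (had : a ≠ d) (hbd : b ≠ d) :
    ∃ s', Exec env (dot (10 + d) (10 + a) (10 + b)) s s' ∧ Keeps 50 (13 * n ^ 2) s s' ∧
      Regs s' ∧ view s' = setCell (view s) d ⟨0, hn⟩ ⟪view s a, view s b⟫_ℝ := by
  obtain ⟨s', e, h, v⟩ := dot_spec (env := env) hr (by omega) (by omega) (by omega)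
    (hr.at_zero hn hd) (hr.atSlot ha) (hr.atSlot hb) had hbd
  exact ⟨s', e, h.mono (by norm_num) (by nlinarith), h.regs (by norm_num) hr, v⟩

theorem matvec_slots {d b : ℕ} {s : State n} (hn : 0 < n) (hr : Regs s) (hd : d < 29)
    (hb : b < 29) (hbd : b ≠ d) :
    ∃ s', Exec env (matvec (10 + d) 40 (10 + b)) s s' ∧ Keeps 50 (24 * n ^ 2) s s' ∧
      Regs s' ∧ view s' = Function.update (view s) d ((matOf (view s) 30).app (view s b)) := by
  obtain ⟨s', e, h, v⟩ := matvec_spec (env := env) (rM := 40) (kM := 30) hr (by omega) (by omega)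
    (by omega) (hr.atSlot hd) (hr.slot 30 le_rfl) (hr.atSlot hb) le_rfl (by omega) (by omega) hbd
  exact ⟨s', e, h.mono le_rfl (by nlinarith), h.regs (by norm_num) hr, v⟩

theorem matvec_inv_slots {d b : ℕ} {s : State n} (hn : 0 < n) (hr : Regs s) (hd : d < 29)
    (hb : b < 29) (hbd : b ≠ d) :
    ∃ s', Exec env (matvec (10 + d) 41 (10 + b)) s s' ∧ Keeps 50 (24 * n ^ 2) s s' ∧
      Regs s' ∧
      view s' = Function.update (view s) d ((matOf (view s) (30 + n)).app (view s b)) := by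
  obtain ⟨s', e, h, v⟩ := matvec_spec (env := env) (rM := 41) (kM := 30 + n) hr (by omega)
    (by omega) (by omega) (hr.atSlot hd) hr.inv (hr.atSlot hb) (by omega) (by omega) (by omega) hbd
  exact ⟨s', e, h.mono le_rfl (by nlinarith), h.regs (by norm_num) hr, v⟩

/-! ### The data of the algorithm in memory -/

/-- The constants and the matrices of the algorithm, as they are stored in memory. -/
structure Consts (hn : 0 < n) (p : Params n) (A B : Mat n) (M : ℕ → Vec n) : Prop where
  eps : M 11 ⟨0, hn⟩ = p.ε
  eps_three : M 12 ⟨0, hn⟩ = 3 * p.ε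
  neg_eta : M 13 ⟨0, hn⟩ = -p.η
  neg_one : M 17 ⟨0, hn⟩ = -1
  two_thirds : M 18 ⟨0, hn⟩ = 2 / 3
  one : M 19 ⟨0, hn⟩ = 1
  zero : M 22 = 0
  mat : matOf M 30 = A
  inv : matOf M (30 + n) = B

/-- The admitted slots are the work space; the other slots below `24` hold constants or serve only
the initialisation. -/
theorem Consts.update {hn : 0 < n} {p : Params n} {A B : Mat n} {M : ℕ → Vec n}
    (h : Consts hn p A B M) {k : ℕ} (hk : k < 11 ∨ (13 < k ∧ k < 17) ∨ k = 23) (v : Vec n) :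
    Consts hn p A B (Function.update M k v) := by
  constructor
  · rw [Function.update_of_ne (by omega)]; exact h.eps
  · rw [Function.update_of_ne (by omega)]; exact h.eps_three
  · rw [Function.update_of_ne (by omega)]; exact h.neg_eta
  · rw [Function.update_of_ne (by omega)]; exact h.neg_one
  · rw [Function.update_of_ne (by omega)]; exact h.two_thirds
  · rw [Function.update_of_ne (by omega)]; exact h.one
  · rw [Function.update_of_ne (by omega)]; exact h.zero
  · rw [matOf_update _ _ (by omega) (by omega)]; exact h.mat
  · rw [matOf_update _ _ (by omega) (by omega)]; exact h.inv

theorem Consts.setCell {hn : 0 < n} {p : Params n} {A B : Mat n} {M : ℕ → Vec n}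
    (h : Consts hn p A B M) {k : ℕ} (hk : k < 11 ∨ (13 < k ∧ k < 17) ∨ k = 23) (i : Fin n)
    (v : ℝ) : Consts hn p A B (setCell M k i v) := h.update hk _

/-- The memory holds the data of the algorithm: the feasible point `x` and the point `y`, the
constants, and the matrices `A` and `B`. -/
structure Rep (hn : 0 < n) (p : Params n) (A B : Mat n) (x y : Vec n) (s : State n) : Prop where
  regs : Regs s
  consts : Consts hn p A B (view s)
  x_eq : view s 0 = x
  y_eq : view s 1 = y

variable {hn : 0 < n} {p : Params n} {A B : Mat n} {x y : Vec n} {s : State n}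

theorem Rep.congr (h : Rep hn p A B x y s) {s' : State n} (hr : Regs s') (hv : view s' = view s) :
    Rep hn p A B x y s' :=
  ⟨hr, hv ▸ h.consts, by rw [hv]; exact h.x_eq, by rw [hv]; exact h.y_eq⟩

/-- Compute `x - y`, `A (x - y)` and `‖x - y‖_A²`. -/
def residual (Q : Cmd) : Cmd :=
  .seq (axpy 14 10 11 27) (.seq (matvec 15 40 14) (.seq (dot 24 14 15) Q))

/-- A Frank-Wolfe step. -/
def fwMove : Cmd :=
  .seq (matvec 18 40 17) (.seq (dot 26 17 18) (.ifRealLe 26 25 (axpy 10 10 17 27)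
    (.seq (.realOp .div 26 25 26) (.seq (.realOp .mul 26 26 27) (axpy 10 10 17 26)))))

/-- One pass through the flattened loop of the approximately feasible projection. -/
def projBody : Cmd :=
  residual (.seq (.loo 16 15) (.ifRealLe 24 22 (.natConst 45 0)
    (.seq (axpy 17 10 16 27) (.seq (dot 25 17 15)
      (.ifRealLe 25 21 (axpy 11 11 14 28) fwMove)))))

/-- The approximately feasible projection. -/
def proj : Cmd :=
  residual (.ifRealLe 24 22 .skip (.seq (.natConst 45 1) (.whileNatLt 4 45 projBody)))

/-- Stated with an arbitrary continuation because the same prefix opens both the whole projection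
and each pass of its loop. -/
theorem residual_spec (h : Rep hn p A B x y s) (Q : Cmd) :
    ∃ s', (∀ s'', Exec env Q s' s'' → Exec env (residual Q) s s'') ∧
      Keeps 50 (49 * n ^ 2) s s' ∧ Rep hn p A B x y s' ∧ view s' 4 = x - y ∧
      view s' 5 = A.app (x - y) ∧ view s' 14 ⟨0, hn⟩ = normSq A (x - y) := by
  obtain ⟨s₁, e1, k1, r1, v1⟩ := axpy_slots (env := env) (d := 4) (a := 0) (b := 1) (k := 17) hn
    h.regs (by norm_num) (by norm_num) (by norm_num) (by norm_num) (by norm_num)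
  rw [h.consts.neg_one, h.x_eq, h.y_eq, neg_one_smul, ← sub_eq_add_neg] at v1
  have c1 : Consts hn p A B (view s₁) := v1 ▸ h.consts.update (by norm_num) _
  obtain ⟨s₂, e2, k2, r2, v2⟩ := matvec_slots (env := env) (d := 5) (b := 4) hn r1 (by norm_num)
    (by norm_num) (by norm_num)
  rw [c1.mat] at v2
  have c2 : Consts hn p A B (view s₂) := v2 ▸ c1.update (by norm_num) _
  obtain ⟨s₃, e3, k3, r3, v3⟩ := dot_slots (env := env) (d := 14) (a := 4) (b := 5) hn r2
    (by norm_num) (by norm_num) (by norm_num) (by norm_num) (by norm_num)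
  have c3 : Consts hn p A B (view s₃) := v3 ▸ c2.setCell (by norm_num) _ _
  have w4 : view s₁ 4 = x - y := by rw [v1]; simp
  refine ⟨s₃, fun s'' e => .seq e1 (.seq e2 (.seq e3 e)),
    (k1.trans (k2.trans k3)).mono le_rfl (by omega), ⟨r3, c3, ?_, ?_⟩, ?_, ?_, ?_⟩
  · rw [v3, setCell_of_ne _ _ _ (by norm_num), v2, v1]; simp [h.x_eq]
  · rw [v3, setCell_of_ne _ _ _ (by norm_num), v2, v1]; simp [h.y_eq]
  · rw [v3, setCell_of_ne _ _ _ (by norm_num), v2]; simp [w4]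
  · rw [v3, setCell_of_ne _ _ _ (by norm_num), v2]; simp [w4]
  · rw [v3, setCell_self, v2]; simp [w4, normSq]

/-- A run may use any minimising step, whereas the program computes a definite one. A positive gap
makes the parabola strictly decreasing at `0`, so its minimiser on the unit interval is unique and
the two agree. -/
theorem line_search_unique (hA : A.IsHermitian) (hpsd : ∀ x, 0 ≤ normSq A x) {x y v : Vec n}
    {σ : ℝ} (hg : 0 < ⟪x - y, A.app (x - v)⟫_ℝ) (hσ : σ ∈ Set.Icc (0 : ℝ) 1)
    (hmin : IsMinOn (fun s : ℝ => normSq A (y - x - s • (v - x))) (Set.Icc 0 1) σ) :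
    σ = if normSq A (x - v) ≤ ⟪x - y, A.app (x - v)⟫_ℝ then 1
      else ⟪x - y, A.app (x - v)⟫_ℝ / normSq A (x - v) := by
  have hφ : ∀ t ∈ Set.Icc (0 : ℝ) 1, _ := fun t ht => hmin ht
  simp only [Set.mem_ofPred_eq, normSq_line hA] at hφ
  have hr := hpsd (x - v)
  set g := ⟪x - y, A.app (x - v)⟫_ℝ
  set r := normSq A (x - v)
  split_ifs with h
  · by_contra hne
    have hlt : σ < 1 := lt_of_le_of_ne hσ.2 hne
    have h1 := hφ 1 (by simp)
    have h2 : (1 - σ) * (2 * g - r * (1 + σ)) ≤ 0 := by nlinarith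
    have h3 : 0 < 2 * g - r * (1 + σ) := by
      have : r * (1 + σ) ≤ g * (1 + σ) := mul_le_mul_of_nonneg_right h (by linarith [hσ.1])
      nlinarith
    nlinarith [mul_pos (sub_pos.2 hlt) h3]
  · have hr0 : 0 < r := by linarith
    have h1 := hφ (g / r) ⟨by positivity, by rw [div_le_one hr0]; linarith⟩
    have e : g = g / r * r := by field_simp
    set t := g / r
    rw [e] at h1
    -- Completing the square: optimality of `σ` against the vertex `t` leaves no room for a
    -- difference.
    have h2 : r * (σ - t) ^ 2 ≤ 0 := by nlinarith
    have h3 : (σ - t) ^ 2 ≤ 0 := by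
      by_contra hc
      have := mul_pos hr0 (not_le.1 hc)
      linarith
    have h4 : σ - t = 0 := by nlinarith [sq_nonneg (σ - t)]
    linarith

theorem fwMove_spec (h : Rep hn p A B x y s) {v : Vec n} {g : ℝ} (hg : 0 < g)
    (hw : view s 7 = x - v) (hgap : view s 15 ⟨0, hn⟩ = g) :
    ∃ s', Exec env fwMove s s' ∧ Keeps 50 (52 * n ^ 2) s s' ∧
      Rep hn p A B (x + (if normSq A (x - v) ≤ g then 1 else g / normSq A (x - v)) • (v - x)) y
        s' := by
  have hq : 1 ≤ n ^ 2 := Nat.one_le_pow _ _ hn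
  obtain ⟨s₁, e1, k1, r1, v1⟩ := matvec_slots (env := env) (d := 8) (b := 7) hn h.regs
    (by norm_num) (by norm_num) (by norm_num)
  rw [h.consts.mat, hw] at v1
  have c1 : Consts hn p A B (view s₁) := v1 ▸ h.consts.update (by norm_num) _
  obtain ⟨s₂, e2, k2, r2, v2⟩ := dot_slots (env := env) (d := 16) (a := 7) (b := 8) hn r1
    (by norm_num) (by norm_num) (by norm_num) (by norm_num) (by norm_num)
  have c2 : Consts hn p A B (view s₂) := v2 ▸ c1.setCell (by norm_num) _ _
  have w0 : view s₂ 0 = x := by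
    rw [v2, setCell_of_ne _ _ _ (by norm_num), v1]; simp [h.x_eq]
  have w1 : view s₂ 1 = y := by
    rw [v2, setCell_of_ne _ _ _ (by norm_num), v1]; simp [h.y_eq]
  have w7 : view s₂ 7 = x - v := by
    rw [v2, setCell_of_ne _ _ _ (by norm_num), v1]; simp [hw]
  have w15 : view s₂ 15 ⟨0, hn⟩ = g := by
    rw [v2, setCell_of_ne _ _ _ (by norm_num), v1]; simp [hgap]
  have w16 : view s₂ 16 ⟨0, hn⟩ = normSq A (x - v) := by
    rw [v2, setCell_self, v1]; simp [hw, normSq]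
  by_cases hle : normSq A (x - v) ≤ g
  · obtain ⟨s₃, k3, r3, v3, e3⟩ := ifRealLe_true_spec (env := env) (a := 26) (b := 25) 50
      (r2.at_zero hn (k := 16) (by norm_num)) (r2.at_zero hn (k := 15) (by norm_num))
      (by rw [w16, w15]; exact hle) (axpy 10 10 17 27)
      (.seq (.realOp .div 26 25 26) (.seq (.realOp .mul 26 26 27) (axpy 10 10 17 26)))
    obtain ⟨s₄, e4, k4, r4, v4⟩ := axpy_slots (env := env) (d := 0) (a := 0) (b := 7) (k := 17) hn
      (r2.congr r3) (by norm_num) (by norm_num) (by norm_num) (by norm_num) (by norm_num)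
    rw [v3, w0, w7, c2.neg_one] at v4
    refine ⟨s₄, .seq e1 (.seq e2 (e3 _ e4)),
      (k1.trans (k2.trans (k3.trans k4))).mono le_rfl (by omega),
      ⟨r4, v4 ▸ c2.update (by norm_num) _, ?_, ?_⟩⟩
    · rw [v4, if_pos hle]; simp only [Function.update_self]; module
    · rw [v4]; simp [w1]
  · have hne : normSq A (x - v) ≠ 0 := by linarith
    obtain ⟨s₃, k3, r3, v3, e3⟩ := ifRealLe_false_spec (env := env) (a := 26) (b := 25) 50
      (r2.at_zero hn (k := 16) (by norm_num)) (r2.at_zero hn (k := 15) (by norm_num))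
      (by rw [w16, w15]; exact hle) (axpy 10 10 17 27)
      (.seq (.realOp .div 26 25 26) (.seq (.realOp .mul 26 26 27) (axpy 10 10 17 26)))
    have r3' := r2.congr r3
    obtain ⟨s₄, e4, k4, r4, v4⟩ := realOp_spec (env := env) (op := .div) (d := 26) (a := 25)
      (b := 26) 50 (r3'.at_zero hn (k := 16) (by norm_num)) (r3'.at_zero hn (k := 15) (by norm_num))
      (r3'.at_zero hn (k := 16) (by norm_num)) (fun _ => by rw [v3, w16]; exact hne)
    rw [v3, w15, w16] at v4
    have r4' := r3'.congr r4
    have c4 : Consts hn p A B (view s₄) := v4 ▸ c2.setCell (by norm_num) _ _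
    -- The stored direction is `x - v`, opposite to the Frank-Wolfe direction, so the step size
    -- changes sign.
    obtain ⟨s₅, e5, k5, r5, v5⟩ := realOp_spec (env := env) (op := .mul) (d := 26) (a := 26)
      (b := 27) 50 (r4'.at_zero hn (k := 16) (by norm_num)) (r4'.at_zero hn (k := 16) (by norm_num))
      (r4'.at_zero hn (k := 17) (by norm_num)) (fun hc => by cases hc)
    rw [c4.neg_one] at v5
    have r5' := r4'.congr r5
    have c5 : Consts hn p A B (view s₅) := v5 ▸ c4.setCell (by norm_num) _ _
    have w5 : ∀ k, k ≠ 16 → view s₅ k = view s₂ k := fun k hk => by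
      rw [v5, setCell_of_ne _ _ _ hk, v4, setCell_of_ne _ _ _ hk]
    have w16' : view s₅ 16 ⟨0, hn⟩ = -(g / normSq A (x - v)) := by
      rw [v5, setCell_self, v4, setCell_self]; simp [ArithOp.eval]
    obtain ⟨s₆, e6, k6, r6, v6⟩ := axpy_slots (env := env) (d := 0) (a := 0) (b := 7) (k := 16) hn
      r5' (by norm_num) (by norm_num) (by norm_num) (by norm_num) (by norm_num)
    rw [w16', w5 0 (by norm_num), w5 7 (by norm_num), w0, w7] at v6
    refine ⟨s₆, .seq e1 (.seq e2 (e3 _ (.seq e4 (.seq e5 e6)))),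
      (k1.trans (k2.trans (k3.trans (k4.trans (k5.trans k6))))).mono le_rfl (by omega),
      ⟨r6, v6 ▸ c5.update (by norm_num) _, ?_, ?_⟩⟩
    · rw [v6, if_neg hle]; simp only [Function.update_self]; module
    · rw [v6, Function.update_of_ne (by norm_num), w5 1 (by norm_num), w1]

/-- The three possible outcomes of a pass through the loop. -/
theorem projBody_spec (hA : A.IsHermitian) (hε : 0 < p.ε) (h : Rep hn p A B x y s) {v : Vec n}
    (hv : v = env.loo s.looCalls (A.app (x - y))) :
    ∃ s' x' y', Exec env projBody s s' ∧ Effect 45 (149 * n ^ 2) 1 [] s s' ∧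
      Rep hn p A B x' y' s' ∧
      (normSq A (x - y) ≤ 3 * p.ε → x' = x ∧ y' = y ∧ s'.reg 45 = 0) ∧
      (¬ normSq A (x - y) ≤ 3 * p.ε → s'.reg 45 = s.reg 45 ∧
        if ⟪x - y, A.app (x - v)⟫_ℝ ≤ p.ε then x' = x ∧ y' = y - (2 / 3 : ℝ) • (y - x)
        else y' = y ∧ x' = x + (if normSq A (x - v) ≤ ⟪x - y, A.app (x - v)⟫_ℝ then 1
          else ⟪x - y, A.app (x - v)⟫_ℝ / normSq A (x - v)) • (v - x)) := by
  have hq : 1 ≤ n ^ 2 := Nat.one_le_pow _ _ hn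
  have hnq : n ≤ n ^ 2 := Nat.le_self_pow (by norm_num) n
  obtain ⟨s₁, e1, k1, h1, w4, w5, w14⟩ := residual_spec (env := env) h
    (.seq (.loo 16 15) (.ifRealLe 24 22 (.natConst 45 0)
      (.seq (axpy 17 10 16 27) (.seq (dot 25 17 15)
        (.ifRealLe 25 21 (axpy 11 11 14 28) fwMove)))))
  obtain ⟨s₂, e2, k2, r2, v2⟩ := loo_spec (env := env) (d := 16) (a := 15) 50
    (h1.regs.atSlot (k := 6) (by norm_num)) (h1.regs.atSlot (k := 5) (by norm_num))
  rw [w5, k1.looCalls, ← hv] at v2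
  have r2' := h1.regs.congr r2
  have c2 : Consts hn p A B (view s₂) := v2 ▸ h1.consts.update (by norm_num) _
  have u0 : view s₂ 0 = x := by rw [v2]; simp [h1.x_eq]
  have u1 : view s₂ 1 = y := by rw [v2]; simp [h1.y_eq]
  have u4 : view s₂ 4 = x - y := by rw [v2]; simp [w4]
  have u5 : view s₂ 5 = A.app (x - y) := by rw [v2]; simp [w5]
  have u6 : view s₂ 6 = v := by rw [v2]; simp
  have u14 : view s₂ 14 ⟨0, hn⟩ = normSq A (x - y) := by rw [v2]; simp [w14]
  have k12 := k1.effect.trans k2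
  have hreg12 : s₂.reg 45 = s.reg 45 := k12.reg 45 (by norm_num)
  by_cases hle : normSq A (x - y) ≤ 3 * p.ε
  · obtain ⟨s₃, k3, r3, v3, e3⟩ := ifRealLe_true_spec (env := env) (a := 24) (b := 22) 50
      (r2'.at_zero hn (k := 14) (by norm_num)) (r2'.at_zero hn (k := 12) (by norm_num))
      (by rw [u14, c2.eps_three]; exact hle) (.natConst 45 0)
      (.seq (axpy 17 10 16 27) (.seq (dot 25 17 15)
        (.ifRealLe 25 21 (axpy 11 11 14 28) fwMove)))
    obtain ⟨s₄, e4, k4, r4, v4⟩ := natConst_spec (env := env) (lo := 45) (i := 45) 0 le_rfl s₃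
    have hreg := k4.regs (by norm_num) (r2'.congr r3)
    refine ⟨s₄, x, y, e1 _ (.seq e2 (e3 _ e4)), ?_, ⟨hreg, ?_, ?_, ?_⟩, fun _ => ⟨rfl, rfl, ?_⟩,
      fun hc => absurd hle hc⟩
    · exact ((k12.trans k3.effect).mono (by norm_num) le_rfl |>.trans k4.effect).mono le_rfl
        (by omega)
    · rw [v4, v3]; exact c2
    · rw [v4, v3]; exact u0
    · rw [v4, v3]; exact u1
    · rw [r4]; simp
  · obtain ⟨s₃, k3, r3, v3, e3⟩ := ifRealLe_false_spec (env := env) (a := 24) (b := 22) 50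
      (r2'.at_zero hn (k := 14) (by norm_num)) (r2'.at_zero hn (k := 12) (by norm_num))
      (by rw [u14, c2.eps_three]; exact hle) (.natConst 45 0)
      (.seq (axpy 17 10 16 27) (.seq (dot 25 17 15)
        (.ifRealLe 25 21 (axpy 11 11 14 28) fwMove)))
    obtain ⟨s₄, e4, k4, r4, v4⟩ := axpy_slots (env := env) (d := 7) (a := 0) (b := 6) (k := 17) hn
      (r2'.congr r3) (by norm_num) (by norm_num) (by norm_num) (by norm_num) (by norm_num)
    rw [v3, u0, u6, c2.neg_one, neg_one_smul, ← sub_eq_add_neg] at v4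
    have c4 : Consts hn p A B (view s₄) := v4 ▸ c2.update (by norm_num) _
    obtain ⟨s₅, e5, k5, r5, v5⟩ := dot_slots (env := env) (d := 15) (a := 7) (b := 5) hn r4
      (by norm_num) (by norm_num) (by norm_num) (by norm_num) (by norm_num)
    have c5 : Consts hn p A B (view s₅) := v5 ▸ c4.setCell (by norm_num) _ _
    have z : ∀ k, k ≠ 15 → k ≠ 7 → view s₅ k = view s₂ k := fun k h15 h7 => by
      rw [v5, setCell_of_ne _ _ _ h15, v4, Function.update_of_ne h7]
    have z7 : view s₅ 7 = x - v := by
      rw [v5, setCell_of_ne _ _ _ (by norm_num), v4]; simp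
    have z15 : view s₅ 15 ⟨0, hn⟩ = ⟪x - y, A.app (x - v)⟫_ℝ := by
      rw [v5, setCell_self, v4]
      simp only [Function.update_self, Function.update_of_ne (show (5 : ℕ) ≠ 7 by norm_num), u5]
      rw [← inner_app_comm hA, real_inner_comm]
    have k15 := k12.trans (k3.trans (k4.trans k5)).effect
    have rep5 : Rep hn p A B x y s₅ := ⟨r5, c5, by rw [z 0 (by norm_num) (by norm_num), u0],
      by rw [z 1 (by norm_num) (by norm_num), u1]⟩
    by_cases hg : ⟪x - y, A.app (x - v)⟫_ℝ ≤ p.ε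
    · obtain ⟨s₆, k6, r6, v6, e6⟩ := ifRealLe_true_spec (env := env) (a := 25) (b := 21) 50
        (r5.at_zero hn (k := 15) (by norm_num)) (r5.at_zero hn (k := 11) (by norm_num))
        (by rw [z15, c5.eps]; exact hg) (axpy 11 11 14 28) fwMove
      obtain ⟨s₇, e7, k7, r7, v7⟩ := axpy_slots (env := env) (d := 1) (a := 1) (b := 4) (k := 18) hn
        (r5.congr r6) (by norm_num) (by norm_num) (by norm_num) (by norm_num) (by norm_num)
      rw [v6, rep5.y_eq, c5.two_thirds, z 4 (by norm_num) (by norm_num), u4] at v7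
      have k17 := k15.trans (k6.trans k7).effect
      refine ⟨s₇, x, y - (2 / 3 : ℝ) • (y - x), e1 _ (.seq e2 (e3 _ (.seq e4 (.seq e5 (e6 _ e7))))),
        k17.mono (by norm_num) (by omega), ⟨r7, v7 ▸ c5.update (by norm_num) _, ?_, ?_⟩,
        fun hc => absurd hc hle, fun _ => ⟨k17.reg 45 (by norm_num), ?_⟩⟩
      · rw [v7, Function.update_of_ne (by norm_num), rep5.x_eq]
      · rw [v7]; simp only [Function.update_self]; module
      · rw [if_pos hg]; exact ⟨rfl, rfl⟩
    · obtain ⟨s₆, k6, r6, v6, e6⟩ := ifRealLe_false_spec (env := env) (a := 25) (b := 21) 50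
        (r5.at_zero hn (k := 15) (by norm_num)) (r5.at_zero hn (k := 11) (by norm_num))
        (by rw [z15, c5.eps]; exact hg) (axpy 11 11 14 28) fwMove
      obtain ⟨s₇, e7, k7, rep7⟩ := fwMove_spec (env := env) (v := v)
        (rep5.congr (r5.congr r6) v6) (hε.trans (not_le.1 hg)) (by rw [v6, z7]) (by rw [v6, z15])
      have k17 := k15.trans (k6.trans k7).effect
      refine ⟨s₇, _, y, e1 _ (.seq e2 (e3 _ (.seq e4 (.seq e5 (e6 _ e7))))),
        k17.mono (by norm_num) (by omega), rep7,
        fun hc => absurd hc hle, fun _ => ⟨k17.reg 45 (by norm_num), ?_⟩⟩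
      rw [if_neg hg]; exact ⟨rfl, rfl⟩

theorem projBody_tick (hA : A.IsHermitian) (hε : 0 < p.ε) (h : Rep hn p A B x y s) {v : Vec n}
    (hv : v = env.loo s.looCalls (A.app (x - y))) :
    ∃ s' x' y', Exec env projBody (s.tick 1) s' ∧ Effect 45 (150 * n ^ 2) 1 [] s s' ∧
      Rep hn p A B x' y' s' ∧
      (normSq A (x - y) ≤ 3 * p.ε → x' = x ∧ y' = y ∧ s'.reg 45 = 0) ∧
      (¬ normSq A (x - y) ≤ 3 * p.ε → s'.reg 45 = s.reg 45 ∧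
        if ⟪x - y, A.app (x - v)⟫_ℝ ≤ p.ε then x' = x ∧ y' = y - (2 / 3 : ℝ) • (y - x)
        else y' = y ∧ x' = x + (if normSq A (x - v) ≤ ⟪x - y, A.app (x - v)⟫_ℝ then 1
          else ⟪x - y, A.app (x - v)⟫_ℝ / normSq A (x - v)) • (v - x)) := by
  have hq : 1 ≤ n ^ 2 := Nat.one_le_pow _ _ hn
  obtain ⟨s', x', y', e, k, r, h1, h2⟩ := projBody_spec (env := env) (s := s.tick 1) hA hε
    (h.congr (h.regs.congr rfl) (view_tick s 1)) hv
  exact ⟨s', x', y', e, by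
    simpa using (((Keeps.tick 45 1 s).effect.trans k).mono le_rfl (t' := 150 * n ^ 2) (by omega)),
    r, h1, h2⟩

/-- The loop runs through the Frank-Wolfe steps. -/
theorem exec_sepHyperplane (hA : A.IsHermitian) (hpsd : ∀ x, 0 ≤ normSq A x) (hε : 0 < p.ε)
    {k k' : ℕ} {x' : Vec n} (hsep : SepHyperplane env.loo A p.ε y k x k' x')
    (h : Rep hn p A B x y s) (hk : s.looCalls = k) (hflag : s.reg 45 = 1) :
    ∃ s' c, (∀ s'', Exec env (.whileNatLt 4 45 projBody) s' s'' →
        Exec env (.whileNatLt 4 45 projBody) s s'') ∧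
      Effect 45 (c * (150 * n ^ 2)) c [] s s' ∧ Rep hn p A B x' y s' ∧ s'.looCalls + 1 = k' ∧
      s'.reg 45 = 1 ∧ FWStop A p.ε y x' (env.loo s'.looCalls (A.app (x' - y))) := by
  induction hsep generalizing s with
  | @halt k x hhalt =>
    -- No pass is spent on the successful test: its oracle call belongs to the next pass, which also
    -- decides between returning and pulling. Hence the count `looCalls + 1`.
    exact ⟨s, 0, fun _ e => e, by simpa using (Keeps.refl 45 s).effect, h, by rw [hk], hflag,
      by rw [hk]; exact hhalt⟩
  | @step k x v σ k' x' hv hhalt hσ hmin next ih =>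
    obtain ⟨s₁, x₁, y₁, e1, f1, rep1, -, h2⟩ := projBody_tick (env := env) hA hε h
      (v := v) (by rw [hk]; exact hv)
    simp only [FWStop, not_or] at hhalt
    obtain ⟨h45, hx⟩ := h2 hhalt.2
    rw [if_neg hhalt.1, ← line_search_unique hA hpsd (hε.trans (not_le.1 hhalt.1)) hσ hmin] at hx
    rw [hx.1, hx.2] at rep1
    obtain ⟨s', c, e2, f2, rep2, g1, g2, g3⟩ := ih rep1 (by rw [f1.looCalls, hk])
      (by rw [h45, hflag])
    refine ⟨s', 1 + c, fun s'' e => .while_true (by rw [h.regs.zero, hflag]; norm_num) e1 (e2 _ e),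
      ?_, rep2, g1, g2, g3⟩
    simpa using (f1.trans f2).mono le_rfl (t' := (1 + c) * (150 * n ^ 2)) (by rw [add_mul]; omega)

/-- After the Frank-Wolfe moves, one pass makes the call of the successful test and then either
clears the flag or pulls. Every pass makes exactly one call, so the time is proportional to the
calls. -/
theorem exec_projLoop (hA : A.IsHermitian) (hpsd : ∀ x, 0 ≤ normSq A x) (hε : 0 < p.ε)
    {k k' : ℕ} {x' y' : Vec n} (hloop : ProjLoop env.loo A p.ε k x y k' x' y')
    (h : Rep hn p A B x y s) (hk : s.looCalls = k) (hflag : s.reg 45 = 1) :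
    ∃ s' c, Exec env (.whileNatLt 4 45 projBody) s s' ∧
      Effect 45 (c * (150 * n ^ 2) + 1) c [] s s' ∧ Rep hn p A B x' y' s' ∧
      s'.looCalls = k' := by
  induction hloop generalizing s with
  | @ret k x y k' x' sep hle =>
    obtain ⟨s₁, c, e1, f1, rep1, g1, g2, g3⟩ := exec_sepHyperplane hA hpsd hε sep h hk hflag
    obtain ⟨s₂, x₂, y₂, e2, f2, rep2, h2, -⟩ := projBody_tick (env := env) hA hε rep1 rfl
    obtain ⟨rfl, rfl, h45⟩ := h2 hle
    have hz : s₂.reg 4 = 0 := rep2.regs.zero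
    refine ⟨s₂.tick 1, c + 1, e1 _ (.while_true (by rw [rep1.regs.zero, g2]; norm_num) e2
      (.while_false (by rw [hz, h45]; norm_num))), ?_, rep2.congr (rep2.regs.congr rfl)
      (view_tick _ _), by rw [tick_looCalls, f2.looCalls, g1]⟩
    simpa using ((f1.trans f2).trans (Keeps.tick 45 1 s₂).effect).mono le_rfl
      (t' := (c + 1) * (150 * n ^ 2) + 1) (by rw [add_mul]; omega)
  | @pull k x y k₁ x₁ k' x' y' sep hlt next ih =>
    obtain ⟨s₁, c, e1, f1, rep1, g1, g2, g3⟩ := exec_sepHyperplane hA hpsd hε sep h hk hflag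
    obtain ⟨s₂, x₂, y₂, e2, f2, rep2, -, h2⟩ := projBody_tick (env := env) hA hε rep1 rfl
    obtain ⟨h45, hx⟩ := h2 (not_le.2 hlt)
    rw [if_pos (g3.resolve_right (not_le.2 hlt))] at hx
    obtain ⟨rfl, rfl⟩ := hx
    obtain ⟨s', c', e3, f3, rep3, g4⟩ := ih rep2 (by rw [f2.looCalls, g1]) (by rw [h45, g2])
    refine ⟨s', c + 1 + c', e1 _ (.while_true (by rw [rep1.regs.zero, g2]; norm_num) e2 e3), ?_,
      rep3, g4⟩
    simpa using ((f1.trans f2).trans f3).mono le_rfl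
      (t' := (c + 1 + c') * (150 * n ^ 2) + 1) (by rw [add_mul, add_mul]; omega)

/-- The summand `1` beside `c` pays for the initial distance test, which is made even if the oracle
is never called. -/
theorem proj_spec (hA : A.IsHermitian) (hpsd : ∀ x, 0 ≤ normSq A x) (hε : 0 < p.ε)
    {k' : ℕ} {x' y' : Vec n} (hproj : ApproxProj env.loo A p.ε s.looCalls x y k' x' y')
    (h : Rep hn p A B x y s) :
    ∃ s' c, Exec env proj s s' ∧ Effect 45 ((c + 1) * (150 * n ^ 2)) c [] s s' ∧
      Rep hn p A B x' y' s' ∧ s'.looCalls = k' := by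
  have hq : 1 ≤ n ^ 2 := Nat.one_le_pow _ _ hn
  obtain ⟨s₁, e1, k1, h1, -, -, w14⟩ := residual_spec (env := env) h
    (.ifRealLe 24 22 .skip (.seq (.natConst 45 1) (.whileNatLt 4 45 projBody)))
  rcases hproj with ⟨hle, rfl, rfl, rfl⟩ | ⟨hlt, hloop⟩
  · obtain ⟨s₂, k2, r2, v2, e2⟩ := ifRealLe_true_spec (env := env) (a := 24) (b := 22) 50
      (h1.regs.at_zero hn (k := 14) (by norm_num)) (h1.regs.at_zero hn (k := 12) (by norm_num))
      (by rw [w14, h1.consts.eps_three]; exact hle) .skip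
      (.seq (.natConst 45 1) (.whileNatLt 4 45 projBody))
    have k12 := (k1.trans k2).effect
    exact ⟨s₂, 0, e1 _ (e2 _ (.skip _)), k12.mono (by norm_num) (by omega),
      h1.congr (h1.regs.congr r2) v2, k12.looCalls⟩
  · obtain ⟨s₂, k2, r2, v2, e2⟩ := ifRealLe_false_spec (env := env) (a := 24) (b := 22) 50
      (h1.regs.at_zero hn (k := 14) (by norm_num)) (h1.regs.at_zero hn (k := 12) (by norm_num))
      (by rw [w14, h1.consts.eps_three]; exact not_le.2 hlt) .skip
      (.seq (.natConst 45 1) (.whileNatLt 4 45 projBody))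
    obtain ⟨s₃, e3, k3, r3, v3⟩ := natConst_spec (env := env) (lo := 45) (i := 45) 1 le_rfl s₂
    have k13 := ((k1.trans k2).mono (lo' := 45) (by norm_num) le_rfl).trans k3
    obtain ⟨s', c, e4, f4, rep4, g4⟩ := exec_projLoop (s := s₃) hA hpsd hε hloop
      (h1.congr (k3.regs (by norm_num) (h1.regs.congr r2)) (by rw [v3, v2])) k13.looCalls
      (by rw [r3]; simp)
    refine ⟨s', c, e1 _ (e2 _ (.seq e3 e4)), ?_, rep4, g4⟩
    simpa using (k13.effect.trans f4).mono le_rfl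
      (t' := (c + 1) * (150 * n ^ 2)) (by rw [add_mul]; omega)

end Programs

end RealRAM

/-! ### One block of the algorithm, and the sequence of blocks. -/

namespace RealRAM

section Blocks

variable {n : ℕ} {env : Env n} {hn : 0 < n} {p : Params n} {A B : Mat n} {x y : Vec n}
  {s : State n}

theorem Consts.of_frame (h : Consts hn p A B (view s)) {A' B' : Mat n} {M : ℕ → Vec n}
    (hM : ∀ k < 30, M k = view s k) (hA : matOf M 30 = A') (hB : matOf M (30 + n) = B') :
    Consts hn p A' B' M := by
  constructor
  · rw [hM _ (by norm_num)]; exact h.eps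
  · rw [hM _ (by norm_num)]; exact h.eps_three
  · rw [hM _ (by norm_num)]; exact h.neg_eta
  · rw [hM _ (by norm_num)]; exact h.neg_one
  · rw [hM _ (by norm_num)]; exact h.two_thirds
  · rw [hM _ (by norm_num)]; exact h.one
  · rw [hM _ (by norm_num)]; exact h.zero
  · exact hA
  · exact hB

/-- Update the matrix and its inverse (by the Sherman-Morrison formula), and make a Newton step. -/
def newton : Cmd :=
  .seq (matvec 19 41 12) (.seq (dot 33 19 12) (.seq (.realOp .add 33 33 29)
    (.seq (.realOp .div 33 27 33) (.seq (axpy 20 32 19 33) (.seq (rankOne 41 20 19)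
      (.seq (rankOne 40 12 12) (.seq (matvec 19 41 12) (axpy 11 11 19 23))))))))

/-- Keeping the exact inverse in memory replaces a linear solve by a rank-one update, so a Newton
step costs `O(n²)`. The scalar divided by is positive because `A` is positive definite. -/
theorem newton_spec (hA : A.PosDef) (h : Rep hn p A A⁻¹ x y s) {g : Vec n} (hg : view s 2 = g) :
    ∃ s', Exec env newton s s' ∧ Keeps 50 (140 * n ^ 2) s s' ∧
      Rep hn p (A + outer g) (A + outer g)⁻¹ x
        (y - p.η • Mat.app (A + outer g)⁻¹ g) s' := by
  have hq : 1 ≤ n ^ 2 := Nat.one_le_pow _ _ hn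
  have hpos : 0 < 1 + ⟪g, Mat.app A⁻¹ g⟫_ℝ := by
    have := inner_inv_nonneg hA g
    linarith
  obtain ⟨s₁, e1, k1, r1, v1⟩ := matvec_inv_slots (env := env) (d := 9) (b := 2) hn h.regs
    (by norm_num) (by norm_num) (by norm_num)
  rw [h.consts.inv, hg] at v1
  have c1 : Consts hn p A A⁻¹ (view s₁) := v1 ▸ h.consts.update (by norm_num) _
  set w := Mat.app A⁻¹ g with hw
  have a1 : ∀ k, k ≠ 9 → view s₁ k = view s k := fun k hk => by
    rw [v1, Function.update_of_ne hk]
  have a1' : view s₁ 9 = w := by rw [v1, Function.update_self]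
  obtain ⟨s₂, e2, k2, r2, v2⟩ := dot_slots (env := env) (d := 23) (a := 9) (b := 2) hn r1
    (by norm_num) (by norm_num) (by norm_num) (by norm_num) (by norm_num)
  rw [a1', a1 2 (by norm_num), hg, real_inner_comm] at v2
  have c2 : Consts hn p A A⁻¹ (view s₂) := v2 ▸ c1.setCell (by norm_num) _ _
  obtain ⟨s₃, e3, k3, r3, v3⟩ := realOp_spec (env := env) (op := .add) (d := 33) (a := 33) (b := 29)
    50 (r2.at_zero hn (k := 23) (by norm_num)) (r2.at_zero hn (k := 23) (by norm_num))
    (r2.at_zero hn (k := 19) (by norm_num)) (by simp)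
  rw [c2.one, v2, setCell_self, ← v2] at v3
  have c3 : Consts hn p A A⁻¹ (view s₃) := v3 ▸ c2.setCell (by norm_num) _ _
  have r3' := r2.congr r3
  have a3 : view s₃ 23 ⟨0, hn⟩ = 1 + ⟪g, w⟫_ℝ := by
    rw [v3, setCell_self]; exact add_comm _ _
  obtain ⟨s₄, e4, k4, r4, v4⟩ := realOp_spec (env := env) (op := .div) (d := 33) (a := 27) (b := 33)
    50 (r3'.at_zero hn (k := 23) (by norm_num)) (r3'.at_zero hn (k := 17) (by norm_num))
    (r3'.at_zero hn (k := 23) (by norm_num)) (by rw [a3]; exact fun _ => hpos.ne')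
  rw [c3.neg_one, a3] at v4
  have c4 : Consts hn p A A⁻¹ (view s₄) := v4 ▸ c3.setCell (by norm_num) _ _
  have r4' := r3'.congr r4
  have a4 : ∀ k, k ≠ 23 → view s₄ k = view s₁ k := fun k hk => by
    rw [v4, setCell_of_ne _ _ _ hk, v3, setCell_of_ne _ _ _ hk, v2, setCell_of_ne _ _ _ hk]
  have a4' : view s₄ 23 ⟨0, hn⟩ = -1 / (1 + ⟪g, w⟫_ℝ) := by rw [v4, setCell_self]; rfl
  -- Adding to the zero vector in slot `22` produces `-w / (1 + s)`. Its outer product with `w` is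
  -- the Sherman-Morrison correction.
  obtain ⟨s₅, e5, k5, r5, v5⟩ := axpy_slots (env := env) (d := 10) (a := 22) (b := 9) (k := 23) hn
    r4' (by norm_num) (by norm_num) (by norm_num) (by norm_num) (by norm_num)
  rw [c4.zero, a4', zero_add, a4 9 (by norm_num), a1'] at v5
  have c5 : Consts hn p A A⁻¹ (view s₅) := v5 ▸ c4.update (by norm_num) _
  have a5 : ∀ k, k ≠ 10 → k ≠ 23 → k ≠ 9 → view s₅ k = view s k := fun k h10 h23 h9 => by
    rw [v5, Function.update_of_ne h10, a4 k h23, a1 k h9]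
  have a5' : view s₅ 9 = w := by
    rw [v5, Function.update_of_ne (by norm_num), a4 9 (by norm_num), a1']
  have a5'' : view s₅ 10 = (-1 / (1 + ⟪g, w⟫_ℝ)) • w := by rw [v5, Function.update_self]
  obtain ⟨s₆, e6, k6, m6, f6⟩ := rankOne_spec (env := env) (rM := 41) (ru := 20) (rv := 19)
    (kM := 30 + n) r5 (by norm_num) (by norm_num) (by norm_num) (r5.atSlot (k := 10) (by norm_num))
    r5.inv (r5.atSlot (k := 9) (by norm_num)) (by omega) (by omega) (by norm_num) (by norm_num)
  have r6 := k6.regs (by norm_num) r5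
  have hinv : matOf (view s₆) (30 + n) = (A + outer g)⁻¹ := by
    rw [m6, c5.inv, a5', a5'', inv_add_outer hA g hpos.ne', ← hw, outer, WithLp.ofLp_smul,
      Matrix.smul_vecMulVec, sub_eq_add_neg, ← neg_smul, neg_div]
  have hmat6 : matOf (view s₆) 30 = A := by
    rw [← c5.mat]
    exact matOf_congr fun i => f6 _ fun j => by have := i.2; omega
  have a6 : ∀ k < 30, view s₆ k = view s₅ k := fun k hk => f6 k fun i => by omega
  obtain ⟨s₇, e7, k7, m7, f7⟩ := rankOne_spec (env := env) (rM := 40) (ru := 12) (rv := 12)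
    (kM := 30) r6 (by norm_num) (by norm_num) (by norm_num) (r6.atSlot (k := 2) (by norm_num))
    (r6.slot 30 le_rfl) (r6.atSlot (k := 2) (by norm_num)) (by omega) (by omega) (by norm_num)
    (by norm_num)
  have r7 := k7.regs (by norm_num) r6
  have a7 : ∀ k < 30, view s₇ k = view s₅ k := fun k hk =>
    (f7 k fun i => by omega).trans (a6 k hk)
  have hmat7 : matOf (view s₇) 30 = A + outer g := by
    rw [m7, hmat6, a6 2 (by norm_num), a5 2 (by norm_num) (by norm_num) (by norm_num), hg, outer]
  have hinv7 : matOf (view s₇) (30 + n) = (A + outer g)⁻¹ := by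
    rw [← hinv]
    exact matOf_congr fun i => f7 _ fun j => by have := j.2; omega
  have c7 : Consts hn p (A + outer g) (A + outer g)⁻¹ (view s₇) := c5.of_frame a7 hmat7 hinv7
  obtain ⟨s₈, e8, k8, r8, v8⟩ := matvec_inv_slots (env := env) (d := 9) (b := 2) hn r7
    (by norm_num) (by norm_num) (by norm_num)
  rw [c7.inv, a7 2 (by norm_num), a5 2 (by norm_num) (by norm_num) (by norm_num), hg] at v8
  have c8 : Consts hn p (A + outer g) (A + outer g)⁻¹ (view s₈) := v8 ▸ c7.update (by norm_num) _
  have a8 : ∀ k < 9, view s₈ k = view s k := fun k hk => by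
    rw [v8, Function.update_of_ne (by omega), a7 k (by omega),
      a5 k (by omega) (by omega) (by omega)]
  obtain ⟨s₉, e9, k9, r9, v9⟩ := axpy_slots (env := env) (d := 1) (a := 1) (b := 9) (k := 13) hn
    r8 (by norm_num) (by norm_num) (by norm_num) (by norm_num) (by norm_num)
  rw [c8.neg_eta, a8 1 (by norm_num), h.y_eq] at v9
  refine ⟨s₉, .seq e1 (.seq e2 (.seq e3 (.seq e4 (.seq e5 (.seq e6 (.seq e7 (.seq e8 e9))))))),
    (k1.trans (k2.trans (k3.trans (k4.trans (k5.trans (k6.trans (k7.trans (k8.trans k9)))))))).mono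
      le_rfl (by omega), r9, v9 ▸ c8.update (by norm_num) _, ?_, ?_⟩
  · rw [v9, Function.update_of_ne (by norm_num), a8 0 (by norm_num), h.x_eq]
  · rw [v9, Function.update_self, v8, Function.update_self, neg_smul, ← sub_eq_add_neg]

/-- Play the rounds of a block, and add up the gradients. -/
def rounds : Cmd :=
  .seq (.natAdd 43 42 2) (.whileNatLt 42 43
    (.seq (.play 10) (.seq (.grad 13 11) (.seq (axpy 12 12 13 29) (.natAdd 42 42 3)))))

theorem rounds_spec (h : Rep hn p A B x y s) (hG : view s 2 = 0) {t K : ℕ} (ht : s.reg 42 = t)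
    (hplays : s.plays.length = t) (hK : s.reg 2 = K) (hy : y ∈ env.dom) :
    ∃ s', Exec env rounds s s' ∧
      Effect 42 (K * (18 * n ^ 2) + 2) 0 (List.replicate K x) s s' ∧ Rep hn p A B x y s' ∧
      view s' 2 = ∑ i ∈ Finset.range K, env.grad (t + i) y ∧ s'.reg 42 = t + K := by
  obtain ⟨s₀, e0, k0, r0, v0⟩ := natAdd_spec (env := env) (lo := 43) (i := 43) 42 2 le_rfl s
  let Inv : ℕ → State n → Prop := fun k s' =>
    Effect 42 (k * (18 * n ^ 2)) 0 (List.replicate k x) s₀ s' ∧ Rep hn p A B x y s' ∧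
      view s' 2 = ∑ i ∈ Finset.range k, env.grad (t + i) y ∧ s'.reg 42 = t + k ∧
      s'.reg 43 = t + K
  have hstep : ∀ k < K, ∀ s₁, Inv k s₁ → s₁.reg 42 < s₁.reg 43 ∧ ∃ s', Exec env
      (.seq (.play 10) (.seq (.grad 13 11) (.seq (axpy 12 12 13 29) (.natAdd 42 42 3))))
      (s₁.tick 1) s' ∧ Inv (k + 1) s' := by
    rintro k hk s₁ ⟨f, rep, hsum, h42, h43⟩
    refine ⟨by rw [h42, h43]; omega, ?_⟩
    have hr1 : Regs (s₁.tick 1) := rep.regs.congr rfl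
    obtain ⟨s₂, e2, f2, r2, v2⟩ := play_spec (env := env) (a := 10) 50
      (hr1.atSlot (k := 0) (by norm_num))
    rw [view_tick] at v2 f2
    rw [rep.x_eq] at f2
    have hr2 := hr1.congr r2
    have hlen : s₂.plays.length = t + k + 1 := by
      rw [f2.plays, tick_plays, f.plays, k0.plays]
      simp [hplays]
      omega
    obtain ⟨s₃, e3, k3, r3, v3⟩ := grad_spec (env := env) (d := 13) (a := 11) 50
      (hr2.atSlot (k := 3) (by norm_num)) (hr2.atSlot (k := 1) (by norm_num))
      (by rintro hc; rw [hc] at hlen; simp at hlen) (by rw [v2, rep.y_eq]; exact hy)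
    -- The point has just been played, so the loss revealed last is that of round `t + k`, one less
    -- than the number of plays.
    rw [v2, rep.y_eq, hlen, Nat.add_sub_cancel] at v3
    have hr3 := hr2.congr r3
    have c3 : Consts hn p A B (view s₃) := v3 ▸ rep.consts.update (by norm_num) _
    obtain ⟨s₄, e4, k4, r4, v4⟩ := axpy_slots (env := env) (d := 2) (a := 2) (b := 3) (k := 19) hn
      hr3 (by norm_num) (by norm_num) (by norm_num) (by norm_num) (by norm_num)
    rw [c3.one, one_smul] at v4
    have c4 : Consts hn p A B (view s₄) := v4 ▸ c3.update (by norm_num) _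
    obtain ⟨s₅, e5, k5, r5, v5⟩ := natAdd_spec (env := env) (lo := 42) (i := 42) 42 3 le_rfl s₄
    have a4 : ∀ k, k ≠ 2 → k ≠ 3 → view s₄ k = view s₁ k := fun k h2 h3 => by
      rw [v4, Function.update_of_ne h2, v3, Function.update_of_ne h3]
    have k24 := ((Keeps.tick 50 1 s₁).effect.trans f2).trans (k3.trans k4).effect
    refine ⟨s₅, .seq e2 (.seq e3 (.seq e4 e5)), ?_, ⟨k5.regs le_rfl r4, v5 ▸ c4, ?_, ?_⟩, ?_, ?_, ?_⟩
    · have := f.trans ((k24.mono (lo' := 42) (by norm_num) le_rfl).trans k5.effect)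
      rw [List.replicate_succ', Nat.succ_mul]
      exact this.mono le_rfl (by nlinarith)
    · rw [v5, a4 0 (by norm_num) (by norm_num), rep.x_eq]
    · rw [v5, a4 1 (by norm_num) (by norm_num), rep.y_eq]
    · rw [v5, v4, Function.update_self, v3, Function.update_self,
        Function.update_of_ne (by norm_num), hsum, Finset.sum_range_succ]
    · rw [r5, Function.update_self, r4.one, k24.reg 42 (by norm_num), h42, add_assoc]
    · rw [r5, Function.update_of_ne (by norm_num), k24.reg 43 (by norm_num), h43]
  have hr0 : Regs s₀ := k0.regs (by norm_num) h.regs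
  obtain ⟨s', e', f', rep', hsum', h42', -⟩ := while_spec (env := env) Inv K hstep
    (fun s₁ ⟨_, _, _, h42, h43⟩ => by rw [h42, h43]; exact lt_irrefl _)
    (s := s₀) ⟨by simpa using (Keeps.refl 42 s₀).effect, h.congr hr0 v0, by rw [v0, hG]; simp,
      by rw [r0, Function.update_of_ne (by norm_num), ht, add_zero],
      by rw [r0, Function.update_self, ht, hK]⟩
  refine ⟨s'.tick 1, .seq e0 e', ?_, rep'.congr (rep'.regs.congr rfl) (view_tick _ _), ?_, h42'⟩
  · simpa using ((k0.mono (lo' := 42) (by norm_num) le_rfl).effect.trans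
      (f'.trans (Keeps.tick 42 1 s').effect)).mono le_rfl (t' := K * (18 * n ^ 2) + 2) (by omega)
  · rw [view_tick, hsum']

/-- One block of the algorithm. -/
def block : Cmd :=
  .seq (axpy 12 12 12 27) (.seq rounds (.seq newton proj))

theorem block_spec (hA : A.PosDef) (hε : 0 < p.ε) (h : Rep hn p A A⁻¹ x y s) {t K : ℕ}
    (ht : s.reg 42 = t) (hplays : s.plays.length = t) (hK : s.reg 2 = K) (hy : y ∈ env.dom)
    {g : Vec n} (hg : ∑ i ∈ Finset.range K, env.grad (t + i) y = g) {A' : Mat n}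
    (hA' : A' = A + outer g) (hherm : A'.IsHermitian) (hpsd : ∀ x, 0 ≤ normSq A' x)
    {k' : ℕ} {x' y' : Vec n}
    (hproj : ApproxProj env.loo A' p.ε s.looCalls x (y - p.η • Mat.app A'⁻¹ g) k' x' y') :
    ∃ s' c, Exec env block s s' ∧
      Effect 42 (K * (18 * n ^ 2) + c * (150 * n ^ 2) + 400 * n ^ 2) c (List.replicate K x) s s' ∧
      Rep hn p A' A'⁻¹ x' y' s' ∧ s'.reg 42 = t + K ∧ s'.looCalls = k' := by
  have hq : 1 ≤ n ^ 2 := Nat.one_le_pow _ _ hn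
  -- The accumulator for the block gradient is cleared by subtracting it from itself.
  obtain ⟨s₁, e1, k1, r1, v1⟩ := axpy_slots (env := env) (d := 2) (a := 2) (b := 2) (k := 17) hn
    h.regs (by norm_num) (by norm_num) (by norm_num) (by norm_num) (by norm_num)
  rw [h.consts.neg_one, neg_one_smul, add_neg_cancel] at v1
  have rep1 : Rep hn p A A⁻¹ x y s₁ := ⟨r1, v1 ▸ h.consts.update (by norm_num) _,
    by rw [v1, Function.update_of_ne (by norm_num), h.x_eq],
    by rw [v1, Function.update_of_ne (by norm_num), h.y_eq]⟩
  obtain ⟨s₂, e2, f2, rep2, g2, h42⟩ := rounds_spec (env := env) rep1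
    (by rw [v1, Function.update_self]) (by rw [k1.reg 42 (by norm_num), ht])
    (by rw [k1.plays, hplays]) (by rw [k1.reg 2 (by norm_num), hK]) hy
  obtain ⟨s₃, e3, k3, rep3⟩ := newton_spec (env := env) hA rep2 (g2.trans hg)
  rw [← hA'] at rep3
  have hcalls : s₃.looCalls = s.looCalls := by
    rw [k3.looCalls, f2.looCalls, k1.looCalls, add_zero]
  rw [← hcalls] at hproj
  obtain ⟨s₄, c, e4, f4, rep4, g4⟩ := proj_spec hherm hpsd hε hproj rep3
  refine ⟨s₄, c, .seq e1 (.seq e2 (.seq e3 e4)), ?_, rep4, ?_, g4⟩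
  · have := (k1.effect.mono (lo' := 42) (by norm_num) le_rfl).trans (f2.trans
      ((k3.effect.mono (lo' := 42) (by norm_num) le_rfl).trans
        (f4.mono (lo' := 42) (by norm_num) le_rfl)))
    simpa using this.mono le_rfl (t' := K * (18 * n ^ 2) + c * (150 * n ^ 2) + 400 * n ^ 2)
      (by rw [add_mul]; omega)
  · rw [f4.reg 42 (by norm_num), k3.reg 42 (by norm_num), h42]

theorem map_played_range_succ (r : Run n) {K : ℕ} (hK : 0 < K) (m : ℕ) :
    (List.range ((m + 1) * K)).map (r.played K) =
      (List.range (m * K)).map (r.played K) ++ List.replicate K (r.x m) := by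
  rw [Nat.succ_mul, List.range_add, List.map_append, List.map_map]
  congr 1
  refine List.eq_replicate_iff.2 ⟨by simp, fun b hb => ?_⟩
  obtain ⟨i, hi, rfl⟩ := List.mem_map.1 hb
  rw [List.mem_range] at hi
  simp only [Function.comp, Run.played]
  rw [mul_comm, Nat.mul_add_div hK, Nat.div_eq_of_lt hi, add_zero]

/-- The blocks of the algorithm, one after the other. -/
def blocks : Cmd := .whileNatLt 42 1 block

theorem blocks_spec {r : Run n} (hr : IsRun env.grad env.loo p r) (hεI : 0 < p.εI) (hε : 0 < p.ε)
    (hK : 0 < p.K) (hKT : p.K ∣ p.T) (hy : ∀ m < p.T / p.K, r.y m ∈ env.dom)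
    (h : Rep hn p (p.εI • 1) (p.εI • 1)⁻¹ p.x₁ p.x₁ s) (h1 : s.reg 1 = p.T) (h2 : s.reg 2 = p.K)
    (h42 : s.reg 42 = 0) (hplays : s.plays = []) (hcalls : s.looCalls = 0) :
    ∃ s', Exec env blocks s s' ∧ s'.plays = (List.range p.T).map (r.played p.K) ∧
      s'.looCalls = r.calls (p.T / p.K) ∧
      s'.time ≤ s.time + (p.T * (18 * n ^ 2) + (r.calls (p.T / p.K) + 3 * (p.T / p.K)) * (150 * n ^ 2)
        + 1) ∧
      s'.space ≤ max s.space (memBound n) := by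
  let Inv : ℕ → State n → Prop := fun m s' =>
    Effect 42 ((m * p.K) * (18 * n ^ 2) + (r.calls m + 3 * m) * (150 * n ^ 2)) (r.calls m)
      ((List.range (m * p.K)).map (r.played p.K)) s s' ∧
      Rep hn p (r.A m) (r.A m)⁻¹ (r.x m) (r.y m) s' ∧ s'.reg 42 = m * p.K
  have hTK : p.T / p.K * p.K = p.T := Nat.div_mul_cancel hKT
  have hstep : ∀ m < p.T / p.K, ∀ s₁, Inv m s₁ → s₁.reg 42 < s₁.reg 1 ∧ ∃ s', Exec env block
      (s₁.tick 1) s' ∧ Inv (m + 1) s' := by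
    rintro m hm s₁ ⟨f, rep, h42'⟩
    have hlt : m * p.K < p.T := by
      rw [← hTK]; exact Nat.mul_lt_mul_of_pos_right hm hK
    refine ⟨by rw [h42', f.reg 1 (by norm_num), h1]; exact hlt, ?_⟩
    have hc : s₁.looCalls = r.calls m := by rw [f.looCalls, hcalls, zero_add]
    obtain ⟨s', c, e, f', rep', g42, gc⟩ := block_spec (env := env) (s := s₁.tick 1)
      (hr.A_posDef hεI hm.le) hε (rep.congr (rep.regs.congr rfl) (view_tick _ _)) h42'
      (by rw [tick_plays, f.plays, hplays]; simp) ((f.reg 2 (by norm_num)).trans h2) (hy m hm) rfl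
      (hr.A_succ m hm) (hr.A_isHermitian (Nat.succ_le_of_lt hm))
      (hr.normSq_A_nonneg hεI (Nat.succ_le_of_lt hm))
      (by rw [tick_looCalls, hc]; exact hr.proj m hm)
    have hcc : r.calls (m + 1) = r.calls m + c := by
      rw [← gc, f'.looCalls, tick_looCalls, hc]
    refine ⟨s', e, ?_, rep', by rw [g42, Nat.succ_mul]⟩
    rw [map_played_range_succ r hK, hcc]
    have hq : 1 ≤ n ^ 2 := Nat.one_le_pow _ _ hn
    have := f.trans ((Keeps.tick 42 1 s₁).effect.trans f')
    rw [zero_add, List.nil_append] at this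
    -- The fixed cost `400 n²` of a block and its loop test fit into `3 · 150 n²`.
    exact this.mono le_rfl (by nlinarith)
  obtain ⟨s', e', f', -, -⟩ := while_spec (env := env) Inv (p.T / p.K) hstep
    (fun s₁ ⟨f, _, h42'⟩ => by
      rw [h42', f.reg 1 (by norm_num), h1, hTK]; exact lt_irrefl _)
    (s := s) ⟨by simpa [hr.calls_zero] using (Keeps.refl 42 s).effect, by
      rw [hr.A_zero, hr.x_zero, hr.y_zero]; exact h, by rw [h42, zero_mul]⟩
  rw [hTK] at f'
  refine ⟨s'.tick 1, e', ?_, ?_, ?_, f'.space⟩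
  · rw [tick_plays, f'.plays, hplays, List.nil_append]
  · rw [tick_looCalls, f'.looCalls, hcalls, zero_add]
  · rw [tick_time]; have := f'.time; omega

end Blocks

end RealRAM

/-! ### Initialisation of the registers and the memory. -/

namespace RealRAM

section Setup

variable {n : ℕ} {env : Env n} {hn : 0 < n} {p : Params n} {s : State n}

/-- Store the addresses of the slots `0, …, k`. -/
def slotRegs : ℕ → Cmd
  | 0 => .natConst 10 3
  | k + 1 => .seq (slotRegs k) (.natAdd (10 + (k + 1)) (10 + k) 0)

theorem slotRegs_spec (h0 : s.reg 0 = n) (k : ℕ) :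
    ∃ ρ, Exec env (slotRegs k) s { s with reg := ρ, time := s.time + (k + 1) } ∧
      (∀ j ≤ k, ρ (10 + j) = 3 + j * n) ∧ ∀ j, j < 10 ∨ 10 + k < j → ρ j = s.reg j := by
  induction k with
  | zero =>
    refine ⟨_, .natConst 10 3 s, fun j hj => ?_, fun j hj => ?_⟩
    · obtain rfl : j = 0 := by omega
      simp
    · rw [setReg_reg, Function.update_of_ne (by omega)]
  | succ k ih =>
    obtain ⟨ρ, e, h1, h2⟩ := ih
    refine ⟨_, .seq e (.natAdd _ _ _ _), fun j hj => ?_, fun j hj => ?_⟩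
    · simp only [setReg_reg]
      rcases Nat.lt_or_ge k j with hlt | hge
      · obtain rfl : j = k + 1 := by omega
        rw [Function.update_self, h1 k le_rfl, h2 0 (by omega), h0]
        ring
      · rw [Function.update_of_ne (by omega), h1 j hge]
    · simp only [setReg_reg]
      rw [Function.update_of_ne (by omega), h2 j (by omega)]

/-- Initialize the registers. -/
def setupRegs : Cmd :=
  .seq (.natConst 3 1) (.seq (slotRegs 30) (.seq (.natAdd 41 40 4) (.seq (.natConst 50 0)
    (.whileNatLt 50 0 (.seq (.natAdd 41 41 0) (.natAdd 50 50 3))))))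

/-- Integer registers can only be added and subtracted, so the address of the inverse matrix, which
involves `n²`, is reached by `n` additions of `n`. -/
theorem setupRegs_spec (h0 : s.reg 0 = n) (h4 : s.reg 4 = 0) :
    ∃ ρ t, Exec env setupRegs s { s with reg := ρ, time := s.time + t } ∧ t ≤ 40 + 3 * n ∧
      Regs { s with reg := ρ, time := s.time + t } ∧ ρ 1 = s.reg 1 ∧ ρ 2 = s.reg 2 ∧
      ρ 42 = s.reg 42 := by
  obtain ⟨ρ, e, h1, h2⟩ := slotRegs_spec (env := env) (s := (s.setReg 3 1).tick 1) (by simpa) 30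
  have hb : ∀ j, j < 10 ∨ 40 < j → j ≠ 3 → ρ j = s.reg j := fun j hj h3 => by
    rw [h2 j (by omega), tick_reg, setReg_reg, Function.update_of_ne h3]
  have h3 : ρ 3 = 1 := by rw [h2 3 (by omega)]; simp
  let ρ₀ : ℕ → ℕ := Function.update (Function.update ρ 41 (ρ 40 + ρ 4)) 50 0
  let s₀ : State n := { s with reg := ρ₀, time := s.time + 34 }
  let Inv : ℕ → State n → Prop := fun k s' =>
    ∃ ρ', s' = { s₀ with reg := ρ', time := s₀.time + k * 3 } ∧ ρ' 41 = 3 + (30 + k) * n ∧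
      ρ' 50 = k ∧ ∀ j, j ≠ 41 → j ≠ 50 → ρ' j = ρ j
  have hstep : ∀ k < n, ∀ s₁, Inv k s₁ → s₁.reg 50 < s₁.reg 0 ∧ ∃ s',
      Exec env (.seq (.natAdd 41 41 0) (.natAdd 50 50 3)) (s₁.tick 1) s' ∧ Inv (k + 1) s' := by
    rintro k hk s₁ ⟨ρ', rfl, g1, g2, g3⟩
    have g0 : ρ' 0 = n := by rw [g3 0 (by norm_num) (by norm_num), hb 0 (by omega) (by norm_num), h0]
    refine ⟨by simpa [g2, g0] using hk, _, .seq (.natAdd _ _ _ _) (.natAdd _ _ _ _),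
      Function.update (Function.update ρ' 41 (ρ' 41 + ρ' 0)) 50 (ρ' 50 + ρ' 3), ?_, ?_, ?_, ?_⟩
    · simp only [State.tick, State.setReg]
      congr 1
      ring
    · rw [Function.update_of_ne (by norm_num), Function.update_self, g1, g0]; ring
    · rw [Function.update_self, g2, g3 3 (by norm_num) (by norm_num), h3]
    · intro j hj hj'
      rw [Function.update_of_ne hj', Function.update_of_ne hj, g3 j hj hj']
  have h40 : ρ 40 = 3 + 30 * n := h1 30 le_rfl
  have hρ4 : ρ 4 = 0 := by rw [hb 4 (by omega) (by norm_num), h4]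
  have hρ0 : ρ 0 = n := by rw [hb 0 (by omega) (by norm_num), h0]
  obtain ⟨_, e', ρ', rfl, g1, -, g3⟩ := while_spec (env := env) Inv n hstep
    (by
      rintro _ ⟨ρ', rfl, -, g2, g3⟩
      simp [g2, g3 0 (by norm_num) (by norm_num), hρ0])
    (s := s₀) ⟨ρ₀, rfl, by simp [ρ₀, h40, hρ4], by simp [ρ₀], fun j hj hj' => by
      simp only [ρ₀]; rw [Function.update_of_ne hj', Function.update_of_ne hj]⟩
  refine ⟨ρ', 35 + n * 3, .seq (.natConst _ _ _) (.seq e (.seq (.natAdd _ _ _ _)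
    (.seq (.natConst _ _ _) ?_))), by omega, ⟨?_, ?_, ?_, fun k hk => ?_, g1⟩, ?_, ?_, ?_⟩
  · rw [show s.time + (35 + n * 3) = s.time + 34 + n * 3 + 1 by omega]
    exact e'
  · exact (g3 0 (by norm_num) (by norm_num)).trans hρ0
  · exact (g3 3 (by norm_num) (by norm_num)).trans h3
  · exact (g3 4 (by norm_num) (by norm_num)).trans hρ4
  · exact (g3 (10 + k) (by omega) (by omega)).trans (h1 k hk)
  · rw [g3 1 (by norm_num) (by norm_num), hb 1 (by omega) (by norm_num)]
  · rw [g3 2 (by norm_num) (by norm_num), hb 2 (by omega) (by norm_num)]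
  · rw [g3 42 (by norm_num) (by norm_num), hb 42 (by omega) (by norm_num)]

/-- Copying from the cells that hold the parameters. -/
theorem copyParam_spec {d a k : ℕ} {i : Fin n} (lo : ℕ) {s : State n} (hd : At (s.reg d) k i)
    (ha : s.reg a < 3) :
    ∃ s', Exec env (.realCopy d a) s s' ∧ Keeps lo 1 s s' ∧ s'.reg = s.reg ∧
      view s' = setCell (view s) k i (s.mem (s.reg a)) ∧ ∀ j < 3, s'.mem j = s.mem j := by
  have hle : s.reg a + 1 ≤ memBound n := by rw [memBound]; omega
  refine ⟨_, .realCopy d a s, ⟨rfl, rfl, fun _ _ => rfl, le_rfl,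
    max_le (max_le_max le_rfl hd.le) (le_max_of_le_right hle)⟩, rfl, view_update hd rfl, ?_⟩
  intro j hj
  have := hd.addr
  simp only [tick_mem, touch_mem, setMem_mem]
  rw [Function.update_of_ne (by omega)]

/-- Compute the constants. -/
def setupScalars : Cmd :=
  .seq (.natConst 50 2) (.seq (.realCopy 30 3) (.seq (.realCopy 21 50) (.seq (.realCopy 23 4)
    (.seq (.realConst 27 (-1)) (.seq (.realConst 28 (2 / 3)) (.seq (.realConst 29 1)
      (.seq (.realOp .mul 23 23 27) (.seq (.realOp .add 22 21 21) (.seq (.realOp .add 22 22 21)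
        (.realOp .div 31 29 30))))))))))

theorem setupScalars_spec (hn : 0 < n) (hr : Regs s) (hη : s.mem 0 = p.η) (hεI : s.mem 1 = p.εI)
    (hε : s.mem 2 = p.ε) (hpos : 0 < p.εI) :
    ∃ s', Exec env setupScalars s s' ∧ Keeps 50 11 s s' ∧ Regs s' ∧
      view s' 11 ⟨0, hn⟩ = p.ε ∧ view s' 12 ⟨0, hn⟩ = 3 * p.ε ∧ view s' 13 ⟨0, hn⟩ = -p.η ∧
      view s' 17 ⟨0, hn⟩ = -1 ∧ view s' 18 ⟨0, hn⟩ = 2 / 3 ∧ view s' 19 ⟨0, hn⟩ = 1 ∧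
      view s' 20 ⟨0, hn⟩ = p.εI ∧ view s' 21 ⟨0, hn⟩ = 1 / p.εI ∧
      ∀ k, k < 11 ∨ 21 < k → view s' k = view s k := by
  obtain ⟨s₀, e0, k0, r0, v0⟩ := natConst_spec (env := env) (lo := 50) (i := 50) 2 le_rfl s
  have m0 : s₀.mem = s.mem := by cases e0; rfl
  have q0 : Regs s₀ := k0.regs (by norm_num) hr
  have h50 : s₀.reg 50 = 2 := by rw [r0, Function.update_self]
  obtain ⟨s₁, e1, k1, r1, v1, m1⟩ := copyParam_spec (env := env) (d := 30) (a := 3) 50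
    (q0.at_zero hn (k := 20) (by norm_num)) (by rw [q0.one]; norm_num)
  rw [v0, q0.one, m0, hεI] at v1
  have q1 := q0.congr r1
  obtain ⟨s₂, e2, k2, r2, v2, m2⟩ := copyParam_spec (env := env) (d := 21) (a := 50) 50
    (q1.at_zero hn (k := 11) (by norm_num)) (by rw [r1, h50]; norm_num)
  rw [v1, r1, h50, m1 2 (by norm_num), m0, hε] at v2
  have q2 := q1.congr r2
  obtain ⟨s₃, e3, k3, r3, v3, -⟩ := copyParam_spec (env := env) (d := 23) (a := 4) 50
    (q2.at_zero hn (k := 13) (by norm_num)) (by rw [q2.zero]; norm_num)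
  rw [v2, q2.zero, m2 0 (by norm_num), m1 0 (by norm_num), m0, hη] at v3
  have q3 := q2.congr r3
  obtain ⟨s₄, e4, k4, r4, v4⟩ := realConst_spec (env := env) (d := 27) 50 (-1)
    (q3.at_zero hn (k := 17) (by norm_num))
  have q4 := q3.congr r4
  obtain ⟨s₅, e5, k5, r5, v5⟩ := realConst_spec (env := env) (d := 28) 50 (2 / 3)
    (q4.at_zero hn (k := 18) (by norm_num))
  have q5 := q4.congr r5
  obtain ⟨s₆, e6, k6, r6, v6⟩ := realConst_spec (env := env) (d := 29) 50 1
    (q5.at_zero hn (k := 19) (by norm_num))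
  have q6 := q5.congr r6
  rw [v5, v4, v3] at v6
  have w6 : view s₆ 17 ⟨0, hn⟩ = -1 ∧ view s₆ 18 ⟨0, hn⟩ = 2 / 3 ∧ view s₆ 19 ⟨0, hn⟩ = 1 ∧
      view s₆ 20 ⟨0, hn⟩ = p.εI ∧ view s₆ 11 ⟨0, hn⟩ = p.ε ∧ view s₆ 13 ⟨0, hn⟩ = p.η ∧
      ∀ k, k < 11 ∨ 21 < k → view s₆ k = view s k := by
    rw [v6]
    refine ⟨?_, ?_, ?_, ?_, ?_, ?_, fun k hk => ?_⟩
    · simp [setCell]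
    · simp [setCell]
    · simp [setCell]
    · simp [setCell]
    · simp [setCell]
    · simp [setCell]
    · iterate 6 rw [setCell_of_ne _ _ _ (by omega)]
  obtain ⟨w17, w18, w19, w20, w11, w13, wf⟩ := w6
  obtain ⟨s₇, e7, k7, r7, v7⟩ := realOp_spec (env := env) (op := .mul) (d := 23) (a := 23) (b := 27)
    50 (q6.at_zero hn (k := 13) (by norm_num)) (q6.at_zero hn (k := 13) (by norm_num))
    (q6.at_zero hn (k := 17) (by norm_num)) (by simp)
  rw [w13, w17] at v7
  have q7 := q6.congr r7
  obtain ⟨s₈, e8, k8, r8, v8⟩ := realOp_spec (env := env) (op := .add) (d := 22) (a := 21) (b := 21)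
    50 (q7.at_zero hn (k := 12) (by norm_num)) (q7.at_zero hn (k := 11) (by norm_num))
    (q7.at_zero hn (k := 11) (by norm_num)) (by simp)
  have q8 := q7.congr r8
  obtain ⟨s₉, e9, k9, r9, v9⟩ := realOp_spec (env := env) (op := .add) (d := 22) (a := 22) (b := 21)
    50 (q8.at_zero hn (k := 12) (by norm_num)) (q8.at_zero hn (k := 12) (by norm_num))
    (q8.at_zero hn (k := 11) (by norm_num)) (by simp)
  have q9 := q8.congr r9
  have a9 : ∀ k, k ≠ 12 → k ≠ 13 → view s₉ k = view s₆ k := fun k h12 h13 => by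
    rw [v9, setCell_of_ne _ _ _ h12, v8, setCell_of_ne _ _ _ h12, v7, setCell_of_ne _ _ _ h13]
  have a9' : view s₉ 12 ⟨0, hn⟩ = 3 * p.ε := by
    have h7 : view s₇ 11 ⟨0, hn⟩ = p.ε := by rw [v7, setCell_of_ne _ _ _ (by norm_num), w11]
    rw [v9, setCell_self, v8, setCell_self, setCell_of_ne _ _ _ (by norm_num), h7]
    simp only [ArithOp.eval]
    ring
  have a9'' : view s₉ 13 ⟨0, hn⟩ = -p.η := by
    rw [v9, setCell_of_ne _ _ _ (by norm_num), v8, setCell_of_ne _ _ _ (by norm_num), v7,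
      setCell_self]
    simp [ArithOp.eval]
  obtain ⟨s', e', k', r', v'⟩ := realOp_spec (env := env) (op := .div) (d := 31) (a := 29) (b := 30)
    50 (q9.at_zero hn (k := 21) (by norm_num)) (q9.at_zero hn (k := 19) (by norm_num))
    (q9.at_zero hn (k := 20) (by norm_num)) (by
      rw [a9 20 (by norm_num) (by norm_num), w20]; exact fun _ => hpos.ne')
  have a' : ∀ k, k ≠ 12 → k ≠ 13 → k ≠ 21 → view s' k = view s₆ k := fun k h12 h13 h21 => by
    rw [v', setCell_of_ne _ _ _ h21, a9 k h12 h13]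
  refine ⟨s', .seq e0 (.seq e1 (.seq e2 (.seq e3 (.seq e4 (.seq e5 (.seq e6 (.seq e7 (.seq e8
    (.seq e9 e'))))))))), (k0.trans (k1.trans (k2.trans (k3.trans (k4.trans (k5.trans (k6.trans
      (k7.trans (k8.trans (k9.trans k')))))))))).mono le_rfl (by norm_num), q9.congr r',
    ?_, ?_, ?_, ?_, ?_, ?_, ?_, ?_, fun k hk => ?_⟩
  · rw [a' 11 (by norm_num) (by norm_num) (by norm_num), w11]
  · rw [v', setCell_of_ne _ _ _ (by norm_num), a9']
  · rw [v', setCell_of_ne _ _ _ (by norm_num), a9'']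
  · rw [a' 17 (by norm_num) (by norm_num) (by norm_num), w17]
  · rw [a' 18 (by norm_num) (by norm_num) (by norm_num), w18]
  · rw [a' 19 (by norm_num) (by norm_num) (by norm_num), w19]
  · rw [a' 20 (by norm_num) (by norm_num) (by norm_num), w20]
  · rw [v', setCell_self, a9 19 (by norm_num) (by norm_num), a9 20 (by norm_num) (by norm_num),
      w19, w20]
    rfl
  · rw [a' k (by omega) (by omega) (by omega), wf k hk]

/-- Slot `0` starts at address `3`, where the initial point is supplied, so it need not be moved. -/
theorem view_initState_zero (p : Params n) : view (initState p) 0 = p.x₁ := by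
  ext i
  simp [view, readVec, initState, writeVec]

theorem view_initState_pos (p : Params n) {k : ℕ} (hk : 0 < k) : view (initState p) k = 0 := by
  have h : n ≤ k * n := Nat.le_mul_of_pos_left n hk
  ext i
  rw [view]
  split_ifs
  · rfl
  · simp only [readVec, initState, writeVec]
    rw [dif_neg (by omega), if_neg (by omega), if_neg (by omega), if_neg (by omega)]
    rfl

theorem inv_smul_one {c : ℝ} (hc : c ≠ 0) : (c • (1 : Mat n))⁻¹ = (1 / c) • (1 : Mat n) := by
  apply Matrix.inv_eq_right_inv
  rw [smul_mul_smul_comm, mul_one, mul_one_div_cancel hc, one_smul]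

/-- Initialize the registers and the memory. -/
def setup : Cmd :=
  .seq setupRegs (.seq setupScalars (.seq (diag 40 30) (.seq (diag 41 31) (axpy 11 10 10 32))))

theorem setup_spec (hn : 0 < n) (hεI : 0 < p.εI) :
    ∃ s', Exec env setup (initState p) s' ∧
      Rep hn p (p.εI • 1) (p.εI • 1)⁻¹ p.x₁ p.x₁ s' ∧ s'.reg 1 = p.T ∧ s'.reg 2 = p.K ∧
      s'.reg 42 = 0 ∧ s'.plays = [] ∧ s'.looCalls = 0 ∧ s'.time ≤ 100 * n ^ 2 ∧
      s'.space ≤ memBound n := by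
  obtain ⟨ρ, t, e0, ht, q0, h1, h2, h42⟩ := setupRegs_spec (env := env) (s := initState p) rfl rfl
  set s₀ : State n := { initState p with reg := ρ, time := (initState p).time + t } with hs₀
  have v0 : view s₀ = view (initState p) := view_congr rfl
  obtain ⟨s₁, e1, k1, q1, c11, c12, c13, c17, c18, c19, c20, c21, f1⟩ := setupScalars_spec
    (env := env) (p := p) hn q0 (by simp [hs₀, initState, writeVec])
    (by simp [hs₀, initState, writeVec]) (by simp [hs₀, initState, writeVec]) hεI
  -- The matrix slots are still zero from the initial state, so writing the diagonal completes the
  -- matrix.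
  obtain ⟨s₂, e2, k2, m2, f2⟩ := diag_spec (env := env) (rM := 40) (rs := 30) (kM := 30) q1
    (by norm_num) (by norm_num) (q1.slot 30 le_rfl) (q1.at_zero hn (k := 20) (by norm_num))
    le_rfl (by omega) (by norm_num) (fun i => by
      rw [f1 _ (by omega), v0, view_initState_pos _ (by omega)])
  have q2 := k2.regs (by norm_num) q1
  have a2 : ∀ k < 30, view s₂ k = view s₁ k := fun k hk => f2 k fun i => by omega
  obtain ⟨s₃, e3, k3, m3, f3⟩ := diag_spec (env := env) (rM := 41) (rs := 31) (kM := 30 + n) q2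
    (by norm_num) (by norm_num) q2.inv (q2.at_zero hn (k := 21) (by norm_num))
    (by omega) (by omega) (by norm_num) (fun i => by
      rw [f2 _ (fun j => by have := j.2; omega), f1 _ (by omega), v0,
        view_initState_pos _ (by omega)])
  have q3 := k3.regs (by norm_num) q2
  have a3 : ∀ k < 30, view s₃ k = view s₁ k := fun k hk =>
    (f3 k fun i => by omega).trans (a2 k hk)
  have mat3 : matOf (view s₃) 30 = p.εI • (1 : Mat n) := by
    rw [← c20, ← m2]
    exact matOf_congr fun i => f3 _ fun j => by have := i.2; omega
  have inv3 : matOf (view s₃) (30 + n) = (p.εI • (1 : Mat n))⁻¹ := by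
    rw [m3, a2 21 (by norm_num), c21, inv_smul_one hεI.ne']
  have c3 : Consts hn p (p.εI • (1 : Mat n)) (p.εI • (1 : Mat n))⁻¹ (view s₃) := by
    constructor
    · rw [a3 _ (by norm_num), c11]
    · rw [a3 _ (by norm_num), c12]
    · rw [a3 _ (by norm_num), c13]
    · rw [a3 _ (by norm_num), c17]
    · rw [a3 _ (by norm_num), c18]
    · rw [a3 _ (by norm_num), c19]
    · rw [a3 _ (by norm_num), f1 _ (by norm_num), v0, view_initState_pos _ (by norm_num)]
    · exact mat3
    · exact inv3
  have x3 : view s₃ 0 = p.x₁ := by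
    rw [a3 _ (by norm_num), f1 _ (by norm_num), v0, view_initState_zero]
  obtain ⟨s₄, e4, k4, q4, v4⟩ := axpy_slots (env := env) (d := 1) (a := 0) (b := 0) (k := 22) hn
    q3 (by norm_num) (by norm_num) (by norm_num) (by norm_num) (by norm_num)
  rw [c3.zero, x3] at v4
  have k14 := k1.trans (k2.trans (k3.trans k4))
  refine ⟨s₄, .seq e0 (.seq e1 (.seq e2 (.seq e3 e4))),
    ⟨q4, v4 ▸ c3.update (by norm_num) _, ?_, ?_⟩, ?_, ?_, ?_, k14.plays, k14.looCalls, ?_, ?_⟩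
  · rw [v4, Function.update_of_ne (by norm_num), x3]
  · rw [v4, Function.update_self]; simp
  · rw [k14.reg 1 (by norm_num)]; exact h1
  · rw [k14.reg 2 (by norm_num)]; exact h2
  · rw [k14.reg 42 (by norm_num)]; exact h42
  · have h := k14.time
    have ht0 : s₀.time = t := Nat.zero_add t
    nlinarith
  · refine k14.space.trans (max_le ?_ le_rfl)
    have : n + 3 ≤ memBound n := by rw [memBound]; nlinarith
    exact this

end Setup

/-! ### Total running time and memory. -/

section Program

/-- The whole algorithm. -/
def program : Cmd := .seq setup blocks

theorem program_implements {n : ℕ} {env : Env n} {p : Params n} {r : Run n} (hn : 0 < n)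
    (hr : IsRun env.grad env.loo p r) (hεI : 0 < p.εI) (hε : 0 < p.ε) (hK : 0 < p.K)
    (hT : 0 < p.T) (hKT : p.K ∣ p.T) (hy : ∀ m < p.T / p.K, r.y m ∈ env.dom) {E : ℝ}
    (hcalls : (r.calls (p.T / p.K) : ℝ) ≤ 0.65 * (8 * E + p.T)) (hE : 0 ≤ E) :
    Implements program env p r (800 * ((n : ℝ) ^ 2 * (p.T + E))) (800 * (n : ℝ) ^ 2) := by
  obtain ⟨s, e, rep, h1, h2, h42, hp, hc, ht, hs⟩ := setup_spec (env := env) hn hεI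
  obtain ⟨s', e', g1, g2, g3, g4⟩ := blocks_spec hr hεI hε hK hKT hy rep h1 h2 h42 hp hc
  refine ⟨s', .seq e e', g1, g2, ?_, ?_⟩
  · have hq : 1 ≤ n ^ 2 := Nat.one_le_pow _ _ hn
    have hd : p.T / p.K ≤ p.T := Nat.div_le_self _ _
    set c := r.calls (p.T / p.K)
    have h3 : s'.time ≤ (101 + 18 * p.T + (c + 3 * p.T) * 150) * n ^ 2 := by
      have := Nat.mul_le_mul_right (150 * n ^ 2) (Nat.mul_le_mul_left 3 hd)
      nlinarith
    have h4 : (s'.time : ℝ) ≤ (101 + 18 * p.T + (c + 3 * p.T) * 150) * (n : ℝ) ^ 2 := by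
      exact_mod_cast h3
    have hT' : (1 : ℝ) ≤ p.T := by exact_mod_cast hT
    have hn2 : (0 : ℝ) ≤ (n : ℝ) ^ 2 := by positivity
    -- The calls contribute `150 · 0.65 · 8 = 780` to the coefficient of `E`. Since `T ≥ 1`, the
    -- coefficient of `T` is at most `101 + 18 + 97.5 + 450`; both stay below `800`.
    nlinarith [mul_le_mul_of_nonneg_right hcalls hn2, mul_nonneg hn2 hE]
  · have h3 : s'.space ≤ memBound n := g4.trans (max_le hs le_rfl)
    have h4 : memBound n ≤ 800 * n ^ 2 := by rw [memBound]; nlinarith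
    exact_mod_cast h3.trans h4

end Program

end RealRAM

/-! ### Assembly of the regret and resource bounds. -/

section Main

variable {n d T K : ℕ} {S : Set (Vec n)} {G R α β τ δ L ℓ l : ℝ} {x₁ : Vec n}
  {f : ℕ → Vec n → ℝ} {loo : ℕ → Vec n → Vec n} {r : Run n}

theorem TuningFacts.K_pos (h : TuningFacts d T K G R α τ δ L ℓ l) : 0 < K := by
  have h1 : 0 < τ := by linarith [h.L_ge, h.τ_ge]
  have h2 : 0 < δ := by linarith [h.δ_ge]
  have : (0 : ℝ) < K := by rw [h.K_eq]; positivity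
  exact_mod_cast this

theorem tuned_εI_pos (hG : 0 < G) (h : TuningFacts d T K G R α τ δ L ℓ l) :
    0 < (tuned d T K G R α x₁).εI := by
  have h1 : 0 < τ := by linarith [h.L_ge, h.τ_ge]
  rw [tuned_eq n x₁ h]
  simp only
  positivity

theorem exists_tuned_run (hset : OCOSetup S R G α β T f) (hloo : IsLOO S loo) (hx₁ : x₁ ∈ S)
    (h : TuningFacts d T K G R α τ δ L ℓ l) :
    ∃ r : Run n, IsRun (lossGrad R f) loo (tuned d T K G R α x₁) r :=
  exists_isRun hloo hset.convex hset.compact _ _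
    (tuned_admissible (x₁ := x₁) hset.G_pos hset.R_pos h).1.2.2.1 (tuned_εI_pos hset.G_pos h).le hx₁

theorem tuned_resourceBounds (hn : 0 < n) (hT : 0 < T) (hset : OCOSetup S R G α β T f)
    (hloo : IsLOO S loo) (hx₁ : x₁ ∈ S) (hdn : d ≤ n) (hKT : K ∣ T)
    (h : TuningFacts d T K G R α τ δ L ℓ l)
    (hr : IsRun (lossGrad R f) loo (tuned d T K G R α x₁) r) :
    ResourceBounds RealRAM.program 800 R f loo (tuned d T K G R α x₁) r := by
  have hcalls := tuned_calls_le hset hloo hx₁ hdn h hr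
  obtain ⟨hadm, -⟩ := tuned_admissible (x₁ := x₁) hset.G_pos hset.R_pos h
  have hεI := tuned_εI_pos (x₁ := x₁) hset.G_pos h
  refine ⟨hcalls, RealRAM.program_implements hn hr hεI hadm.2.2.1 h.K_pos hT hKT
    (fun m hm => hr.y_mem hεI hadm.2.2.1 hloo hset.convex hx₁ hset.R_pos hset.subset_ball
      hadm.2.2.2 hm.le) ?_ (by positivity)⟩
  rw [← mul_assoc 8]
  exact hcalls

theorem TuningFacts.rpow_two_thirds (h : TuningFacts d T K G R α τ δ L ℓ l) :
    (T : ℝ) ^ (2 / 3 : ℝ) = τ ^ 2 ∧ (d : ℝ) ^ (2 / 3 : ℝ) = δ ^ 2 := by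
  rw [← h.τ_eq, ← h.δ_eq, ← rpow_third_pow 2 (Nat.cast_nonneg _),
    ← rpow_third_pow 2 (Nat.cast_nonneg _)]
  norm_num

/-- The regret bound for the tuning that depends on `ρ`. -/
theorem tuned_regret_le_self (hset : OCOSetup S R G α β T f) (hloo : IsLOO S loo) (hx₁ : x₁ ∈ S)
    (hKT : K ∣ T) (h : TuningFacts d T K G R α τ δ L ℓ l)
    (hr : IsRun (lossGrad R f) loo (tuned d T K G R α x₁) r) {z : Vec n} (hz : z ∈ S)
    (hd : 1 ≤ d) (hdn : d ≤ n) {Ω : ℝ}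
    (hΩ : tailEigenvalues (lossGrad R f) (tuned d T K G R α x₁) r d = Ω) :
    ∑ t ∈ Finset.range T, f t (r.played K t) - ∑ t ∈ Finset.range T, f t z ≤
      9 * β * R ^ 2 * (T : ℝ) ^ (2 / 3 : ℝ) * ℓ
        + 2 * R * G * (d : ℝ) ^ (1 / 3 : ℝ) * (T : ℝ) ^ (2 / 3 : ℝ)
        + (36 * G * R + 4 / α) * (d : ℝ) ^ (2 / 3 : ℝ) * (T : ℝ) ^ (2 / 3 : ℝ) * ℓ
        + 5 * R * (T : ℝ) ^ (1 / 3 : ℝ) * √Ω * √ℓ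
        + (3 * G * R + 1 / (2 * α)) / ((d : ℝ) ^ (2 / 3 : ℝ) * G ^ 2) * Ω := by
  have hreg := tuned_regret_le hset hloo hx₁ h.K_pos hKT h hr hz hd hdn hΩ
  have hG := hset.G_pos
  have hR := hset.R_pos
  have hα := hset.α_pos
  have hδ0 : 0 < δ := by linarith [h.δ_ge]
  obtain ⟨e1, e2⟩ := h.rpow_two_thirds
  rw [e1, e2, h.τ_eq, h.δ_eq]
  have e3 : (d : ℝ) / δ = δ ^ 2 := by rw [← h.δ_cube]; field_simp
  have e4 : √((d : ℝ) * δ) = δ ^ 2 := by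
    rw [← h.δ_cube, show δ ^ 3 * δ = (δ ^ 2) ^ 2 by ring, Real.sqrt_sq (by positivity)]
  rw [e3, e4, mul_comm (G ^ 2)] at hreg
  refine hreg.trans ?_
  -- For `ρ = d` both `ρ / δ` and `√(ρ δ)` equal `δ²`. Raising `l` to `ℓ` merges the coefficients
  -- `24` and `12` into `36`.
  have := mul_le_mul_of_nonneg_left h.l_le
    (show 0 ≤ (24 * G * R + 4 / α) * δ ^ 2 * τ ^ 2 by positivity)
  linarith

/-- The regret bounds for the tuning that depends on `n`. -/
theorem tuned_regret_le_rank (hset : OCOSetup S R G α β T f) (hloo : IsLOO S loo) (hx₁ : x₁ ∈ S)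
    (hKT : K ∣ T) (h : TuningFacts n T K G R α τ δ L ℓ l)
    (hr : IsRun (lossGrad R f) loo (tuned n T K G R α x₁) r) {z : Vec n} (hz : z ∈ S)
    {ρ : ℕ} (hρ : 1 ≤ ρ) (hρn : ρ ≤ n) {Ω : ℝ}
    (hΩ : tailEigenvalues (lossGrad R f) (tuned n T K G R α x₁) r ρ = Ω) :
    ∑ t ∈ Finset.range T, f t (r.played K t) - ∑ t ∈ Finset.range T, f t z ≤
      9 * β * R ^ 2 * (T : ℝ) ^ (2 / 3 : ℝ) * ℓ
        + 2 * R * G * (n : ℝ) ^ (1 / 3 : ℝ) * (T : ℝ) ^ (2 / 3 : ℝ)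
        + 36 * G * R * (ρ : ℝ) ^ (1 / 2 : ℝ) * (n : ℝ) ^ (1 / 6 : ℝ) * (T : ℝ) ^ (2 / 3 : ℝ) * ℓ
        + 4 / α * ρ * (n : ℝ) ^ (-(1 / 3) : ℝ) * (T : ℝ) ^ (2 / 3 : ℝ) * l
        + 5 * R * (T : ℝ) ^ (1 / 3 : ℝ) * √Ω * √ℓ
        + (3 * G * R + 1 / (2 * α)) / (G ^ 2 * (n : ℝ) ^ (2 / 3 : ℝ)) * Ω := by
  have hreg := tuned_regret_le hset hloo hx₁ h.K_pos hKT h hr hz hρ hρn hΩ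
  have hG := hset.G_pos
  have hR := hset.R_pos
  have hτ0 : 0 < τ := by linarith [h.L_ge, h.τ_ge]
  have hδ0 : 0 < δ := by linarith [h.δ_ge]
  have hℓ0 : 0 < ℓ := by linarith [h.L_le, h.L_ge]
  obtain ⟨e1, e2⟩ := h.rpow_two_thirds
  have e3 : (n : ℝ) ^ (-(1 / 3) : ℝ) = δ⁻¹ := by rw [Real.rpow_neg (Nat.cast_nonneg _), h.δ_eq]
  have e4 : (n : ℝ) ^ (1 / 6 : ℝ) = √δ := by
    rw [Real.sqrt_eq_rpow, ← h.δ_eq, ← Real.rpow_mul (Nat.cast_nonneg _)]; norm_num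
  rw [e1, e2, e3, e4, h.τ_eq, h.δ_eq, ← Real.sqrt_eq_rpow]
  rw [Real.sqrt_mul (Nat.cast_nonneg _)] at hreg
  -- From `ρ ≤ n = δ³` one gets `ρ² ≤ ρ δ³`. So the part of the determinant term with `GR` joins the
  -- square-root term, again giving `24 + 12 = 36`.
  have hle : (ρ : ℝ) / δ ≤ √ρ * √δ := by
    have hρδ : (ρ : ℝ) ≤ δ ^ 3 := by rw [h.δ_cube]; exact_mod_cast hρn
    rw [div_le_iff₀ hδ0, ← Real.sqrt_mul (Nat.cast_nonneg _)]
    refine le_of_sq_le_sq ?_ (by positivity)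
    rw [mul_pow, Real.sq_sqrt (by positivity)]
    nlinarith [mul_le_mul_of_nonneg_left hρδ (Nat.cast_nonneg (α := ℝ) ρ)]
  have hlog : (ρ : ℝ) / δ * l ≤ √ρ * √δ * ℓ :=
    (mul_le_mul_of_nonneg_left h.l_le (by positivity)).trans
      (mul_le_mul_of_nonneg_right hle hℓ0.le)
  have := mul_le_mul_of_nonneg_left hlog (show 0 ≤ 24 * G * R * τ ^ 2 by positivity)
  have e5 : (4 / α) * ρ * δ⁻¹ * τ ^ 2 * l = (4 / α) * (ρ / δ) * τ ^ 2 * l := by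
    rw [div_eq_mul_inv (ρ : ℝ)]; ring
  rw [e5]
  refine hreg.trans ?_
  linarith

end Main

theorem mainTheorem1 :
    ∃ c : ℝ, 0 < c ∧ ∃ (P : RealRAM.Cmd) (C : ℝ), 0 < C ∧
      ∀ (n T K : ℕ) (S : Set (Vec n)) (R G α β : ℝ) (f : ℕ → Vec n → ℝ)
        (loo : ℕ → Vec n → Vec n) (x₁ : Vec n),
        0 < n → 0 < T → OCOSetup S R G α β T f → IsLOO S loo → x₁ ∈ S →
        -- the tuning that depends on `n`
        ((K : ℝ) = blockLength n T → K ∣ T → horizonThreshold c n T G R α ≤ T →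
          (tuned n T K G R α x₁).Admissible G R α ∧
          (∃ r : Run n, IsRun (lossGrad R f) loo (tuned n T K G R α x₁) r) ∧
          ∀ r : Run n, IsRun (lossGrad R f) loo (tuned n T K G R α x₁) r →
            (∃ reg : ℝ, IsRegret S T f (r.played K) reg ∧
              reg ≤ 9 * β * R ^ 2 * (T : ℝ) ^ (2 / 3 : ℝ) * logFactor c T G R α
                + 2 * R * G * (n : ℝ) ^ (1 / 3 : ℝ) * (T : ℝ) ^ (2 / 3 : ℝ)
                + (36 * G * R + 4 / α) * (n : ℝ) ^ (2 / 3 : ℝ) * (T : ℝ) ^ (2 / 3 : ℝ)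
                  * logFactor c T G R α ∧
              ∀ ρ : ℕ, 1 ≤ ρ → ρ ≤ n →
                reg ≤ 9 * β * R ^ 2 * (T : ℝ) ^ (2 / 3 : ℝ) * logFactor c T G R α
                  + 2 * R * G * (n : ℝ) ^ (1 / 3 : ℝ) * (T : ℝ) ^ (2 / 3 : ℝ)
                  + 36 * G * R * (ρ : ℝ) ^ (1 / 2 : ℝ) * (n : ℝ) ^ (1 / 6 : ℝ)
                    * (T : ℝ) ^ (2 / 3 : ℝ) * logFactor c T G R α
                  + 4 / α * ρ * (n : ℝ) ^ (-(1 / 3) : ℝ) * (T : ℝ) ^ (2 / 3 : ℝ)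
                    * Real.log (c * (T : ℝ) ^ (1 / 3 : ℝ))
                  + 5 * R * (T : ℝ) ^ (1 / 3 : ℝ)
                    * √(tailEigenvalues (lossGrad R f) (tuned n T K G R α x₁) r ρ)
                    * √(logFactor c T G R α)
                  + (3 * G * R + 1 / (2 * α)) / (G ^ 2 * (n : ℝ) ^ (2 / 3 : ℝ))
                    * tailEigenvalues (lossGrad R f) (tuned n T K G R α x₁) r ρ) ∧
            ResourceBounds P C R f loo (tuned n T K G R α x₁) r) ∧
        -- the tuning that depends on `ρ`
        (∀ ρ : ℕ, 1 ≤ ρ → ρ ≤ n →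
          (K : ℝ) = blockLength ρ T → K ∣ T → horizonThreshold c ρ T G R α ≤ T →
          (tuned ρ T K G R α x₁).Admissible G R α ∧
          (∃ r : Run n, IsRun (lossGrad R f) loo (tuned ρ T K G R α x₁) r) ∧
          ∀ r : Run n, IsRun (lossGrad R f) loo (tuned ρ T K G R α x₁) r →
            (∃ reg : ℝ, IsRegret S T f (r.played K) reg ∧
              reg ≤ 9 * β * R ^ 2 * (T : ℝ) ^ (2 / 3 : ℝ) * logFactor c T G R α
                + 2 * R * G * (ρ : ℝ) ^ (1 / 3 : ℝ) * (T : ℝ) ^ (2 / 3 : ℝ)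
                + (36 * G * R + 4 / α) * (ρ : ℝ) ^ (2 / 3 : ℝ) * (T : ℝ) ^ (2 / 3 : ℝ)
                  * logFactor c T G R α
                + 5 * R * (T : ℝ) ^ (1 / 3 : ℝ)
                  * √(tailEigenvalues (lossGrad R f) (tuned ρ T K G R α x₁) r ρ)
                  * √(logFactor c T G R α)
                + (3 * G * R + 1 / (2 * α)) / ((ρ : ℝ) ^ (2 / 3 : ℝ) * G ^ 2)
                  * tailEigenvalues (lossGrad R f) (tuned ρ T K G R α x₁) r ρ) ∧
            ResourceBounds P C R f loo (tuned ρ T K G R α x₁) r) := by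
  -- `1000` is the constant of `tuningFacts`; `800` is the constant of `program_implements`.
  refine ⟨1000, by norm_num, RealRAM.program, 800, by norm_num, ?_⟩
  intro n T K S R G α β f loo x₁ hn hT hset hloo hx₁
  obtain ⟨z, hz, hmin⟩ := exists_best_point hset
  refine ⟨fun hK hKT hT₀ => ?_, fun ρ hρ hρn hK hKT hT₀ => ?_⟩
  · have h := tuningFacts hn hT hset.G_pos hset.R_pos hset.α_pos hK hKT hT₀
    refine ⟨(tuned_admissible hset.G_pos hset.R_pos h).1, exists_tuned_run hset hloo hx₁ h,
      fun r hr => ⟨⟨_, ⟨z, hz, hmin, rfl⟩, ?_, fun ρ hρ hρn => ?_⟩,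
        tuned_resourceBounds hn hT hset hloo hx₁ le_rfl hKT h hr⟩⟩
    -- With `d = ρ = n` the tail is zero, and simplification removes the two terms that contain it.
    · simpa using tuned_regret_le_self hset hloo hx₁ hKT h hr hz hn le_rfl
        (tailEigenvalues_dim _ _ _)
    · exact tuned_regret_le_rank hset hloo hx₁ hKT h hr hz hρ hρn rfl
  · have h := tuningFacts hρ hT hset.G_pos hset.R_pos hset.α_pos hK hKT hT₀
    exact ⟨(tuned_admissible hset.G_pos hset.R_pos h).1, exists_tuned_run hset hloo hx₁ h,
      fun r hr => ⟨⟨_, ⟨z, hz, hmin, rfl⟩, tuned_regret_le_self hset hloo hx₁ hKT h hr hz hρ hρn rfl⟩,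
        tuned_resourceBounds hn hT hset hloo hx₁ hρn hKT h hr⟩⟩
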